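/- Let $\mathbb{K}$ be an imaginary quadratic field with discriminant $D$, $D_{\mathbb K}=|D|$, class number $h$ and $w$ roots of unity. Let $\zeta_{\mathbb K}$ be its Dedekind zeta function, $\chi_D=\left(\frac{D}{\cdot}\right)$ the Kronecker symbol with $L$-function $L(s,\chi_D)$, and $\sigma_{\mathbb K,a}(n)=\sum_{d\mid n}v_{\mathbb K}(d)\,d^{a}$, where $v_{\mathbb K}(d)$ is the number of non-zero integral ideals of norm $d$. Let $\gamma$ be Euler's constant, $A=8\pi/D_{\mathbb K}$, and let $\mathrm{ker},\mathrm{kei}$ be the Kelvin functions, $\mathrm{ker}(x)+i\,\mathrm{kei}(x)=K_0(xe^{\pi i/4})$ for $x>0$, extended holomorphically to $|\arg z|<\pi/4$, that is $$\mathrm{ker}(z)=\tfrac12\left(K_0(ze^{\pi i/4})+K_0(ze^{-\pi i/4})\right),\qquad \mathrm{kei}(z)=\tfrac1{2i}\left(K_0(ze^{\pi i/4})-K_0(ze^{-\pi i/4})\right),$$ where $K_0$ is the modified Bessel function of the second kind. Let $m\ge 1$ be an integer and let $\alpha,\beta\in\mathbb C$ satisfy $\Re(\alpha),\Re(\beta)>0$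 and $\alpha\beta=\frac{D_{\mathbb K}^2}{16\pi^2}$. Then, with principal branches of powers, square roots and logarithms, all infinite series below converge absolutely and $$\begin{aligned} &\alpha^{-m}\left\{\frac12\zeta_{\mathbb K}(2m+1)+\sum_{n=1}^\infty\sigma_{\mathbb K,-2m-1}(n)e^{-A\pi n\alpha}-\frac1{A\pi\alpha}\zeta_{\mathbb K}(2m+2)\right\}\\ &=(-\beta)^{-m}\left\{\frac{\pi h}{w\sqrt{D_{\mathbb K}}}\zeta(2m+1)-\frac4{\sqrt{D_{\mathbb K}}}\sum_{n=1}^\infty\frac{\sigma_{\mathbb K,2m+1}(n)}{n^{2m+1}}\mathrm{kei}\left(A\sqrt{\pi n\beta}\right)-\frac{2h}{wA\pi\beta}\zeta(2m+2)\right\}\\ &\quad+\frac4{D_{\mathbb K}}\sum_{k=1}^{m}(-1)^{m-k}\zeta(2m+2-2k)\,\zeta_{\mathbb K}(2k)\,\alpha^{1-k}\beta^{k-m} \end{aligned}$$ and $$\begin{aligned} &\alpha^{-(m-\frac12)}\left\{\frac12\zeta_{\mathbb K}(2m)+\sum_{n=1}^\infty\sigma_{\mathbb K,-2m}(n)e^{-A\pi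 n\alpha}-\frac1{A\pi\alpha}\zeta_{\mathbb K}(2m+1)\right\}\\ &=(-1)^{m+1}\beta^{-(m-\frac12)}\left\{\frac1\pi\zeta(2m)\left(\left(\gamma+\log\left(\frac{A\beta}2\right)\right)L(1,\chi_D)+L'(1,\chi_D)\right)\right.\\ &\qquad\left.-\frac4{\sqrt{D_{\mathbb K}}}\sum_{n=1}^\infty\frac{\sigma_{\mathbb K,2m}(n)}{n^{2m}}\mathrm{ker}\left(A\sqrt{\pi n\beta}\right)-\frac{2h}{w\sqrt{D_{\mathbb K}}}\zeta'(2m)\right\}\\ &\quad+\frac1\pi\sum_{k=1}^{m-1}(-1)^{m-1-k}\zeta(2m-2k)\,\zeta_{\mathbb K}(2k+1)\,\alpha^{-k}\beta^{k-m+\frac12}. \end{aligned}$$ -/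

import Mathlib

open scoped NumberField

noncomputable section

/-- The absolute value `D_K` of the discriminant of a number field `K`. -/
def absDiscr (K : Type*) [Field K] [NumberField K] : ℕ :=
  (NumberField.discr K).natAbs

/-- `v_K(d)`: the number of integral ideals of norm `d` (for `d ≥ 1` these are non-zero ideals). -/
def idealCount (K : Type*) [Field K] [NumberField K] (d : ℕ) : ℕ :=
  Nat.card {I : Ideal (𝓞 K) // Ideal.absNorm I = d}

/-- The divisor function `σ_{K,a}(n) = ∑_{d ∣ n} v_K(d) d ^ a`. -/
def sigmaK (K : Type*) [Field K] [NumberField K] (a : ℂ) (n : ℕ) : ℂ :=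
  ∑ d ∈ n.divisors, (idealCount K d : ℂ) * (d : ℂ) ^ a

/-- The Kronecker symbol `(D / n)` for `n ≥ 0`: the Jacobi symbol at the odd part of `n` times the
appropriate power of `(D / 2)`, which is `0`, `1`, `-1` according as `D` is even,
`D ≡ ±1 mod 8`, `D ≡ ±3 mod 8`. -/
def kroneckerSymbol (D : ℤ) (n : ℕ) : ℤ :=
  if n = 0 then (if D.natAbs = 1 then 1 else 0)
  else ZMod.χ₈ (D : ZMod 8) ^ padicValNat 2 n * jacobiSym D (n / 2 ^ padicValNat 2 n)

/-- The quadratic character `χ_D = (D / ·)` of `K`, `D = disc K`. It has period `|D|` on the natural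
numbers, so that it is given by its values at the residues `0, …, |D| - 1`. -/
def quadChar (K : Type*) [Field K] [NumberField K] (a : ZMod (absDiscr K)) : ℂ :=
  (kroneckerSymbol (NumberField.discr K) a.val : ℂ)

/-- `L(s, χ_D)`: the analytic continuation of `∑_{n ≥ 1} χ_D(n) n ^ (-s)`. -/
def quadL (K : Type*) [Field K] [NumberField K] (s : ℂ) : ℂ :=
  haveI : NeZero (absDiscr K) := ⟨Int.natAbs_ne_zero.mpr (NumberField.discr_ne_zero K)⟩
  ZMod.LFunction (quadChar K) s

/-- The modified Bessel function of the second kind of order `ν`, for `Re z > 0`. -/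
def besselK (ν z : ℂ) : ℂ :=
  ∫ t in Set.Ioi (0 : ℝ), Complex.exp (-z * Complex.cosh t) * Complex.cosh (ν * t)

/-- The Kelvin function `ker = ker_0`, for `|arg z| < π / 4`. For real `x > 0` it is the real part
of `K_0 (x e ^ (π i / 4))`; the formula below is the holomorphic extension. -/
def kelvinKer (z : ℂ) : ℂ :=
  (besselK 0 (z * Complex.exp (Real.pi * Complex.I / 4)) +
    besselK 0 (z * Complex.exp (-(Real.pi * Complex.I / 4)))) / 2

/-- The Kelvin function `kei = kei_0`, for `|arg z| < π / 4`. For real `x > 0` it is the imaginary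
part of `K_0 (x e ^ (π i / 4))`; the formula below is the holomorphic extension. -/
def kelvinKei (z : ℂ) : ℂ :=
  (besselK 0 (z * Complex.exp (Real.pi * Complex.I / 4)) -
    besselK 0 (z * Complex.exp (-(Real.pi * Complex.I / 4)))) / (2 * Complex.I)

/-- At real arguments the two values of `K_0` are complex conjugates. -/
theorem besselK_zero_conj (x : ℝ) :
    besselK 0 ((x : ℂ) * Complex.exp (-(Real.pi * Complex.I / 4))) =
      (starRingEnd ℂ) (besselK 0 ((x : ℂ) * Complex.exp (Real.pi * Complex.I / 4))) := by
  unfold besselK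
  rw [← integral_conj]
  congr 1
  funext t
  simp only [map_mul, ← Complex.exp_conj, ← Complex.cosh_conj, map_neg, map_zero, map_div₀,
    Complex.conj_ofReal, Complex.conj_I, map_ofNat]
  congr 6
  ring

/-- `ker x = Re K_0 (x e ^ (π i / 4))` for real `x`. -/
theorem kelvinKer_ofReal (x : ℝ) :
    kelvinKer x = ((besselK 0 ((x : ℂ) * Complex.exp (Real.pi * Complex.I / 4))).re : ℂ) := by
  rw [kelvinKer, besselK_zero_conj, Complex.re_eq_add_conj]

/-- `kei x = Im K_0 (x e ^ (π i / 4))` for real `x`. -/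
theorem kelvinKei_ofReal (x : ℝ) :
    kelvinKei x = ((besselK 0 ((x : ℂ) * Complex.exp (Real.pi * Complex.I / 4))).im : ℂ) := by
  rw [kelvinKei, besselK_zero_conj, Complex.im_eq_sub_conj]

/-- The constant `A = 8 π / D_K`. -/
def constA (K : Type*) [Field K] [NumberField K] : ℝ :=
  8 * Real.pi / absDiscr K

end

/-! Both identities come from one double series summed in two orders. Write v for `idealCount K`, y
= Aπα and q = Aβ/2, so that yq = 2π and q² = β/α. After expanding σ, the brace on the left with
exponent e is ∑_d v(d) d^(-e) (1/(e^(dy) - 1) + 1/2 - 1/(dy)). The partial fractions of this kernel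
(`hasSum_partialFraction_exp`) turn it into (2/y) ∑_{d,k} v(d) d^(1-e) / (d² + (qk)²), which is
`lambert_eq`. Summing over d first instead, a truncated geometric expansion (`inv_pow_mul_inv_add`)
peels off the even powers of d. This produces the finite sums of products ζ · ζ_K and leaves ∑
v(d)/(d² + c²) for e odd and ∑ v(d)/(d(d² + c²)) for e even, at c = qk.

Up to a factor these are ψ(ic) - ψ(-ic) and ψ(ic) + ψ(-ic) for the digamma analogue ψ(z) = ∑ v(n)
(1/n - 1/(n + z)). The key is `psi_eq`: ψ(z) = c₀/z + ρ log z + const - (4π/√D) ∑ v(n)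
K₀(4π√(nz)/√D), with c₀ = h/w and ρ = L(1, χ_D). For 0 < a ≤ b the increment ψ(b) - ψ(a) is an
integral of S(t) = ∑ v(n) e^(-nt) against e^(-at) - e^(-bt). The functional equation of c₀ + S
splits it into the term in c₀, a Frullani logarithm and Bessel integrals (`realPsi_sub_realPsi`).
Letting b tend to infinity fixes the constant as ργ + lim (ζ_K(s) - ρζ(s)) for s → 1+, that is ργ +
L'(1, χ_D). The identity theorem extends the formula to the slit plane, and √(±ic) = √c e^(±πi/4)
brings in kei and ker.

The arithmetic input is twofold. The functional equation is proved class by class: ideals of a class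
correspond, up to units, to the non-zero elements of an ideal in the inverse class, which is a plane
lattice, and Poisson summation applies (`exists_hasSum_idealCount_exp`). The factorization ζ_K = ζ ·
L amounts to v = 1 * χ_D, checked on prime powers through the splitting of primes
(`idealCount_eq_sum_kroneckerSymbol`); compared with the residue of ζ_K at 1 it gives ρ = L(1, χ_D).
-/

section

open scoped NumberField nonZeroDivisors
open Filter Topology MeasureTheory Set

/-! ### The ring of integers of a quadratic field -/

/-- The ring of integers of a quadratic field has an integral basis `1, ω`. -/
theorem exists_basis_one_omega (K : Type*) [Field K] [NumberField K]
    (hK : Module.finrank ℚ K = 2) :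
    ∃ b : Module.Basis (Fin 2) ℤ (𝓞 K), b 0 = 1 := by
  have hr : Module.finrank ℤ (𝓞 K) = 2 := by rw [NumberField.RingOfIntegers.rank, hK]
  let e : Module.Basis (Fin 2) ℤ (𝓞 K) := Module.finBasisOfFinrankEq ℤ (𝓞 K) hr
  set x := e.repr 1 0 with hx
  set y := e.repr 1 1 with hy
  have h1 : (1 : 𝓞 K) = x • e 0 + y • e 1 := by
    conv_lhs => rw [← e.sum_repr 1]
    rw [Fin.sum_univ_two]
  -- A prime dividing both coordinates of 1 would be a unit of `𝓞 K`, although it generates an ideal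
  -- of norm p².
  have hcop : IsCoprime x y := by
    rw [Int.isCoprime_iff_gcd_eq_one]
    by_contra hg
    obtain ⟨p, hp, hpd⟩ := Nat.exists_prime_and_dvd hg
    have hpx : (p : ℤ) ∣ x := (Int.natCast_dvd_natCast.mpr hpd).trans (Int.gcd_dvd_left _ _)
    have hpy : (p : ℤ) ∣ y := (Int.natCast_dvd_natCast.mpr hpd).trans (Int.gcd_dvd_right _ _)
    obtain ⟨x', hx'⟩ := hpx
    obtain ⟨y', hy'⟩ := hpy
    have hu : ((p : ℕ) : 𝓞 K) ∣ 1 := ⟨x' • e 0 + y' • e 1, by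
      rw [h1, hx', hy', mul_smul, mul_smul, ← smul_add, zsmul_eq_mul]
      simp⟩
    have hn : Ideal.absNorm (Ideal.span {((p : ℕ) : 𝓞 K)}) = p ^ 2 := by
      rw [Ideal.absNorm_span_singleton]
      have := Algebra.norm_algebraMap (S := 𝓞 K) (p : ℤ)
      simp only [algebraMap_int_eq, eq_intCast, Int.cast_natCast, hr] at this
      rw [this, Int.natAbs_pow, Int.natAbs_natCast]
    rw [Ideal.span_singleton_eq_top.mpr (isUnit_of_dvd_one hu), Ideal.absNorm_top] at hn
    have := hp.two_le
    nlinarith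
  obtain ⟨u, v, huv⟩ := hcop
  -- The Bézout coefficients complete the row (x, y) to a matrix of determinant 1.
  let f : Fin 2 → 𝓞 K := ![1, (-v) • e 0 + u • e 1]
  have hdet : IsUnit (e.det f) := by
    have : e.det f = 1 := by
      rw [Module.Basis.det_apply, Matrix.det_fin_two]
      simp [f, Module.Basis.toMatrix_apply, ← hx, ← hy, -zsmul_eq_mul]
      linarith
    rw [this]; exact isUnit_one
  obtain ⟨hli, hsp⟩ := e.is_basis_iff_det.mpr hdet
  exact ⟨Module.Basis.mk hli hsp.ge, by simp [f]⟩

section QuadraticBasis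

variable {K : Type*} [Field K] (b : Module.Basis (Fin 2) ℤ (𝓞 K))

theorem eq_repr_add_repr_mul (hb : b 0 = 1) (x : 𝓞 K) :
    x = (b.repr x 0 : 𝓞 K) + (b.repr x 1 : 𝓞 K) * b 1 := by
  conv_lhs => rw [← b.sum_repr x]
  rw [Fin.sum_univ_two, hb, zsmul_eq_mul, zsmul_eq_mul, mul_one]

theorem repr_intCast_add_mul (hb : b 0 = 1) (x y : ℤ) :
    b.repr ((x : 𝓞 K) + (y : 𝓞 K) * b 1) 0 = x ∧ b.repr ((x : 𝓞 K) + (y : 𝓞 K) * b 1) 1 = y := by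
  have : (x : 𝓞 K) + (y : 𝓞 K) * b 1 = x • b 0 + y • b 1 := by
    rw [hb, zsmul_eq_mul, zsmul_eq_mul, mul_one]
  rw [this]
  simp [-zsmul_eq_mul]

/-- The trace of `ω`. -/
noncomputable def omegaTrace : ℤ := b.repr (b 1 * b 1) 1

/-- The norm of `ω`. -/
noncomputable def omegaNorm : ℤ := -b.repr (b 1 * b 1) 0

theorem omega_mul_self (hb : b 0 = 1) :
    b 1 * b 1 = (omegaTrace b : 𝓞 K) * b 1 - (omegaNorm b : 𝓞 K) := by
  rw [omegaTrace, omegaNorm]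
  conv_lhs => rw [eq_repr_add_repr_mul b hb (b 1 * b 1)]
  push_cast
  ring

/-- The trace form has Gram determinant 2(t² - 2n) - t² in the basis 1, ω. The discriminant thus
becomes that of X² - tX + n, which is what links the splitting of primes to the Kronecker symbol. -/
theorem discr_eq_omega [NumberField K] (hb : b 0 = 1) :
    NumberField.discr K = omegaTrace b ^ 2 - 4 * omegaNorm b := by
  rw [← NumberField.discr_eq_discr K b, Algebra.discr_def, Matrix.det_fin_two]
  simp only [Algebra.traceMatrix_apply, Algebra.traceForm_apply, hb, one_mul, mul_one]
  have h1 : Algebra.trace ℤ (𝓞 K) 1 = 2 := by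
    rw [Algebra.trace_eq_matrix_trace b]
    simp
  have h2 : Algebra.trace ℤ (𝓞 K) (b 1) = omegaTrace b := by
    rw [Algebra.trace_eq_matrix_trace b, Matrix.trace_fin_two, Algebra.leftMulMatrix_eq_repr_mul,
      Algebra.leftMulMatrix_eq_repr_mul, hb, mul_one, omegaTrace]
    simp
  have h3 : Algebra.trace ℤ (𝓞 K) (b 1 * b 1) = omegaTrace b ^ 2 - 2 * omegaNorm b := by
    have : b 1 * b 1 = omegaTrace b • b 1 - omegaNorm b • (1 : 𝓞 K) := by
      rw [omega_mul_self b hb, zsmul_eq_mul, zsmul_eq_mul, mul_one]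
    rw [this, map_sub, map_smul, map_smul, h1, h2, smul_eq_mul, smul_eq_mul]
    ring
  rw [h1, h2, h3]
  ring

/-- Reduction of `a + b ω` modulo a prime of degree one: evaluation at a root of the minimal
polynomial of `ω` modulo `p`. -/
noncomputable def evalRoot (p : ℕ) (r : ZMod p)
    (hr : r * r = (omegaTrace b : ZMod p) * r - (omegaNorm b : ZMod p)) (hb : b 0 = 1) :
    𝓞 K →+* ZMod p where
  toFun x := (b.repr x 0 : ZMod p) + (b.repr x 1 : ZMod p) * r
  map_one' := by
    rw [← hb]
    simp
  map_mul' x y := by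
    have h := repr_intCast_add_mul b hb
      (b.repr x 0 * b.repr y 0 - omegaNorm b * (b.repr x 1 * b.repr y 1))
      (b.repr x 0 * b.repr y 1 + b.repr x 1 * b.repr y 0
        + omegaTrace b * (b.repr x 1 * b.repr y 1))
    have hxy : x * y =
        ((b.repr x 0 * b.repr y 0 - omegaNorm b * (b.repr x 1 * b.repr y 1) : ℤ) : 𝓞 K)
        + ((b.repr x 0 * b.repr y 1 + b.repr x 1 * b.repr y 0
        + omegaTrace b * (b.repr x 1 * b.repr y 1) : ℤ) : 𝓞 K) * b 1 := by
      conv_lhs => rw [eq_repr_add_repr_mul b hb x, eq_repr_add_repr_mul b hb y]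
      push_cast
      linear_combination ((b.repr x 1 : 𝓞 K) * (b.repr y 1 : 𝓞 K)) * omega_mul_self b hb
    rw [hxy, h.1, h.2]
    push_cast
    linear_combination (-(b.repr x 1 : ZMod p) * (b.repr y 1 : ZMod p)) * hr
  map_zero' := by simp
  map_add' x y := by simp; ring

theorem evalRoot_apply_omega (hb : b 0 = 1) (p : ℕ) (r : ZMod p)
    (hr : r * r = (omegaTrace b : ZMod p) * r - (omegaNorm b : ZMod p)) :
    evalRoot b p r hr hb (b 1) = r := by
  simp [evalRoot]

theorem absNorm_ker_evalRoot [NumberField K] (hb : b 0 = 1) (p : ℕ) [NeZero p] (r : ZMod p)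
    (hr : r * r = (omegaTrace b : ZMod p) * r - (omegaNorm b : ZMod p)) :
    Ideal.absNorm (RingHom.ker (evalRoot b p r hr hb)) = p := by
  have hsurj : Function.Surjective (evalRoot b p r hr hb) := fun a ↦ ⟨(a.val : 𝓞 K), by simp⟩
  rw [Ideal.absNorm_apply, Submodule.cardQuot_apply]
  rw [Nat.card_congr (RingHom.quotientKerEquivOfSurjective hsurj).toEquiv, Nat.card_zmod]

/-- The ideals of prime norm `p` correspond to the roots modulo `p` of the minimal polynomial of
`ω`. -/
theorem idealCount_prime_eq_card_roots [NumberField K] (hb : b 0 = 1) (p : ℕ) [hp : Fact p.Prime] :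
    idealCount K p =
      Nat.card {r : ZMod p // r * r = (omegaTrace b : ZMod p) * r - (omegaNorm b : ZMod p)} := by
  rw [idealCount]
  symm
  refine Nat.card_congr (Equiv.ofBijective
    (fun r ↦ ⟨RingHom.ker (evalRoot b p r.1 r.2 hb), absNorm_ker_evalRoot b hb p r.1 r.2⟩) ⟨?_, ?_⟩)
  · rintro ⟨r, hr⟩ ⟨r', hr'⟩ h
    have h' : RingHom.ker (evalRoot b p r hr hb) = RingHom.ker (evalRoot b p r' hr' hb) :=
      congrArg Subtype.val h
    -- The kernel remembers the root: ω - r lies in it, and evaluating at the other root r' gives r'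
    -- - r.
    have hmem : b 1 - (r.val : 𝓞 K) ∈ RingHom.ker (evalRoot b p r hr hb) := by
      rw [RingHom.mem_ker, map_sub, evalRoot_apply_omega b hb, map_natCast]
      simp
    rw [h', RingHom.mem_ker, map_sub, evalRoot_apply_omega b hb, map_natCast, ZMod.natCast_val,
      ZMod.cast_id', id_eq, sub_eq_zero] at hmem
    exact Subtype.ext hmem.symm
  · rintro ⟨I, hI⟩
    have hpI : (p : 𝓞 K) ∈ I := by rw [← hI]; exact Ideal.absNorm_mem I
    have hcard : Nat.card (𝓞 K ⧸ I) = p := by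
      rw [← hI, Ideal.absNorm_apply, Submodule.cardQuot_apply]
    have hchar : ((p : ℕ) : 𝓞 K ⧸ I) = 0 := by
      rw [← map_natCast (Ideal.Quotient.mk I)]
      exact Ideal.Quotient.eq_zero_iff_mem.mpr hpI
    have hnt : Nontrivial (𝓞 K ⧸ I) := by
      apply Ideal.Quotient.nontrivial_iff.mpr
      rintro rfl
      rw [Ideal.absNorm_top] at hI
      exact hp.out.one_lt.ne hI
    have hcp : CharP (𝓞 K ⧸ I) p := by
      rw [CharP.charP_iff_prime_eq_zero hp.out]
      exact hchar
    have hfin : Finite (𝓞 K ⧸ I) := Nat.finite_of_card_ne_zero (by rw [hcard]; exact hp.out.ne_zero)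
    -- A quotient with p elements is canonically `ZMod p`, so the class of ω there is the required
    -- root.
    have hbij : Function.Bijective (ZMod.castHom dvd_rfl (𝓞 K ⧸ I) : ZMod p →+* 𝓞 K ⧸ I) := by
      refine (Nat.bijective_iff_injective_and_card _).mpr ⟨RingHom.injective _, ?_⟩
      rw [hcard, Nat.card_zmod]
    obtain ⟨r, hr⟩ := hbij.2 (Ideal.Quotient.mk I (b 1))
    have hroot : r * r = (omegaTrace b : ZMod p) * r - (omegaNorm b : ZMod p) := by
      apply hbij.1
      rw [map_mul, map_sub, map_mul, hr, map_intCast, map_intCast, ← map_mul, omega_mul_self b hb,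
        map_sub, map_mul, map_intCast, map_intCast]
    refine ⟨⟨r, hroot⟩, Subtype.ext ?_⟩
    change RingHom.ker (evalRoot b p r hroot hb) = I
    ext x
    rw [RingHom.mem_ker, ← Ideal.Quotient.eq_zero_iff_mem]
    have : Ideal.Quotient.mk I x = ZMod.castHom dvd_rfl (𝓞 K ⧸ I) (evalRoot b p r hroot hb x) := by
      conv_lhs => rw [eq_repr_add_repr_mul b hb x]
      rw [map_add, map_mul, map_intCast, map_intCast, ← hr]
      simp [evalRoot]
    rw [this, map_eq_zero_iff _ hbij.1]

end QuadraticBasis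

/-! ### Counting ideals of given norm -/


theorem natCast_isCoprime {K : Type*} [Field K] {m n : ℕ} (h : m.Coprime n) :
    IsCoprime (Ideal.span {(m : 𝓞 K)}) (Ideal.span {(n : 𝓞 K)}) := by
  rw [Ideal.isCoprime_span_singleton_iff]
  have := (Nat.isCoprime_iff_coprime.mpr h).map (Int.castRingHom (𝓞 K))
  simpa using this

section IdealCount

variable (K : Type*) [Field K] [NumberField K]

theorem idealCount_eq_ncard (n : ℕ) :
    idealCount K n = {I : Ideal (𝓞 K) | Ideal.absNorm I = n}.ncard := rfl

theorem idealCount_one : idealCount K 1 = 1 := by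
  rw [idealCount_eq_ncard, Set.ncard_eq_one]
  exact ⟨⊤, by ext I; simp [Ideal.absNorm_eq_one_iff]⟩

variable {K} in
theorem ne_bot_of_absNorm_ne_zero {I : Ideal (𝓞 K)} (h : Ideal.absNorm I ≠ 0) : I ≠ ⊥ := by
  rintro rfl
  simp at h

variable {K} in
-- Since n lies in J, the ideals J and (m) are comaximal, and adding (m) cancels the factor J. A
-- product of ideals of coprime norms therefore determines its factors.
theorem mul_sup_span_eq {m n : ℕ} (h : m.Coprime n) {I J : Ideal (𝓞 K)}
    (hI : Ideal.absNorm I = m) (hJ : Ideal.absNorm J = n) :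
    I * J ⊔ Ideal.span {(m : 𝓞 K)} = I := by
  have hmI : Ideal.span {(m : 𝓞 K)} ≤ I := by
    rw [Ideal.span_singleton_le_iff_mem, ← hI]; exact Ideal.absNorm_mem I
  have hnJ : Ideal.span {(n : 𝓞 K)} ≤ J := by
    rw [Ideal.span_singleton_le_iff_mem, ← hJ]; exact Ideal.absNorm_mem J
  have hJm : J ⊔ Ideal.span {(m : 𝓞 K)} = ⊤ := by
    rw [eq_top_iff, ← (Ideal.isCoprime_iff_sup_eq.mp (natCast_isCoprime (K := K) h)), sup_comm]
    exact sup_le_sup_right hnJ _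
  refine le_antisymm (sup_le Ideal.mul_le_left hmI) ?_
  calc I = I * (J ⊔ Ideal.span {(m : 𝓞 K)}) := by rw [hJm, Ideal.mul_top]
    _ = I * J ⊔ I * Ideal.span {(m : 𝓞 K)} := Ideal.mul_sup _ _ _
    _ ≤ _ := sup_le_sup_left Ideal.mul_le_right _

variable {K} in
-- This recovers the factorization: expanding the product leaves only multiples of I and (mn) ⊆ I,
-- while I = I((m) + (n)) gives the other inclusion.
theorem sup_span_mul_sup_span {m n : ℕ} (h : m.Coprime n) {I : Ideal (𝓞 K)}
    (hI : Ideal.absNorm I = m * n) :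
    (I ⊔ Ideal.span {(m : 𝓞 K)}) * (I ⊔ Ideal.span {(n : 𝓞 K)}) = I := by
  have hmem : Ideal.span {(m : 𝓞 K)} * Ideal.span {(n : 𝓞 K)} ≤ I := by
    rw [Ideal.span_singleton_mul_span_singleton, Ideal.span_singleton_le_iff_mem, ← Nat.cast_mul,
      ← hI]
    exact Ideal.absNorm_mem I
  refine le_antisymm ?_ ?_
  · rw [Ideal.sup_mul, Ideal.mul_sup, Ideal.mul_sup]
    exact sup_le (sup_le Ideal.mul_le_left Ideal.mul_le_left) (sup_le Ideal.mul_le_right hmem)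
  · calc I = I * (Ideal.span {(m : 𝓞 K)} ⊔ Ideal.span {(n : 𝓞 K)}) := by
          rw [Ideal.isCoprime_iff_sup_eq.mp (natCast_isCoprime h), Ideal.mul_top]
      _ = Ideal.span {(m : 𝓞 K)} * I ⊔ I * Ideal.span {(n : 𝓞 K)} := by
          rw [Ideal.mul_sup, mul_comm I (Ideal.span {(m : 𝓞 K)})]
      _ ≤ _ := sup_le (Ideal.mul_mono le_sup_right le_sup_left)
          (Ideal.mul_mono le_sup_left le_sup_right)

theorem absNorm_span_natCast (hK : Module.finrank ℚ K = 2) (k : ℕ) :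
    Ideal.absNorm (Ideal.span {(k : 𝓞 K)}) = k * k := by
  rw [Ideal.absNorm_span_singleton]
  have := Algebra.norm_algebraMap (S := 𝓞 K) (k : ℤ)
  simp only [algebraMap_int_eq, eq_intCast, Int.cast_natCast, NumberField.RingOfIntegers.rank,
    hK] at this
  rw [this, Int.natAbs_pow, Int.natAbs_natCast, sq]

/-- Multiplication of ideals is a bijection from pairs of norms (m, n) to ideals of norm mn, with
inverse I ↦ (I + (m), I + (n)). -/
theorem idealCount_mul (hK : Module.finrank ℚ K = 2) {m n : ℕ} (hm : m ≠ 0) (hn : n ≠ 0)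
    (h : m.Coprime n) :
    idealCount K (m * n) = idealCount K m * idealCount K n := by
  have hnorm (k : ℕ) : Ideal.absNorm (Ideal.span {(k : 𝓞 K)}) = k ^ 2 := by
    rw [absNorm_span_natCast K hK, sq]
  rw [idealCount, idealCount, idealCount, ← Nat.card_prod]
  symm
  refine Nat.card_congr (Equiv.ofBijective (fun x ↦ ⟨x.1.1 * x.2.1, by
    rw [map_mul, x.1.2, x.2.2]⟩) ⟨?_, ?_⟩)
  · rintro ⟨⟨I, hI⟩, ⟨J, hJ⟩⟩ ⟨⟨I', hI'⟩, ⟨J', hJ'⟩⟩ hxy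
    have hIJ : I * J = I' * J' := congrArg Subtype.val hxy
    have h1 : I = I' := by rw [← mul_sup_span_eq h hI hJ, hIJ, mul_sup_span_eq h hI' hJ']
    have h2 : J = J' := by
      rw [← mul_sup_span_eq h.symm hJ hI, mul_comm J, hIJ, mul_comm I',
        mul_sup_span_eq h.symm hJ' hI']
    subst h1 h2
    rfl
  · rintro ⟨I, hI⟩
    have hprod := sup_span_mul_sup_span h hI
    have hN : Ideal.absNorm (I ⊔ Ideal.span {(m : 𝓞 K)}) *
        Ideal.absNorm (I ⊔ Ideal.span {(n : 𝓞 K)}) = m * n := by rw [← map_mul, hprod, hI]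
    have h1 : Ideal.absNorm (I ⊔ Ideal.span {(m : 𝓞 K)}) ∣ m ^ 2 := by
      rw [← hnorm]; exact Ideal.absNorm_dvd_absNorm_of_le le_sup_right
    have h2 : Ideal.absNorm (I ⊔ Ideal.span {(n : 𝓞 K)}) ∣ n ^ 2 := by
      rw [← hnorm]; exact Ideal.absNorm_dvd_absNorm_of_le le_sup_right
    -- The norm of I + (m) divides m² and mn, hence m by coprimality. Likewise the other norm
    -- divides n, and the product mn forces equality in both.
    have h1' : Ideal.absNorm (I ⊔ Ideal.span {(m : 𝓞 K)}) ∣ m :=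
      Nat.Coprime.dvd_of_dvd_mul_right (Nat.Coprime.coprime_dvd_left h1 (h.pow_left 2))
        (Dvd.intro _ hN)
    have h2' : Ideal.absNorm (I ⊔ Ideal.span {(n : 𝓞 K)}) ∣ n :=
      Nat.Coprime.dvd_of_dvd_mul_left (Nat.Coprime.coprime_dvd_left h2 (h.symm.pow_left 2))
        (Dvd.intro_left _ hN)
    have hle1 := Nat.le_of_dvd (Nat.pos_of_ne_zero hm) h1'
    have hle2 := Nat.le_of_dvd (Nat.pos_of_ne_zero hn) h2'
    have e1 : Ideal.absNorm (I ⊔ Ideal.span {(m : 𝓞 K)}) = m := by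
      by_contra hne
      have hlt := lt_of_le_of_ne hle1 hne
      have : Ideal.absNorm (I ⊔ Ideal.span {(m : 𝓞 K)}) *
        Ideal.absNorm (I ⊔ Ideal.span {(n : 𝓞 K)}) < m * n :=
        Nat.mul_lt_mul_of_lt_of_le hlt hle2 (Nat.pos_of_ne_zero hn)
      omega
    have e2 : Ideal.absNorm (I ⊔ Ideal.span {(n : 𝓞 K)}) = n := by
      rw [e1] at hN
      exact Nat.eq_of_mul_eq_mul_left (Nat.pos_of_ne_zero hm) hN
    exact ⟨⟨⟨_, e1⟩, ⟨_, e2⟩⟩, Subtype.ext hprod⟩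

variable {K} in
theorem image_mul_setOf_absNorm (P : Ideal (𝓞 K)) {a : ℕ} (ha : a ≠ 0)
    (hP : Ideal.absNorm P = a) (m : ℕ) :
    Set.image (P * ·) {I : Ideal (𝓞 K) | Ideal.absNorm I = m} =
      {I : Ideal (𝓞 K) | Ideal.absNorm I = a * m ∧ P ∣ I} := by
  ext I
  constructor
  · rintro ⟨J, hJ, rfl⟩
    exact ⟨by rw [map_mul, hP, hJ], Dvd.intro _ rfl⟩
  · rintro ⟨hI, J, rfl⟩
    refine ⟨J, ?_, rfl⟩
    rw [map_mul, hP] at hI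
    exact Nat.eq_of_mul_eq_mul_left (Nat.pos_of_ne_zero ha) hI

variable {K} in
-- Division by P is injective on ideals, so counting multiples of P lowers the norm by N(P). The
-- recursion for prime powers rests on this.
theorem ncard_setOf_absNorm_dvd (P : Ideal (𝓞 K)) {a : ℕ} (ha : a ≠ 0)
    (hP : Ideal.absNorm P = a) (m : ℕ) :
    {I : Ideal (𝓞 K) | Ideal.absNorm I = a * m ∧ P ∣ I}.ncard = idealCount K m := by
  rw [← image_mul_setOf_absNorm P ha hP, Set.ncard_image_of_injective, idealCount_eq_ncard]
  exact mul_right_injective₀ (ne_bot_of_absNorm_ne_zero (by rw [hP]; exact ha))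

variable {K} in
/-- Every non-trivial ideal of `p`-power norm is divisible by a prime ideal dividing `p`. -/
theorem exists_isPrime_dvd_of_absNorm_eq_pow {p k : ℕ} (hp : p.Prime) {I : Ideal (𝓞 K)}
    (hI : Ideal.absNorm I = p ^ (k + 1)) :
    ∃ Q : Ideal (𝓞 K), Q.IsPrime ∧ Q ∣ I ∧ Q ∣ Ideal.span {(p : 𝓞 K)} := by
  have hne : I ≠ ⊤ := by
    rintro rfl
    rw [Ideal.absNorm_top] at hI
    exact (Nat.one_lt_pow (Nat.succ_ne_zero k) hp.one_lt).ne hI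
  obtain ⟨Q, hQ, hIQ⟩ := Ideal.exists_le_maximal I hne
  refine ⟨Q, hQ.isPrime, Ideal.dvd_iff_le.mpr hIQ, Ideal.dvd_iff_le.mpr ?_⟩
  rw [Ideal.span_singleton_le_iff_mem]
  have : ((p : 𝓞 K)) ^ (k + 1) ∈ Q := by
    rw [← Nat.cast_pow, ← hI]; exact hIQ (Ideal.absNorm_mem I)
  exact hQ.isPrime.mem_of_pow_mem _ this

/-- The recursion for the number of ideals of prime power norm in a quadratic field. -/
theorem idealCount_prime_pow_add_two (hK : Module.finrank ℚ K = 2) {p : ℕ} (hp : p.Prime)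
    {c : ℤ} (hc : c = -1 ∨ c = 0 ∨ c = 1) (hpc : (idealCount K p : ℤ) = 1 + c) (k : ℕ) :
    (idealCount K (p ^ (k + 2)) : ℤ) =
      (1 + c) * idealCount K (p ^ (k + 1)) - c * idealCount K (p ^ k) := by
  have hpp := absNorm_span_natCast K hK p
  have hp0 := hp.ne_zero
  have hprime {P : Ideal (𝓞 K)} (hP : Ideal.absNorm P = p) : Prime P := by
    have hP' : P.IsPrime := Ideal.isPrime_of_irreducible_absNorm (hP ▸ hp)
    exact (Ideal.prime_iff_isPrime (ne_bot_of_absNorm_ne_zero (by rw [hP]; exact hp0))).mpr hP'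
  have hconj {P : Ideal (𝓞 K)} (hP : Ideal.absNorm P = p) :
      ∃ Q, Ideal.span {(p : 𝓞 K)} = P * Q ∧ Ideal.absNorm Q = p := by
    obtain ⟨Q, hQ⟩ : P ∣ Ideal.span {(p : 𝓞 K)} := by
      rw [Ideal.dvd_iff_le, Ideal.span_singleton_le_iff_mem, ← hP]
      exact Ideal.absNorm_mem P
    refine ⟨Q, hQ, ?_⟩
    rw [hQ, map_mul, hP] at hpp
    exact Nat.eq_of_mul_eq_mul_left hp.pos hpp
  have hmaxdvd {P Q : Ideal (𝓞 K)} (hQ : Q.IsPrime) (hP : Prime P) (hPQ : Q ∣ P) : Q = P := by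
    have hQ' : Q.IsMaximal := by
      refine Ideal.IsPrime.isMaximal hQ ?_
      rintro rfl
      rw [← Ideal.zero_eq_bot] at hPQ
      exact hP.ne_zero (zero_dvd_iff.mp hPQ)
    have hP' : P.IsMaximal :=
      Ideal.IsPrime.isMaximal (Ideal.isPrime_of_prime hP) hP.ne_zero
    exact (hP'.eq_of_le hQ'.ne_top (Ideal.dvd_iff_le.mp hPQ)).symm
  have hprimeQ {Q : Ideal (𝓞 K)} (hQ : Q.IsPrime) (hQp : Q ∣ Ideal.span {(p : 𝓞 K)}) : Prime Q := by
    refine (Ideal.prime_iff_isPrime ?_).mpr hQ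
    rintro rfl
    rw [← Ideal.zero_eq_bot, zero_dvd_iff, Ideal.zero_eq_bot, Ideal.span_singleton_eq_bot] at hQp
    exact hp0 (by exact_mod_cast hQp)
  -- The three cases are inert, ramified and split primes, with 0, 1 and 2 ideals of norm p.
  rcases hc with rfl | rfl | rfl
  · have h0 : idealCount K p = 0 := by omega
    -- Inert case: a prime factor Q of I divides (p), and its norm is neither 1 nor p. So Q = (p)
    -- and every such I is divisible by (p).
    have hset : {I : Ideal (𝓞 K) | Ideal.absNorm I = p ^ (k + 2)} =
        {I : Ideal (𝓞 K) | Ideal.absNorm I = p * p * p ^ k ∧ Ideal.span {(p : 𝓞 K)} ∣ I} := by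
      ext I
      have hpow : p ^ (k + 2) = p * p * p ^ k := by ring
      simp only [Set.mem_ofPred_eq, hpow, iff_self_and]
      rw [← hpow]
      intro hI
      obtain ⟨Q, hQ, hQI, R, hR⟩ := exists_isPrime_dvd_of_absNorm_eq_pow hp hI
      have hNQ : Ideal.absNorm Q * Ideal.absNorm R = p * p := by rw [← map_mul, ← hR, hpp]
      have hdiv : Ideal.absNorm Q ∣ p ^ 2 := by rw [sq, ← hNQ]; exact Dvd.intro _ rfl
      obtain ⟨j, hj, hQj⟩ := (Nat.dvd_prime_pow hp).mp hdiv
      have hcount : ∀ J : Ideal (𝓞 K), Ideal.absNorm J ≠ p := by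
        intro J hJ
        rw [idealCount_eq_ncard, Set.ncard_eq_zero (Ideal.finite_setOfPred_absNorm_eq p)] at h0
        have : J ∈ ({I : Ideal (𝓞 K) | Ideal.absNorm I = p}) := hJ
        rw [h0] at this
        exact this
      interval_cases j
      · rw [pow_zero, Ideal.absNorm_eq_one_iff] at hQj
        exact absurd hQj hQ.ne_top
      · rw [pow_one] at hQj
        exact absurd hQj (hcount Q)
      · rw [hQj, sq] at hNQ
        have hR1 : Ideal.absNorm R = 1 := by
          have : 0 < p * p := Nat.mul_pos hp.pos hp.pos
          exact Nat.eq_of_mul_eq_mul_left this (by rw [hNQ, mul_one])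
        rw [Ideal.absNorm_eq_one_iff] at hR1
        rw [hR, hR1, Ideal.mul_top]
        exact hQI
    rw [idealCount_eq_ncard K (p ^ (k + 2)), hset,
      ncard_setOf_absNorm_dvd _ (mul_ne_zero hp0 hp0) hpp]
    ring
  · have h1 : idealCount K p = 1 := by omega
    rw [idealCount_eq_ncard, Set.ncard_eq_one] at h1
    obtain ⟨P, hPset⟩ := h1
    have hPiff (J : Ideal (𝓞 K)) : Ideal.absNorm J = p ↔ J = P := by
      have := Set.ext_iff.mp hPset J
      simpa using this
    have hP : Ideal.absNorm P = p := (hPiff P).mpr rfl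
    obtain ⟨Q', hQ', hQ'n⟩ := hconj hP
    obtain rfl := (hPiff Q').mp hQ'n
    have hset : {I : Ideal (𝓞 K) | Ideal.absNorm I = p ^ (k + 2)} =
        {I : Ideal (𝓞 K) | Ideal.absNorm I = p * p ^ (k + 1) ∧ Q' ∣ I} := by
      ext I
      have hpow : p ^ (k + 2) = p * p ^ (k + 1) := by ring
      simp only [Set.mem_ofPred_eq, hpow, iff_self_and]
      rw [← hpow]
      intro hI
      obtain ⟨Q, hQ, hQI, hQp⟩ := exists_isPrime_dvd_of_absNorm_eq_pow hp hI
      have hQprime := hprimeQ hQ hQp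
      rw [hQ'] at hQp
      have : Q ∣ Q' := (hQprime.dvd_or_dvd hQp).elim id id
      rwa [← hmaxdvd hQ (hprime hP) this]
    rw [idealCount_eq_ncard K (p ^ (k + 2)), hset, ncard_setOf_absNorm_dvd _ hp0 hP]
    ring
  · have h2 : idealCount K p = 2 := by omega
    rw [idealCount_eq_ncard, Set.ncard_eq_two] at h2
    obtain ⟨P, P', hne, hPset⟩ := h2
    have hPiff (J : Ideal (𝓞 K)) : Ideal.absNorm J = p ↔ J = P ∨ J = P' := by
      have := Set.ext_iff.mp hPset J
      simpa using this
    have hP : Ideal.absNorm P = p := (hPiff P).mpr (Or.inl rfl)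
    have hP' : Ideal.absNorm P' = p := (hPiff P').mpr (Or.inr rfl)
    have hndvd : ¬ P' ∣ P := fun h ↦
      hne (hmaxdvd (Ideal.isPrime_of_prime (hprime hP')) (hprime hP) h).symm
    have hspan : Ideal.span {(p : 𝓞 K)} = P * P' := by
      obtain ⟨Q, hQ, hQn⟩ := hconj hP
      obtain ⟨R, hR, hRn⟩ := hconj hP'
      rcases (hPiff Q).mp hQn with rfl | rfl
      · have : P' ∣ Q * Q := by rw [← hQ, hR]; exact Dvd.intro _ rfl
        exact absurd ((hprime hP').dvd_or_dvd this) (by simpa using hndvd)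
      · exact hQ
    have hset : {I : Ideal (𝓞 K) | Ideal.absNorm I = p ^ (k + 2)} =
        {I : Ideal (𝓞 K) | Ideal.absNorm I = p * p ^ (k + 1) ∧ P ∣ I} ∪
        {I : Ideal (𝓞 K) | Ideal.absNorm I = p * p ^ (k + 1) ∧ P' ∣ I} := by
      ext I
      have hpow : p ^ (k + 2) = p * p ^ (k + 1) := by ring
      simp only [Set.mem_ofPred_eq, Set.mem_union, ← hpow, ← and_or_left, iff_self_and]
      intro hI
      obtain ⟨Q, hQ, hQI, hQp⟩ := exists_isPrime_dvd_of_absNorm_eq_pow hp hI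
      have hQprime := hprimeQ hQ hQp
      rw [hspan] at hQp
      rcases hQprime.dvd_or_dvd hQp with h | h
      · exact Or.inl (hmaxdvd hQ (hprime hP) h ▸ hQI)
      · exact Or.inr (hmaxdvd hQ (hprime hP') h ▸ hQI)
    -- Ideals divisible by both primes are the multiples of PP' = (p); inclusion-exclusion then
    -- produces the negative term of the recursion.
    have h_inter : {I : Ideal (𝓞 K) | Ideal.absNorm I = p * p ^ (k + 1) ∧ P ∣ I} ∩
        {I : Ideal (𝓞 K) | Ideal.absNorm I = p * p ^ (k + 1) ∧ P' ∣ I} =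
        {I : Ideal (𝓞 K) | Ideal.absNorm I = p * p * p ^ k ∧ Ideal.span {(p : 𝓞 K)} ∣ I} := by
      ext I
      have hpow : p * p ^ (k + 1) = p * p * p ^ k := by ring
      simp only [Set.mem_ofPred_eq, Set.mem_inter_iff, hpow, hspan]
      constructor
      · rintro ⟨⟨h1, J, rfl⟩, -, h3⟩
        refine ⟨h1, mul_dvd_mul_left _ (((hprime hP').dvd_or_dvd h3).resolve_left hndvd)⟩
      · rintro ⟨h1, h2⟩
        exact ⟨⟨h1, (Dvd.intro _ rfl).trans h2⟩, h1, (Dvd.intro_left _ rfl).trans h2⟩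
    have hfin (R : Ideal (𝓞 K)) :
        {I : Ideal (𝓞 K) | Ideal.absNorm I = p * p ^ (k + 1) ∧ R ∣ I}.Finite :=
      (Ideal.finite_setOfPred_absNorm_eq (p * p ^ (k + 1))).subset fun I hI ↦ hI.1
    have hcard := Set.ncard_union_add_ncard_inter _ _ (hfin P) (hfin P')
    rw [← hset, h_inter, ← idealCount_eq_ncard, ncard_setOf_absNorm_dvd _ hp0 hP,
      ncard_setOf_absNorm_dvd _ hp0 hP', ncard_setOf_absNorm_dvd _ (mul_ne_zero hp0 hp0) hpp]
      at hcard
    push_cast [← hcard]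
    zify at hcard
    linarith

end IdealCount

/-! ### The Kronecker symbol -/

theorem kroneckerSymbol_one (D : ℤ) : kroneckerSymbol D 1 = 1 := by
  simp [kroneckerSymbol]

theorem kroneckerSymbol_of_odd (D : ℤ) {n : ℕ} (hn : Odd n) :
    kroneckerSymbol D n = jacobiSym D n := by
  have h0 : n ≠ 0 := by rintro rfl; simp at hn
  have h1 : padicValNat 2 n = 0 :=
    padicValNat.eq_zero_of_not_dvd (by rw [← even_iff_two_dvd, Nat.not_even_iff_odd]; exact hn)
  simp [kroneckerSymbol, h0, h1]

theorem kroneckerSymbol_two (D : ℤ) : kroneckerSymbol D 2 = ZMod.χ₈ (D : ZMod 8) := by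
  simp [kroneckerSymbol]

theorem kroneckerSymbol_mul (D : ℤ) {m n : ℕ} (hm : m ≠ 0) (hn : n ≠ 0) :
    kroneckerSymbol D (m * n) = kroneckerSymbol D m * kroneckerSymbol D n := by
  have hdiv : m * n / 2 ^ padicValNat 2 (m * n) =
      (m / 2 ^ padicValNat 2 m) * (n / 2 ^ padicValNat 2 n) := by
    rw [padicValNat.mul hm hn, pow_add,
      Nat.mul_div_mul_comm pow_padicValNat_dvd pow_padicValNat_dvd]
  simp only [kroneckerSymbol, mul_ne_zero hm hn, hm, hn, if_false]
  rw [hdiv, padicValNat.mul hm hn, pow_add]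
  have h1 : NeZero (m / 2 ^ padicValNat 2 m) :=
    ⟨(Nat.div_pos (Nat.le_of_dvd (Nat.pos_of_ne_zero hm) pow_padicValNat_dvd) (by positivity)).ne'⟩
  have h2 : NeZero (n / 2 ^ padicValNat 2 n) :=
    ⟨(Nat.div_pos (Nat.le_of_dvd (Nat.pos_of_ne_zero hn) pow_padicValNat_dvd) (by positivity)).ne'⟩
  rw [jacobiSym.mul_right]
  ring

theorem kroneckerSymbol_pow (D : ℤ) {m : ℕ} (hm : m ≠ 0) (k : ℕ) :
    kroneckerSymbol D (m ^ k) = kroneckerSymbol D m ^ k := by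
  induction k with
  | zero => simp [kroneckerSymbol_one]
  | succ k ih => rw [pow_succ, kroneckerSymbol_mul D (pow_ne_zero k hm) hm, ih, pow_succ]

theorem kroneckerSymbol_trichotomy (D : ℤ) {p : ℕ} (hp : p.Prime) :
    kroneckerSymbol D p = -1 ∨ kroneckerSymbol D p = 0 ∨ kroneckerSymbol D p = 1 := by
  rcases hp.eq_two_or_odd' with rfl | hodd
  · rw [kroneckerSymbol_two]
    generalize (D : ZMod 8) = x
    revert x
    decide
  · rw [kroneckerSymbol_of_odd D hodd]
    rcases jacobiSym.trichotomy D p with h | h | h <;> simp [h]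

/-- For odd `n`, the symbol with an even discriminant is periodic. -/
theorem jacobiSym_four_mul (d : ℤ) {n : ℕ} (hn : Odd n) :
    jacobiSym (4 * d) n = jacobiSym d n := by
  have h4 : jacobiSym 4 n = 1 := by
    have : (4 : ℤ) = 2 ^ 2 := by norm_num
    rw [this]
    exact jacobiSym.sq_one' (by
      rw [Int.gcd_eq_natAbs]; simpa using (Nat.coprime_two_left.mpr hn))
  rw [jacobiSym.mul_left, h4, one_mul]

theorem kroneckerSymbol_even_of_four_dvd (d : ℤ) {n : ℕ} (hn : Even n) :
    kroneckerSymbol (4 * d) n = 0 := by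
  rcases eq_or_ne n 0 with rfl | h0
  · simp only [kroneckerSymbol, if_true]
    rw [if_neg]
    omega
  · have hχ : ∀ x : ZMod 8, ZMod.χ₈ (4 * x) = 0 := by decide
    obtain ⟨m, rfl⟩ := hn.two_dvd
    rw [kroneckerSymbol_mul _ two_ne_zero (by omega), kroneckerSymbol_two]
    push_cast
    rw [hχ, zero_mul]

/-- Quadratic reciprocity moves n to the upper place, where periodicity modulo N is visible. By
multiplicativity it suffices to treat odd arguments and 2; the sign of `jacobiSym.neg` cancels that
of reciprocity because N ≡ 3 mod 4. -/
theorem kroneckerSymbol_neg_eq_jacobiSym {N : ℕ} (hN : N % 4 = 3) {n : ℕ} (hn : n ≠ 0) :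
    kroneckerSymbol (-(N : ℤ)) n = jacobiSym n N := by
  have hNodd : Odd N := Nat.odd_iff.mpr (by omega)
  have hodd {k : ℕ} (hk : Odd k) : kroneckerSymbol (-(N : ℤ)) k = jacobiSym k N := by
    rw [kroneckerSymbol_of_odd _ hk, jacobiSym.neg _ hk]
    rcases Nat.odd_mod_four_iff.mp (Nat.odd_iff.mp hk) with h | h
    · rw [jacobiSym.quadratic_reciprocity_one_mod_four' hNodd h,
        ZMod.χ₄_nat_one_mod_four h, one_mul]
    · rw [jacobiSym.quadratic_reciprocity_three_mod_four hN h, ZMod.χ₄_nat_three_mod_four h]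
      ring
  have h2 : kroneckerSymbol (-(N : ℤ)) 2 = jacobiSym 2 N := by
    have hχ : ∀ x : ZMod 8, ZMod.χ₈ (-x) = ZMod.χ₈ x := by decide
    rw [kroneckerSymbol_two, jacobiSym.at_two hNodd]
    push_cast
    exact hχ _
  obtain ⟨e, m, hm, rfl⟩ := Nat.exists_eq_two_pow_mul_odd hn
  rw [kroneckerSymbol_mul _ (by positivity) (by rintro rfl; simp at hm),
    kroneckerSymbol_pow _ two_ne_zero, h2, hodd hm]
  push_cast
  rw [jacobiSym.mul_left, jacobiSym.pow_left]

/-- The Kronecker symbol of a negative discriminant `D` is periodic modulo `|D|`. -/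
theorem kroneckerSymbol_mod {D : ℤ} (hneg : D < 0) (hD : D % 4 = 0 ∨ D % 4 = 1) {n : ℕ}
    (hn : n ≠ 0) : kroneckerSymbol D (n % D.natAbs) = kroneckerSymbol D n := by
  rcases hD with hD | hD
  · obtain ⟨d, rfl⟩ := Int.dvd_of_emod_eq_zero hD
    have habs : (4 * d).natAbs = 4 * d.natAbs := by rw [Int.natAbs_mul]; rfl
    have hd : d ≠ 0 := by omega
    have hmod : n % (4 * d).natAbs % 2 = n % 2 := by
      rw [habs]
      exact Nat.mod_mod_of_dvd _ (Dvd.intro (2 * d.natAbs) (by ring))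
    rcases Nat.even_or_odd n with he | ho
    · rw [kroneckerSymbol_even_of_four_dvd d he, kroneckerSymbol_even_of_four_dvd d]
      rw [Nat.even_iff] at he ⊢
      omega
    · have ho' : Odd (n % (4 * d).natAbs) := by
        rw [Nat.odd_iff] at ho ⊢
        omega
      rw [kroneckerSymbol_of_odd _ ho, kroneckerSymbol_of_odd _ ho', jacobiSym_four_mul d ho,
        jacobiSym_four_mul d ho', habs, ← jacobiSym.mod_right d ho]
  · obtain ⟨N, rfl⟩ : ∃ N : ℕ, D = -(N : ℤ) := ⟨D.natAbs, by omega⟩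
    have hN : N % 4 = 3 := by omega
    rw [Int.natAbs_neg, Int.natAbs_natCast, kroneckerSymbol_neg_eq_jacobiSym hN hn,
      jacobiSym.mod_left n N]
    -- The residue 0 is outside the reach of reciprocity. There the defining value is 0, because N >
    -- 1, which matches the Jacobi symbol.
    rcases eq_or_ne (n % N) 0 with h0 | h0
    · rw [h0, ← Int.natCast_mod, h0]
      have h1 : 1 < N := by omega
      rw [Nat.cast_zero, jacobiSym.zero_left h1]
      simp only [kroneckerSymbol, if_true]
      rw [if_neg]
      omega
    · rw [kroneckerSymbol_neg_eq_jacobiSym hN h0, Int.natCast_mod]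

/-! ### Ideals of prime norm and the Kronecker symbol -/

/-- At p = 2 both sides depend only on t and n modulo 8, so a finite check decides the matter. -/
theorem card_roots_zmod_two (t n : ZMod 8) :
    (Nat.card {r : ZMod 2 // r * r = (ZMod.castHom (by norm_num : 2 ∣ 8) (ZMod 2) t) * r -
      (ZMod.castHom (by norm_num : 2 ∣ 8) (ZMod 2) n)} : ℤ) = 1 + ZMod.χ₈ (t ^ 2 - 4 * n) := by
  rw [Nat.card_eq_fintype_card]
  revert t n
  decide

section

variable {K : Type*} [Field K] [NumberField K]

/-- For odd p, completing the square by r ↦ 2r - t matches the roots of X² - tX + n with the square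
roots of its discriminant, which the Legendre symbol counts. The prime 2 is covered by the table
above. -/
theorem idealCount_prime (hK : Module.finrank ℚ K = 2) {p : ℕ} (hp : p.Prime) :
    (idealCount K p : ℤ) = 1 + kroneckerSymbol (NumberField.discr K) p := by
  have := Fact.mk hp
  obtain ⟨b, hb⟩ := exists_basis_one_omega K hK
  rw [idealCount_prime_eq_card_roots b hb p, discr_eq_omega b hb]
  generalize omegaTrace b = t
  generalize omegaNorm b = n
  rcases hp.eq_two_or_odd' with rfl | hodd
  · rw [kroneckerSymbol_two]
    have := card_roots_zmod_two t n
    simp only [map_intCast] at this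
    rw [this]
    push_cast
    rfl
  · have hp2 : p ≠ 2 := by rintro rfl; exact absurd hodd (by decide)
    rw [kroneckerSymbol_of_odd _ hodd, ← jacobiSym.legendreSym.to_jacobiSym, add_comm,
      ← legendreSym.card_sqrts p hp2, Nat.card_eq_fintype_card]
    congr 1
    rw [Fintype.card_subtype]
    have h2 : (2 : ZMod p) ≠ 0 := by
      intro h
      have h2' : ((2 : ℕ) : ZMod p) = 0 := by exact_mod_cast h
      rw [ZMod.natCast_eq_zero_iff] at h2'
      exact hp2 ((Nat.prime_dvd_prime_iff_eq hp Nat.prime_two).mp h2')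
    refine Finset.card_bij (fun r _ ↦ 2 * r - (t : ZMod p)) ?_ ?_ ?_
    · intro r hr
      simp only [Finset.mem_filter, Finset.mem_univ, true_and] at hr
      simp only [Set.mem_toFinset, Set.mem_ofPred_eq]
      push_cast
      linear_combination 4 * hr
    · intro r _ r' _ h
      exact mul_left_cancel₀ h2 (sub_left_injective h)
    · intro y hy
      simp only [Set.mem_toFinset, Set.mem_ofPred_eq] at hy
      push_cast at hy
      have hinv : (2 : ZMod p) * 2⁻¹ = 1 := mul_inv_cancel₀ h2
      refine ⟨2⁻¹ * (y + t), ?_, ?_⟩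
      · simp only [Finset.mem_filter, Finset.mem_univ, true_and]
        have h4 : (4 : ZMod p) ≠ 0 := by
          have : (4 : ZMod p) = 2 * 2 := by norm_num
          rw [this]; exact mul_ne_zero h2 h2
        have e : 2 * (2⁻¹ * (y + t)) = y + t := by rw [← mul_assoc, hinv, one_mul]
        generalize (2 : ZMod p)⁻¹ * (y + t) = r at e
        refine mul_left_cancel₀ h4 ?_
        have hy' : y = 2 * r - t := by rw [e]; ring
        rw [hy'] at hy
        linear_combination hy
      · rw [← mul_assoc, hinv, one_mul]; ring

/-- `v_K(n) = ∑_{d ∣ n} χ_D(d)`. -/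
theorem idealCount_eq_sum_kroneckerSymbol (hK : Module.finrank ℚ K = 2) {n : ℕ} (hn : n ≠ 0) :
    (idealCount K n : ℤ) = ∑ d ∈ n.divisors, kroneckerSymbol (NumberField.discr K) d := by
  -- The zero ideal is counted by `idealCount K 0`, so the value at 0 has to be overridden; the same
  -- is done for χ.
  let v : ArithmeticFunction ℤ := ⟨fun n ↦ if n = 0 then 0 else idealCount K n, rfl⟩
  let χ : ArithmeticFunction ℤ :=
    ⟨fun n ↦ if n = 0 then 0 else kroneckerSymbol (NumberField.discr K) n, rfl⟩
  have hχ : χ.IsMultiplicative := by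
    rw [ArithmeticFunction.IsMultiplicative.iff_ne_zero]
    refine ⟨by simp [χ, kroneckerSymbol_one], fun {m n} hm hn _ ↦ ?_⟩
    simp [χ, hm, hn, kroneckerSymbol_mul]
  have hv : v.IsMultiplicative := by
    rw [ArithmeticFunction.IsMultiplicative.iff_ne_zero]
    refine ⟨by simp [v, idealCount_one], fun {m n} hm hn h ↦ ?_⟩
    simp [v, hm, hn, idealCount_mul K hK hm hn h]
  have hζ : ((ArithmeticFunction.zeta : ArithmeticFunction ℤ) * χ).IsMultiplicative :=
    ArithmeticFunction.isMultiplicative_zeta.natCast.mul hχ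
  have hζval (n : ℕ) (hn : n ≠ 0) :
      ((ArithmeticFunction.zeta : ArithmeticFunction ℤ) * χ) n =
      ∑ d ∈ n.divisors, kroneckerSymbol (NumberField.discr K) d := by
    rw [ArithmeticFunction.coe_zeta_mul_apply]
    refine Finset.sum_congr rfl fun d hd ↦ ?_
    have : d ≠ 0 := (Nat.pos_of_mem_divisors hd).ne'
    simp [χ, this]
  have heq : v = (ArithmeticFunction.zeta : ArithmeticFunction ℤ) * χ := by
    rw [ArithmeticFunction.IsMultiplicative.eq_iff_eq_on_prime_powers v hv _ hζ]
    intro p i hp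
    have hp0 := hp.ne_zero
    rw [hζval _ (pow_ne_zero i hp0), Nat.sum_divisors_prime_pow hp]
    simp only [v, ArithmeticFunction.coe_mk, pow_ne_zero i hp0, if_false, kroneckerSymbol_pow _ hp0]
    set c := kroneckerSymbol (NumberField.discr K) p with hc
    have hrec := idealCount_prime_pow_add_two K hK hp (kroneckerSymbol_trichotomy _ hp)
      (idealCount_prime hK hp)
    rw [← hc] at hrec
    -- The recursion has order two, so two consecutive values are carried through the induction.
    suffices h : (idealCount K (p ^ i) : ℤ) = ∑ j ∈ Finset.range (i + 1), c ^ j ∧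
        (idealCount K (p ^ (i + 1)) : ℤ) = ∑ j ∈ Finset.range (i + 2), c ^ j from h.1
    induction i with
    | zero =>
      refine ⟨by simp [idealCount_one], ?_⟩
      simp [idealCount_prime hK hp, Finset.sum_range_succ, hc]
    | succ i ih =>
      refine ⟨ih.2, ?_⟩
      rw [hrec, ih.1, ih.2, Finset.sum_range_succ _ (i + 2), Finset.sum_range_succ _ (i + 1)]
      ring
  have := congrArg (fun f : ArithmeticFunction ℤ ↦ f n) heq
  simp only [hζval n hn] at this
  rw [← this]
  simp [v, hn]

theorem discr_emod_four (hK : Module.finrank ℚ K = 2) :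
    NumberField.discr K % 4 = 0 ∨ NumberField.discr K % 4 = 1 := by
  obtain ⟨b, hb⟩ := exists_basis_one_omega K hK
  rw [discr_eq_omega b hb]
  rcases Int.even_or_odd' (omegaTrace b) with ⟨c, h | h⟩ <;> rw [h] <;> ring_nf <;> omega

end

/-! ### Theta functions of plane lattices -/

theorem tsum_prod_eq_tsum_tsum_swap {ι κ : Type*} {f : ι × κ → ℂ} (hf : Summable f) :
    ∑' p, f p = ∑' b, ∑' a, f (a, b) := by
  have h := ((Equiv.prodComm κ ι).summable_iff.mpr hf).tsum_prod
  exact ((Equiv.prodComm κ ι).tsum_eq f).symm.trans h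

theorem summable_exp_neg_mul_int_sq {c : ℝ} (hc : 0 < c) :
    Summable fun m : ℤ ↦ Real.exp (-c * (m : ℝ) ^ 2) := by
  have hnat : Summable fun m : ℕ ↦ Real.exp (-c * (m : ℝ) ^ 2) := by
    refine Summable.of_nonneg_of_le (fun _ ↦ (Real.exp_pos _).le) (fun m ↦ ?_)
      (Real.summable_exp_nat_mul_iff.mpr (neg_neg_of_pos hc))
    refine Real.exp_le_exp.mpr ?_
    have : (m : ℝ) ≤ (m : ℝ) ^ 2 := by exact_mod_cast Nat.le_self_pow two_ne_zero m
    nlinarith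
  refine Summable.of_nat_of_neg ?_ ?_
  · simpa using hnat
  · simpa using hnat

theorem summable_exp_neg_quadratic_form {x y s : ℝ} (hy : y ≠ 0) (hs : 0 < s) :
    Summable fun p : ℤ × ℤ ↦
      Real.exp (-s * (((p.1 : ℝ) + p.2 * x) ^ 2 + (p.2 * y) ^ 2)) := by
  have hy2 : 0 < y ^ 2 := by positivity
  -- From a² ≤ 2(a + bx)² + 2b²x² one gets a² + b² ≤ C((a + bx)² + (by)²), which reduces summability
  -- to a product of one-variable series.
  set C : ℝ := 2 + (2 * x ^ 2 + 1) / y ^ 2 with hC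
  have hCpos : 0 < C := by positivity
  have hS := summable_exp_neg_mul_int_sq (div_pos hs hCpos)
  refine Summable.of_nonneg_of_le (fun _ ↦ (Real.exp_pos _).le) (fun p ↦ ?_)
    (hS.mul_of_nonneg hS (fun _ ↦ (Real.exp_pos _).le) (fun _ ↦ (Real.exp_pos _).le))
  rw [← Real.exp_add, Real.exp_le_exp]
  have hle : (p.1 : ℝ) ^ 2 + (p.2 : ℝ) ^ 2 ≤
      C * (((p.1 : ℝ) + p.2 * x) ^ 2 + (p.2 * y) ^ 2) := by
    have h1 : (2 * x ^ 2 + 1) / y ^ 2 * (p.2 * y) ^ 2 = (2 * x ^ 2 + 1) * (p.2 : ℝ) ^ 2 := by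
      field_simp
    have h2 : (0 : ℝ) ≤ (2 * x ^ 2 + 1) / y ^ 2 * ((p.1 : ℝ) + p.2 * x) ^ 2 := by positivity
    rw [hC]
    nlinarith [sq_nonneg ((p.1 : ℝ) + 2 * p.2 * x), sq_nonneg ((p.2 : ℝ) * y)]
  have : s / C * ((p.1 : ℝ) ^ 2 + (p.2 : ℝ) ^ 2) ≤
      s * (((p.1 : ℝ) + p.2 * x) ^ 2 + (p.2 * y) ^ 2) := by
    calc _ ≤ s / C * (C * (((p.1 : ℝ) + p.2 * x) ^ 2 + (p.2 * y) ^ 2)) := by gcongr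
      _ = _ := by field_simp
  linarith

/-- Poisson summation is applied in one variable at a time. The first application dualizes p.1 and
creates a phase in x; in the second, that phase becomes a shift and rebuilds the same quadratic
form. No separate dual lattice occurs, since the dual of a plane lattice is a rotated and rescaled
copy of it. -/
theorem tsum_exp_neg_quadratic_form {x y s : ℝ} (hy : y ≠ 0) (hs : 0 < s) :
    ∑' p : ℤ × ℤ, Real.exp (-(Real.pi * s) * (((p.1 : ℝ) + p.2 * x) ^ 2 + (p.2 * y) ^ 2)) =
      1 / (s * |y|) * ∑' p : ℤ × ℤ,
        Real.exp (-(Real.pi / (s * y ^ 2)) * (((p.1 : ℝ) + p.2 * x) ^ 2 + (p.2 * y) ^ 2)) := by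
  have hpi := Real.pi_pos
  have hy2 : 0 < y ^ 2 := by positivity
  have hsum1 := summable_exp_neg_quadratic_form (x := x) hy (mul_pos hpi hs)
  have hsum2 := summable_exp_neg_quadratic_form (x := x) hy (div_pos hpi (mul_pos hs hy2))
  have hsc1 : Summable fun p : ℤ × ℤ ↦
      Complex.exp (-(Real.pi * s) * (((p.1 : ℂ) + p.2 * x) ^ 2 + (p.2 * y) ^ 2)) := by
    have := Complex.ofRealCLM.summable hsum1
    refine this.congr fun p ↦ ?_
    simp
  have hsc2 : Summable fun p : ℤ × ℤ ↦
      Complex.exp (-(Real.pi / (s * y ^ 2)) * (((p.1 : ℂ) + p.2 * x) ^ 2 + (p.2 * y) ^ 2)) := by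
    have := Complex.ofRealCLM.summable hsum2
    refine this.congr fun p ↦ ?_
    simp
  -- This is the series between the two applications of Poisson summation. Its absolute convergence
  -- allows the exchange of the two sums.
  have hmid : Summable fun p : ℤ × ℤ ↦
      Complex.exp (-(Real.pi / s) * (p.2 : ℂ) ^ 2 - 2 * Real.pi * Complex.I * p.1 * p.2 * x
        - Real.pi * s * y ^ 2 * (p.1 : ℂ) ^ 2) := by
    have h1 := summable_exp_neg_mul_int_sq (show 0 < Real.pi * s * y ^ 2 by positivity)
    have h2 := summable_exp_neg_mul_int_sq (show 0 < Real.pi / s by positivity)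
    refine Summable.of_norm ((h1.mul_of_nonneg h2 (fun _ ↦ (Real.exp_pos _).le)
      (fun _ ↦ (Real.exp_pos _).le)).congr fun p ↦ ?_)
    rw [Complex.norm_exp, ← Real.exp_add]
    congr 1
    have : (-(Real.pi / s) * (p.2 : ℂ) ^ 2 - 2 * Real.pi * Complex.I * p.1 * p.2 * x
        - Real.pi * s * y ^ 2 * (p.1 : ℂ) ^ 2) =
        ((-(Real.pi * s * y ^ 2) * (p.1 : ℝ) ^ 2 + -(Real.pi / s) * (p.2 : ℝ) ^ 2 : ℝ) : ℂ)
        + ((-(2 * Real.pi * p.1 * p.2 * x) : ℝ) : ℂ) * Complex.I := by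
      push_cast; ring
    rw [this, Complex.add_re, Complex.ofReal_re, Complex.re_ofReal_mul, Complex.I_re, mul_zero,
      add_zero]
  have hsC : (s : ℂ) ≠ 0 := by exact_mod_cast hs.ne'
  have hyC : (y : ℂ) ≠ 0 := by exact_mod_cast hy
  have hin (n : ℤ) :
      ∑' m : ℤ, Complex.exp (-(Real.pi * s) * (((m : ℂ) + n * x) ^ 2 + (n * y) ^ 2)) =
      ((s : ℂ)⁻¹ ^ (1 / 2 : ℂ)) * ∑' k : ℤ, Complex.exp (-(Real.pi / s) * (k : ℂ) ^ 2
        - 2 * Real.pi * Complex.I * n * k * x - Real.pi * s * y ^ 2 * (n : ℂ) ^ 2) := by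
    have h := Complex.tsum_exp_neg_quadratic (a := (s : ℂ)⁻¹)
      (by rw [← Complex.ofReal_inv, Complex.ofReal_re]; positivity) (-Complex.I * n * x)
    have hne : ((s : ℂ)⁻¹ ^ (1 / 2 : ℂ)) ≠ 0 := by
      rw [Complex.cpow_def_of_ne_zero (inv_ne_zero hsC)]; exact Complex.exp_ne_zero _
    rw [eq_comm, one_div, inv_mul_eq_iff_eq_mul₀ hne] at h
    have e1 (m : ℤ) : Complex.exp (-(Real.pi * s) * (((m : ℂ) + n * x) ^ 2 + (n * y) ^ 2)) =
        Complex.exp (-Real.pi / (s : ℂ)⁻¹ * (m + Complex.I * (-Complex.I * n * x)) ^ 2) *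
          Complex.exp (-Real.pi * s * y ^ 2 * (n : ℂ) ^ 2) := by
      rw [← Complex.exp_add]
      congr 1
      have : Complex.I * (-Complex.I * n * x) = n * x := by
        linear_combination (-(n : ℂ) * x) * Complex.I_mul_I
      rw [this, div_inv_eq_mul]
      ring
    have e2 (k : ℤ) : Complex.exp (-(Real.pi / s) * (k : ℂ) ^ 2
        - 2 * Real.pi * Complex.I * n * k * x - Real.pi * s * y ^ 2 * (n : ℂ) ^ 2) =
        Complex.exp (-Real.pi * (s : ℂ)⁻¹ * (k : ℂ) ^ 2
          + 2 * Real.pi * (-Complex.I * n * x) * k) *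
          Complex.exp (-Real.pi * s * y ^ 2 * (n : ℂ) ^ 2) := by
      rw [← Complex.exp_add]
      congr 1
      field_simp
      ring
    simp_rw [e1, e2]
    rw [tsum_mul_right, tsum_mul_right, h, mul_assoc]
  have hout (k : ℤ) : ∑' n : ℤ, Complex.exp (-(Real.pi / s) * (k : ℂ) ^ 2
        - 2 * Real.pi * Complex.I * n * k * x - Real.pi * s * y ^ 2 * (n : ℂ) ^ 2) =
      1 / ((s * y ^ 2 : ℝ) : ℂ) ^ (1 / 2 : ℂ) * ∑' l : ℤ, Complex.exp
        (-(Real.pi / (s * y ^ 2)) * (((l : ℂ) + k * x) ^ 2 + (k * y) ^ 2)) := by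
    have h := Complex.tsum_exp_neg_quadratic (a := ((s * y ^ 2 : ℝ) : ℂ))
      (by rw [Complex.ofReal_re]; positivity) (-Complex.I * k * x)
    have e1 (n : ℤ) : Complex.exp (-(Real.pi / s) * (k : ℂ) ^ 2
        - 2 * Real.pi * Complex.I * n * k * x - Real.pi * s * y ^ 2 * (n : ℂ) ^ 2) =
        Complex.exp (-Real.pi * ((s * y ^ 2 : ℝ) : ℂ) * (n : ℂ) ^ 2
          + 2 * Real.pi * (-Complex.I * k * x) * n) *
          Complex.exp (-(Real.pi / s) * (k : ℂ) ^ 2) := by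
      rw [← Complex.exp_add]
      congr 1
      push_cast
      ring
    have e2 (l : ℤ) : Complex.exp
        (-(Real.pi / (s * y ^ 2)) * (((l : ℂ) + k * x) ^ 2 + (k * y) ^ 2)) =
        Complex.exp (-Real.pi / ((s * y ^ 2 : ℝ) : ℂ) *
          (l + Complex.I * (-Complex.I * k * x)) ^ 2) *
          Complex.exp (-(Real.pi / s) * (k : ℂ) ^ 2) := by
      rw [← Complex.exp_add]
      congr 1
      have : Complex.I * (-Complex.I * k * x) = k * x := by
        linear_combination (-(k : ℂ) * x) * Complex.I_mul_I
      rw [this]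
      push_cast
      field_simp
      ring
    simp_rw [e1, e2]
    rw [tsum_mul_right, tsum_mul_right, h, mul_assoc]
  have hconst : ((s : ℂ)⁻¹ ^ (1 / 2 : ℂ)) * (1 / ((s * y ^ 2 : ℝ) : ℂ) ^ (1 / 2 : ℂ)) =
      ((1 / (s * |y|) : ℝ) : ℂ) := by
    have hhalf : (1 / 2 : ℂ) = ((1 / 2 : ℝ) : ℂ) := by push_cast; rfl
    rw [hhalf, ← Complex.ofReal_inv, ← Complex.ofReal_cpow (by positivity),
      ← Complex.ofReal_cpow (by positivity), ← Real.sqrt_eq_rpow, ← Real.sqrt_eq_rpow,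
      Real.sqrt_inv, Real.sqrt_mul hs.le, Real.sqrt_sq_eq_abs]
    norm_cast
    have := Real.mul_self_sqrt hs.le
    have h0 : Real.sqrt s ≠ 0 := by positivity
    have h1 : |y| ≠ 0 := by positivity
    field_simp
    rw [sq, this]
  have hC : ((∑' p : ℤ × ℤ, Real.exp (-(Real.pi * s) *
      (((p.1 : ℝ) + p.2 * x) ^ 2 + (p.2 * y) ^ 2)) : ℝ) : ℂ) =
      ((1 / (s * |y|) : ℝ) : ℂ) * ((∑' p : ℤ × ℤ, Real.exp (-(Real.pi / (s * y ^ 2)) *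
        (((p.1 : ℝ) + p.2 * x) ^ 2 + (p.2 * y) ^ 2)) : ℝ) : ℂ) := by
    rw [Complex.ofReal_tsum, Complex.ofReal_tsum]
    simp only [Complex.ofReal_exp, Complex.ofReal_mul, Complex.ofReal_neg, Complex.ofReal_add,
      Complex.ofReal_pow, Complex.ofReal_intCast, Complex.ofReal_div] at hsc1 hsc2 ⊢
    rw [tsum_prod_eq_tsum_tsum_swap hsc1, tsum_prod_eq_tsum_tsum_swap hsc2]
    simp_rw [hin]
    rw [tsum_mul_left, ← hmid.tsum_prod (f := fun p : ℤ × ℤ ↦ Complex.exp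
      (-(Real.pi / s) * (p.2 : ℂ) ^ 2 - 2 * Real.pi * Complex.I * p.1 * p.2 * x
        - Real.pi * s * y ^ 2 * (p.1 : ℂ) ^ 2)), tsum_prod_eq_tsum_tsum_swap hmid]
    simp_rw [hout]
    rw [tsum_mul_left, ← mul_assoc, hconst]
    push_cast
    rfl
  exact_mod_cast hC

/-- The theta function of the lattice `ℤ ω₁ + ℤ ω₂`. -/
noncomputable def latticeTheta (ω₁ ω₂ : ℂ) (t : ℝ) : ℝ :=
  ∑' p : ℤ × ℤ, Real.exp (-t * ‖(p.1 : ℂ) * ω₁ + p.2 * ω₂‖ ^ 2)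

theorem norm_lattice_sq {ω₁ : ℂ} (h : ω₁ ≠ 0) (ω₂ : ℂ) (p : ℤ × ℤ) :
    ‖(p.1 : ℂ) * ω₁ + p.2 * ω₂‖ ^ 2 = ‖ω₁‖ ^ 2 *
      (((p.1 : ℝ) + p.2 * (ω₂ / ω₁).re) ^ 2 + (p.2 * (ω₂ / ω₁).im) ^ 2) := by
  have : (p.1 : ℂ) * ω₁ + p.2 * ω₂ = ω₁ * (p.1 + p.2 * (ω₂ / ω₁)) := by field_simp
  rw [this, norm_mul, mul_pow]
  congr 1
  rw [← Complex.normSq_eq_norm_sq, Complex.normSq_apply]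
  simp
  ring

theorem im_div_mul_norm_sq {ω₁ : ℂ} (h : ω₁ ≠ 0) (ω₂ : ℂ) :
    ‖ω₁‖ ^ 2 * (ω₂ / ω₁).im = ((starRingEnd ℂ) ω₁ * ω₂).im := by
  have hn : Complex.normSq ω₁ ≠ 0 := by simpa using h
  rw [← Complex.normSq_eq_norm_sq, Complex.div_im]
  field_simp
  simp
  ring

theorem summable_latticeTheta {ω₁ ω₂ : ℂ} (h : ((starRingEnd ℂ) ω₁ * ω₂).im ≠ 0) {t : ℝ}
    (ht : 0 < t) :
    Summable fun p : ℤ × ℤ ↦ Real.exp (-t * ‖(p.1 : ℂ) * ω₁ + p.2 * ω₂‖ ^ 2) := by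
  have h0 : ω₁ ≠ 0 := by rintro rfl; simp at h
  have hy : (ω₂ / ω₁).im ≠ 0 := by
    intro h'; rw [← im_div_mul_norm_sq h0, h', mul_zero] at h; exact h rfl
  refine (summable_exp_neg_quadratic_form (x := (ω₂ / ω₁).re) hy
    (show 0 < t * ‖ω₁‖ ^ 2 by positivity)).congr fun p ↦ ?_
  rw [norm_lattice_sq h0]
  ring_nf

/-- Scaling by ω₁ reduces to the lattice spanned by 1 and τ = ω₂/ω₁. The quantity ‖ω₁‖² Im τ is the
signed covolume, the only invariant entering the factor and the new argument. -/
theorem latticeTheta_inversion {ω₁ ω₂ : ℂ} (h : ((starRingEnd ℂ) ω₁ * ω₂).im ≠ 0) {t : ℝ}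
    (ht : 0 < t) :
    latticeTheta ω₁ ω₂ t = Real.pi / (t * |((starRingEnd ℂ) ω₁ * ω₂).im|) *
      latticeTheta ω₁ ω₂ (Real.pi ^ 2 / (t * ((starRingEnd ℂ) ω₁ * ω₂).im ^ 2)) := by
  have h0 : ω₁ ≠ 0 := by rintro rfl; simp at h
  have hy : (ω₂ / ω₁).im ≠ 0 := by
    intro h'; rw [← im_div_mul_norm_sq h0, h', mul_zero] at h; exact h rfl
  have hn : 0 < ‖ω₁‖ := norm_pos_iff.mpr h0
  have hpi := Real.pi_pos
  have key := tsum_exp_neg_quadratic_form (x := (ω₂ / ω₁).re) hy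
    (show 0 < t * ‖ω₁‖ ^ 2 / Real.pi by positivity)
  rw [latticeTheta, latticeTheta, ← im_div_mul_norm_sq h0]
  simp_rw [norm_lattice_sq h0]
  convert key using 1
  · refine tsum_congr fun p ↦ ?_
    congr 1
    field_simp
  · congr 1
    · rw [abs_mul, abs_of_pos (show 0 < ‖ω₁‖ ^ 2 by positivity)]
      have : |(ω₂ / ω₁).im| ≠ 0 := by positivity
      field_simp
    · refine tsum_congr fun p ↦ ?_
      congr 1
      field_simp

/-! ### The theta function of an imaginary quadratic field -/

section ImaginaryQuadratic

variable {K : Type*} [Field K] [NumberField K]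

theorem card_infinitePlace_eq_one (hK : Module.finrank ℚ K = 2) [NumberField.IsTotallyComplex K] :
    Fintype.card (NumberField.InfinitePlace K) = 1 := by
  have h := NumberField.InfinitePlace.card_add_two_mul_card_eq_rank K
  rw [NumberField.InfinitePlace.card_eq_nrRealPlaces_add_nrComplexPlaces]
  rw [NumberField.IsTotallyComplex.nrRealPlaces_eq_zero, hK] at *
  omega

/-- The absolute norm is the square of the absolute value at a complex embedding. -/
theorem norm_embedding_sq (hK : Module.finrank ℚ K = 2) [NumberField.IsTotallyComplex K]
    (σ : K →+* ℂ) (x : 𝓞 K) :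
    ‖σ x‖ ^ 2 = ((Algebra.norm ℤ x).natAbs : ℝ) := by
  have h := NumberField.InfinitePlace.prod_eq_abs_norm (x : K)
  obtain ⟨w₀, hw₀⟩ := Fintype.card_eq_one_iff.mp (card_infinitePlace_eq_one hK)
  rw [Fintype.prod_eq_single w₀ (fun w hw ↦ absurd (hw₀ w) hw),
    NumberField.IsTotallyComplex.mult_eq, ← hw₀ (NumberField.InfinitePlace.mk σ),
    NumberField.InfinitePlace.apply] at h
  rw [h, ← Algebra.coe_norm_int, Nat.cast_natAbs]
  push_cast
  rfl

/-- A real value of ω would make the embedding real. The imaginary part of the quadratic equation of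
ω gives 2 Re ω = t, and its real part then gives 4 (Im ω)² = 4n - t². -/
theorem embedding_omega_im_sq (b : Module.Basis (Fin 2) ℤ (𝓞 K)) (hb : b 0 = 1)
    [NumberField.IsTotallyComplex K] (σ : K →+* ℂ) :
    (σ (b 1)).im ≠ 0 ∧ 4 * (σ (b 1)).im ^ 2 = -(NumberField.discr K : ℝ) := by
  have him : (σ (b 1)).im ≠ 0 := by
    intro h
    apply NumberField.IsTotallyComplex.complexEmbedding_not_isReal σ
    rw [NumberField.ComplexEmbedding.isReal_iff]
    refine IsLocalization.ringHom_ext (nonZeroDivisors (𝓞 K)) (RingHom.ext fun x ↦ ?_)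
    simp only [RingHom.comp_apply, NumberField.ComplexEmbedding.conjugate_coe_eq]
    rw [eq_repr_add_repr_mul b hb x]
    have hc : (starRingEnd ℂ) (σ (b 1)) = σ (b 1) := Complex.conj_eq_iff_im.mpr h
    simp [hc]
  refine ⟨him, ?_⟩
  have h := congrArg (fun x : 𝓞 K ↦ σ x) (omega_mul_self b hb)
  simp only [map_mul, map_sub, map_intCast] at h
  rw [discr_eq_omega b hb]
  have hre := congrArg Complex.re h
  have himm := congrArg Complex.im h
  simp only [Complex.mul_re, Complex.mul_im, Complex.sub_re, Complex.sub_im, Complex.intCast_re,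
    Complex.intCast_im, zero_mul, sub_zero, add_zero] at hre himm
  have h2 : 2 * (σ (b 1)).re = omegaTrace b := by
    have : (σ (b 1)).im * (2 * (σ (b 1)).re - omegaTrace b) = 0 := by linarith
    have := (mul_eq_zero.mp this).resolve_left him
    linarith
  push_cast
  rw [← h2] at hre ⊢
  linarith

theorem discr_neg (hK : Module.finrank ℚ K = 2) [NumberField.IsTotallyComplex K] :
    NumberField.discr K < 0 := by
  obtain ⟨b, hb⟩ := exists_basis_one_omega K hK
  obtain ⟨σ⟩ : Nonempty (K →+* ℂ) := inferInstance
  obtain ⟨h1, h2⟩ := embedding_omega_im_sq b hb σ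
  have : 0 < -(NumberField.discr K : ℝ) := by rw [← h2]; positivity
  have h3 : (NumberField.discr K : ℝ) < 0 := by linarith
  exact_mod_cast h3

theorem absDiscr_pos : 0 < absDiscr K :=
  Int.natAbs_pos.mpr (NumberField.discr_ne_zero K)

/-- The covolume of an ideal. -/
theorem covolume_ideal_sq (hK : Module.finrank ℚ K = 2) [NumberField.IsTotallyComplex K]
    (σ : K →+* ℂ) (J : Ideal (𝓞 K)) (c : Module.Basis (Fin 2) ℤ J) :
    4 * ((starRingEnd ℂ) (σ (c 0 : 𝓞 K)) * σ (c 1 : 𝓞 K)).im ^ 2 =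
      (Ideal.absNorm J : ℝ) ^ 2 * absDiscr K := by
  obtain ⟨b, hb⟩ := exists_basis_one_omega K hK
  obtain ⟨h1, h2⟩ := embedding_omega_im_sq b hb σ
  have hdet := Ideal.natAbs_det_basis_change b J c
  rw [Module.Basis.det_apply, Matrix.det_fin_two] at hdet
  simp only [Module.Basis.toMatrix_apply, Function.comp_apply] at hdet
  have hσ (x : 𝓞 K) : σ x = (b.repr x 0 : ℂ) + (b.repr x 1 : ℂ) * σ (b 1) := by
    conv_lhs => rw [eq_repr_add_repr_mul b hb x]
    simp
  have hD : (absDiscr K : ℝ) = -(NumberField.discr K : ℝ) := by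
    rw [absDiscr, Nat.cast_natAbs, abs_of_neg (discr_neg hK)]
    push_cast; rfl
  rw [hD, ← h2, ← hdet, Nat.cast_natAbs, hσ (c 0 : 𝓞 K), hσ (c 1 : 𝓞 K)]
  push_cast
  rw [sq_abs]
  simp
  ring

/-- The theta function of an ideal `J`, normalized by its norm. -/
noncomputable def idealTheta (J : Ideal (𝓞 K)) (t : ℝ) : ℝ :=
  ∑' x : J, Real.exp (-t * ((Algebra.norm ℤ (x : 𝓞 K)).natAbs / Ideal.absNorm J))

theorem exp_ideal_comp_basis (hK : Module.finrank ℚ K = 2) [NumberField.IsTotallyComplex K]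
    (σ : K →+* ℂ) (J : Ideal (𝓞 K)) (c : Module.Basis (Fin 2) ℤ J) (t : ℝ) (p : ℤ × ℤ) :
    Real.exp (-t * ((Algebra.norm ℤ ((c.equivFun.toEquiv.trans (finTwoArrowEquiv ℤ)).symm p :
      𝓞 K)).natAbs / Ideal.absNorm J)) =
    Real.exp (-(t / Ideal.absNorm J) *
      ‖(p.1 : ℂ) * σ (c 0 : 𝓞 K) + p.2 * σ (c 1 : 𝓞 K)‖ ^ 2) := by
  rw [← norm_embedding_sq hK σ]
  have : ((c.equivFun.toEquiv.trans (finTwoArrowEquiv ℤ)).symm p : 𝓞 K) =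
      (p.1 : 𝓞 K) * c 0 + (p.2 : 𝓞 K) * c 1 := by
    simp [Module.Basis.equivFun_symm_apply, Fin.sum_univ_two]
  rw [this]
  simp only [map_add, map_mul, map_intCast]
  congr 1
  ring

theorem summable_idealTheta (hK : Module.finrank ℚ K = 2) [NumberField.IsTotallyComplex K]
    {J : Ideal (𝓞 K)} (hJ : J ≠ ⊥) {t : ℝ} (ht : 0 < t) :
    Summable fun x : J ↦
      Real.exp (-t * ((Algebra.norm ℤ (x : 𝓞 K)).natAbs / Ideal.absNorm J)) := by
  obtain ⟨b, hb⟩ := exists_basis_one_omega K hK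
  obtain ⟨σ⟩ : Nonempty (K →+* ℂ) := inferInstance
  let c := Ideal.selfBasis b J hJ
  have hN : 0 < (Ideal.absNorm J : ℝ) := by
    exact_mod_cast Nat.pos_of_ne_zero (mt Ideal.absNorm_eq_zero_iff.mp hJ)
  have hD : 0 < (absDiscr K : ℝ) := by exact_mod_cast absDiscr_pos
  have hcov := covolume_ideal_sq hK σ J c
  have him : ((starRingEnd ℂ) (σ (c 0 : 𝓞 K)) * σ (c 1 : 𝓞 K)).im ≠ 0 := by
    intro h
    rw [h] at hcov
    have : 0 < (Ideal.absNorm J : ℝ) ^ 2 * absDiscr K := by positivity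
    linarith
  rw [← (c.equivFun.toEquiv.trans (finTwoArrowEquiv ℤ)).symm.summable_iff]
  refine (summable_latticeTheta him (div_pos ht hN)).congr fun p ↦ ?_
  exact (exp_ideal_comp_basis hK σ J c t p).symm

/-- The covolume of J is N(J)√D/2. Dividing norms by N(J) normalizes it to √D/2, so the functional
equation is the same for all ideals and can be summed over classes. -/
theorem idealTheta_inversion (hK : Module.finrank ℚ K = 2) [NumberField.IsTotallyComplex K]
    {J : Ideal (𝓞 K)} (hJ : J ≠ ⊥) {t : ℝ} (ht : 0 < t) :
    idealTheta J t = 2 * Real.pi / (Real.sqrt (absDiscr K) * t) *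
      idealTheta J (4 * Real.pi ^ 2 / (absDiscr K * t)) := by
  obtain ⟨b, hb⟩ := exists_basis_one_omega K hK
  obtain ⟨σ⟩ : Nonempty (K →+* ℂ) := inferInstance
  let c := Ideal.selfBasis b J hJ
  have hN : 0 < (Ideal.absNorm J : ℝ) := by
    exact_mod_cast Nat.pos_of_ne_zero (mt Ideal.absNorm_eq_zero_iff.mp hJ)
  have hD : 0 < (absDiscr K : ℝ) := by exact_mod_cast absDiscr_pos
  have hcov := covolume_ideal_sq hK σ J c
  have him : ((starRingEnd ℂ) (σ (c 0 : 𝓞 K)) * σ (c 1 : 𝓞 K)).im ≠ 0 := by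
    intro h
    rw [h] at hcov
    have : 0 < (Ideal.absNorm J : ℝ) ^ 2 * absDiscr K := by positivity
    linarith
  have hlat (t : ℝ) : idealTheta J t =
      latticeTheta (σ (c 0 : 𝓞 K)) (σ (c 1 : 𝓞 K)) (t / Ideal.absNorm J) := by
    rw [idealTheta, latticeTheta, ← (c.equivFun.toEquiv.trans (finTwoArrowEquiv ℤ)).symm.tsum_eq]
    exact tsum_congr fun p ↦ exp_ideal_comp_basis hK σ J c t p
  rw [hlat, hlat, latticeTheta_inversion him (div_pos ht hN)]
  set V := ((starRingEnd ℂ) (σ (c 0 : 𝓞 K)) * σ (c 1 : 𝓞 K)).im with hV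
  have hV2 : V ^ 2 = (Ideal.absNorm J : ℝ) ^ 2 * absDiscr K / 4 := by linarith
  have habs : |V| = Ideal.absNorm J * Real.sqrt (absDiscr K) / 2 := by
    rw [← Real.sqrt_sq_eq_abs, hV2]
    rw [show (Ideal.absNorm J : ℝ) ^ 2 * absDiscr K / 4 =
      (Ideal.absNorm J / 2 : ℝ) ^ 2 * absDiscr K by ring, Real.sqrt_mul (by positivity),
      Real.sqrt_sq (by positivity)]
    ring
  have hs : 0 < Real.sqrt (absDiscr K) := Real.sqrt_pos.mpr hD
  rw [hV2, habs]
  congr 1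
  · field_simp
  · congr 1
    field_simp

/-- All units of an imaginary quadratic field are roots of unity. -/
theorem card_units_eq_torsionOrder (hK : Module.finrank ℚ K = 2)
    [NumberField.IsTotallyComplex K] :
    Nat.card (𝓞 K)ˣ = NumberField.Units.torsionOrder K := by
  have htop : NumberField.Units.torsion K = ⊤ := by
    rw [eq_top_iff]
    intro u _
    rw [NumberField.Units.mem_torsion]
    intro w
    have h := norm_embedding_sq hK w.embedding (u : 𝓞 K)
    rw [NumberField.InfinitePlace.norm_embedding_eq] at h
    have hu : (Algebra.norm ℤ (u : 𝓞 K)).natAbs = 1 :=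
      Int.isUnit_iff_natAbs_eq.mp (u.isUnit.map _)
    rw [hu, Nat.cast_one] at h
    exact (pow_eq_one_iff_of_nonneg (apply_nonneg w _) two_ne_zero).mp h
  rw [NumberField.Units.torsionOrder, htop]
  exact (Nat.card_congr Subgroup.topEquiv.toEquiv).symm

/-- A generator of the principal ideal `I * J`. -/
theorem exists_generator_mul (J : (Ideal (𝓞 K))⁰) {C : ClassGroup (𝓞 K)}
    (hJ : ClassGroup.mk0 J = C⁻¹) (I : {I : (Ideal (𝓞 K))⁰ // ClassGroup.mk0 I = C}) :
    ∃ x : 𝓞 K, (I : Ideal (𝓞 K)) * (J : Ideal (𝓞 K)) = Ideal.span {x} := by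
  have h : ClassGroup.mk0 (I.1 * J) = 1 := by rw [map_mul, I.2, hJ, mul_inv_cancel]
  rw [ClassGroup.mk0_eq_one_iff] at h
  obtain ⟨x, hx⟩ := h.principal
  exact ⟨x, by simpa using hx⟩

/-- For I in the class C the ideal IJ is principal, and its generators form one orbit of units in J.
Conversely a non-zero x in J determines I = (x)J⁻¹, whose class is C. -/
theorem exists_equiv_ideals_prod_units (J : (Ideal (𝓞 K))⁰) {C : ClassGroup (𝓞 K)}
    (hJ : ClassGroup.mk0 J = C⁻¹) :
    ∃ e : {I : (Ideal (𝓞 K))⁰ // ClassGroup.mk0 I = C} × (𝓞 K)ˣ ≃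
        ↥({0}ᶜ : Set (J : Ideal (𝓞 K))),
      ∀ p, (Algebra.norm ℤ ((e p).1 : 𝓞 K)).natAbs =
        Ideal.absNorm (p.1.1 : Ideal (𝓞 K)) * Ideal.absNorm (J : Ideal (𝓞 K)) := by
  choose g hg using exists_generator_mul J hJ
  have hspan (I) (u : (𝓞 K)ˣ) : Ideal.span {(u : 𝓞 K) * g I} =
      (I : Ideal (𝓞 K)) * (J : Ideal (𝓞 K)) := by
    rw [hg, Ideal.span_singleton_mul_left_unit u.isUnit]
  have hne (I : (Ideal (𝓞 K))⁰) : (I : Ideal (𝓞 K)) ≠ ⊥ := nonZeroDivisors.coe_ne_zero I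
  have hg0 (I) : g I ≠ 0 := by
    intro h
    have := hg I
    rw [h, Ideal.span_singleton_eq_bot.mpr rfl, Ideal.mul_eq_bot] at this
    exact this.elim (hne _) (hne _)
  have hmem (I) (u : (𝓞 K)ˣ) : (u : 𝓞 K) * g I ∈ (J : Ideal (𝓞 K)) := by
    rw [← Ideal.span_singleton_le_iff_mem, hspan]
    exact Ideal.mul_le_right
  let F : {I : (Ideal (𝓞 K))⁰ // ClassGroup.mk0 I = C} × (𝓞 K)ˣ →
      ↥({0}ᶜ : Set (J : Ideal (𝓞 K))) := fun p ↦ ⟨⟨(p.2 : 𝓞 K) * g p.1, hmem p.1 p.2⟩, by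
        simp only [Set.mem_compl_iff, Set.mem_singleton_iff]
        intro h
        exact mul_ne_zero p.2.ne_zero (hg0 p.1) (congrArg Subtype.val h)⟩
  refine ⟨Equiv.ofBijective F ⟨?_, ?_⟩, ?_⟩
  · rintro ⟨I, u⟩ ⟨I', u'⟩ h
    have h' : (u : 𝓞 K) * g I = (u' : 𝓞 K) * g I' :=
      congrArg (fun x : ↥({0}ᶜ : Set (J : Ideal (𝓞 K))) ↦ ((x : (J : Ideal (𝓞 K))) : 𝓞 K)) h
    have hI : I = I' := by
      have := hspan I u
      rw [h', hspan] at this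
      exact Subtype.ext (Subtype.ext (mul_right_cancel₀ (hne J) this.symm))
    subst hI
    have := mul_right_cancel₀ (hg0 I) h'
    rw [Units.ext this]
  · rintro ⟨⟨x, hxJ⟩, hx0⟩
    have hx : x ≠ 0 := by
      rintro rfl
      exact hx0 rfl
    obtain ⟨I, hI⟩ : (J : Ideal (𝓞 K)) ∣ Ideal.span {x} := by
      rw [Ideal.dvd_iff_le, Ideal.span_singleton_le_iff_mem]; exact hxJ
    have hI0 : I ≠ 0 := by
      rintro rfl
      rw [mul_zero, Ideal.zero_eq_bot, Ideal.span_singleton_eq_bot] at hI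
      exact hx hI
    let I' : (Ideal (𝓞 K))⁰ := ⟨I, mem_nonZeroDivisors_iff_ne_zero.mpr hI0⟩
    have hcl : ClassGroup.mk0 I' = C := by
      have h1 : ClassGroup.mk0 (J * I') = 1 := by
        rw [ClassGroup.mk0_eq_one_iff]
        exact ⟨⟨x, by simpa [I'] using hI.symm⟩⟩
      rw [map_mul, hJ, inv_mul_eq_one] at h1
      exact h1.symm
    have hassoc : Associated (g ⟨I', hcl⟩) x := by
      rw [← Ideal.span_singleton_eq_span_singleton, ← hg, hI, mul_comm]
    obtain ⟨u, hu⟩ := hassoc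
    refine ⟨(⟨I', hcl⟩, u), Subtype.ext (Subtype.ext ?_)⟩
    exact (mul_comm _ _).trans hu
  · rintro ⟨I, u⟩
    rw [← map_mul, ← hspan I u, Ideal.absNorm_span_singleton]
    rfl

/-- The theta series of J counts each ideal of the class once for every unit. The zero element
contributes the 1 that is subtracted. -/
theorem hasSum_exp_absNorm_class (hK : Module.finrank ℚ K = 2) [NumberField.IsTotallyComplex K]
    (J : (Ideal (𝓞 K))⁰) {C : ClassGroup (𝓞 K)} (hJ : ClassGroup.mk0 J = C⁻¹) {t : ℝ}
    (ht : 0 < t) :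
    HasSum (fun I : {I : (Ideal (𝓞 K))⁰ // ClassGroup.mk0 I = C} ↦
      Real.exp (-t * Ideal.absNorm (I : Ideal (𝓞 K))))
      ((idealTheta (J : Ideal (𝓞 K)) t - 1) / NumberField.Units.torsionOrder K) := by
  obtain ⟨e, he⟩ := exists_equiv_ideals_prod_units J hJ
  have hJ0 : (J : Ideal (𝓞 K)) ≠ ⊥ := nonZeroDivisors.coe_ne_zero J
  have hN : (Ideal.absNorm (J : Ideal (𝓞 K)) : ℝ) ≠ 0 := by
    exact_mod_cast mt Ideal.absNorm_eq_zero_iff.mp hJ0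
  have hs := summable_idealTheta hK hJ0 ht
  have hsplit := hs.tsum_subtype_add_tsum_subtype_compl {0}
  have hterm (p : {I : (Ideal (𝓞 K))⁰ // ClassGroup.mk0 I = C} × (𝓞 K)ˣ) :
      Real.exp (-t * ((Algebra.norm ℤ ((e p).1 : 𝓞 K)).natAbs /
        Ideal.absNorm (J : Ideal (𝓞 K)))) =
      Real.exp (-t * Ideal.absNorm (p.1 : Ideal (𝓞 K))) := by
    rw [he p]
    push_cast
    rw [mul_div_cancel_right₀ _ hN]
  have hsc := e.summable_iff.mpr (hs.subtype ({0}ᶜ : Set (J : Ideal (𝓞 K))))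
  have hsp : Summable fun p : {I : (Ideal (𝓞 K))⁰ // ClassGroup.mk0 I = C} × (𝓞 K)ˣ ↦
      Real.exp (-t * Ideal.absNorm (p.1 : Ideal (𝓞 K))) := hsc.congr hterm
  have hsI : Summable fun I : {I : (Ideal (𝓞 K))⁰ // ClassGroup.mk0 I = C} ↦
      Real.exp (-t * Ideal.absNorm (I : Ideal (𝓞 K))) :=
    hsp.comp_injective (i := fun I ↦ (I, 1)) fun I I' h ↦ (Prod.ext_iff.mp h).1
  have hsum : ∑' p : {I : (Ideal (𝓞 K))⁰ // ClassGroup.mk0 I = C} × (𝓞 K)ˣ,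
      Real.exp (-t * Ideal.absNorm (p.1 : Ideal (𝓞 K))) =
      NumberField.Units.torsionOrder K * ∑' I : {I : (Ideal (𝓞 K))⁰ // ClassGroup.mk0 I = C},
        Real.exp (-t * Ideal.absNorm (I : Ideal (𝓞 K))) := by
    rw [hsp.tsum_prod]
    simp_rw [tsum_const, card_units_eq_torsionOrder hK, nsmul_eq_mul]
    rw [tsum_mul_left]
  have hzero : ∑' x : ↥({0} : Set (J : Ideal (𝓞 K))), Real.exp (-t *
      ((Algebra.norm ℤ ((x : (J : Ideal (𝓞 K))) : 𝓞 K)).natAbs /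
        Ideal.absNorm (J : Ideal (𝓞 K)))) = 1 := by
    rw [tsum_singleton (0 : (J : Ideal (𝓞 K))) (fun x : (J : Ideal (𝓞 K)) ↦ Real.exp (-t *
      ((Algebra.norm ℤ (x : 𝓞 K)).natAbs / Ideal.absNorm (J : Ideal (𝓞 K)))))]
    have : Nontrivial (𝓞 K) := inferInstance
    simp [Algebra.norm_zero]
  have hcompl : ∑' x : ↥({0}ᶜ : Set (J : Ideal (𝓞 K))), Real.exp (-t *
      ((Algebra.norm ℤ ((x : (J : Ideal (𝓞 K))) : 𝓞 K)).natAbs /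
        Ideal.absNorm (J : Ideal (𝓞 K)))) =
      NumberField.Units.torsionOrder K * ∑' I : {I : (Ideal (𝓞 K))⁰ // ClassGroup.mk0 I = C},
        Real.exp (-t * Ideal.absNorm (I : Ideal (𝓞 K))) := by
    rw [← hsum, ← e.tsum_eq]
    exact tsum_congr hterm
  rw [hzero, hcompl] at hsplit
  have hw : (NumberField.Units.torsionOrder K : ℝ) ≠ 0 := by
    exact_mod_cast (NumberField.Units.torsionOrder_pos K).ne'
  rw [idealTheta, ← hsplit, add_sub_cancel_left, mul_div_cancel_left₀ _ hw]
  exact hsI.hasSum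

/-- The ideals of given positive norm, as elements of the monoid of non-zero ideals. -/
noncomputable def normPNat (I : (Ideal (𝓞 K))⁰) : ℕ+ :=
  ⟨Ideal.absNorm (I : Ideal (𝓞 K)), Nat.pos_of_ne_zero
    (mt Ideal.absNorm_eq_zero_iff.mp (nonZeroDivisors.coe_ne_zero I))⟩

theorem card_normPNat_fiber (n : ℕ+) :
    Nat.card {I : (Ideal (𝓞 K))⁰ // normPNat I = n} = idealCount K n := by
  refine Nat.card_congr ⟨fun I ↦ ⟨I.1, congrArg PNat.val I.2⟩, fun I ↦ ⟨⟨I.1, ?_⟩, ?_⟩, ?_, ?_⟩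
  · rw [mem_nonZeroDivisors_iff_ne_zero]
    exact ne_bot_of_absNorm_ne_zero (by rw [I.2]; exact n.ne_zero)
  · exact PNat.eq I.2
  · intro I; rfl
  · intro I; rfl

/-- The Poisson summation formula for the ideal counting function: the theta series
`h / w + ∑ v_K(n) e ^ (-n t)` is modular. -/
theorem exists_hasSum_idealCount_exp (hK : Module.finrank ℚ K = 2)
    [NumberField.IsTotallyComplex K] :
    ∃ S : ℝ → ℝ,
      (∀ t, 0 < t →
        HasSum (fun n : ℕ+ ↦ (idealCount K n : ℝ) * Real.exp (-t * n)) (S t)) ∧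
      ∀ t, 0 < t →
        (NumberField.classNumber K : ℝ) / NumberField.Units.torsionOrder K + S t =
          2 * Real.pi / (Real.sqrt (absDiscr K) * t) *
            ((NumberField.classNumber K : ℝ) / NumberField.Units.torsionOrder K +
              S (4 * Real.pi ^ 2 / (absDiscr K * t))) := by
  choose J hJ using fun C : ClassGroup (𝓞 K) ↦ ClassGroup.mk0_surjective C⁻¹
  have hD : 0 < (absDiscr K : ℝ) := by exact_mod_cast absDiscr_pos
  refine ⟨fun t ↦ ∑ C, (idealTheta (J C : Ideal (𝓞 K)) t - 1) /
    NumberField.Units.torsionOrder K, fun t ht ↦ ?_, fun t ht ↦ ?_⟩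
  · have hclass (C : ClassGroup (𝓞 K)) := hasSum_exp_absNorm_class hK (J C) (hJ C) ht
    have hall : HasSum (fun I : (Ideal (𝓞 K))⁰ ↦ Real.exp (-t * Ideal.absNorm (I : Ideal (𝓞 K))))
        (∑ C, (idealTheta (J C : Ideal (𝓞 K)) t - 1) / NumberField.Units.torsionOrder K) := by
      rw [← (Equiv.sigmaFiberEquiv (fun I : (Ideal (𝓞 K))⁰ ↦ ClassGroup.mk0 I)).hasSum_iff]
      refine HasSum.sigma_of_hasSum (g := fun C ↦ (idealTheta (J C : Ideal (𝓞 K)) t - 1) /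
        NumberField.Units.torsionOrder K) (hasSum_fintype _) (fun C ↦ hclass C) ?_
      refine (summable_sigma_of_nonneg (fun _ ↦ (Real.exp_pos _).le)).mpr
        ⟨fun C ↦ (hclass C).summable, (hasSum_fintype _).summable⟩
    rw [← (Equiv.sigmaFiberEquiv (normPNat (K := K))).hasSum_iff] at hall
    refine (hall.sigma (g := fun n : ℕ+ ↦ (idealCount K n : ℝ) * Real.exp (-t * n)) fun n ↦ ?_)
    have h := (hall.summable.sigma_factor n).hasSum
    have hval : (∑' I : {I : (Ideal (𝓞 K))⁰ // normPNat I = n},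
        ((fun I : (Ideal (𝓞 K))⁰ ↦ Real.exp (-t * Ideal.absNorm (I : Ideal (𝓞 K)))) ∘
          (Equiv.sigmaFiberEquiv (normPNat (K := K)))) ⟨n, I⟩) =
        (idealCount K n : ℝ) * Real.exp (-t * n) := by
      rw [← card_normPNat_fiber, ← nsmul_eq_mul, ← tsum_const]
      refine tsum_congr fun I ↦ ?_
      have : Ideal.absNorm (I.1 : Ideal (𝓞 K)) = n := congrArg PNat.val I.2
      simp [this]
    rw [hval] at h
    exact h
  -- The constant h/w collects the contributions 1/w of the zero vectors, one per ideal class.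
  · have hsum (t : ℝ) : (NumberField.classNumber K : ℝ) / NumberField.Units.torsionOrder K +
        ∑ C, (idealTheta (J C : Ideal (𝓞 K)) t - 1) / NumberField.Units.torsionOrder K =
        ∑ C, idealTheta (J C : Ideal (𝓞 K)) t / NumberField.Units.torsionOrder K := by
      simp only [sub_div, Finset.sum_sub_distrib]
      rw [Finset.sum_const, Finset.card_univ, nsmul_eq_mul, NumberField.classNumber]
      ring
    simp only [hsum]
    rw [Finset.mul_sum]
    refine Finset.sum_congr rfl fun C _ ↦ ?_
    rw [idealTheta_inversion hK (nonZeroDivisors.coe_ne_zero (J C)) ht, mul_div_assoc]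

end ImaginaryQuadratic

/-! ### Factorization of the Dedekind zeta function -/

theorem LSeriesSummable.hasSum_pnat {f : ℕ → ℂ} {s : ℂ} (hf : LSeriesSummable f s) :
    HasSum (fun n : ℕ+ ↦ f n / (n : ℂ) ^ s) (LSeries f s) := by
  have h := (PNat.coe_injective.hasSum_iff (f := LSeries.term f s) ?_).mpr hf.hasSum
  · have heq : (fun n : ℕ+ ↦ f n / (n : ℂ) ^ s) = LSeries.term f s ∘ ((↑) : ℕ+ → ℕ) := by
      funext n
      simp
    rw [heq]
    exact h
  · intro n hn
    have : n = 0 := by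
      by_contra h0
      exact hn ⟨⟨n, Nat.pos_of_ne_zero h0⟩, rfl⟩
    rw [this, LSeries.term_zero]

theorem hasSum_riemannZeta_pnat {s : ℂ} (hs : 1 < s.re) :
    HasSum (fun n : ℕ+ ↦ 1 / (n : ℂ) ^ s) (riemannZeta s) := by
  rw [← LSeries_one_eq_riemannZeta hs]
  exact (LSeriesSummable_one_iff.mpr hs).hasSum_pnat

section Zeta

variable {K : Type*} [Field K] [NumberField K]

theorem quadChar_natCast (hK : Module.finrank ℚ K = 2) [NumberField.IsTotallyComplex K] {n : ℕ}
    (hn : n ≠ 0) : quadChar K n = kroneckerSymbol (NumberField.discr K) n := by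
  rw [quadChar, ZMod.val_natCast, absDiscr,
    kroneckerSymbol_mod (discr_neg hK) (discr_emod_four hK) hn]

theorem lseriesSummable_quadChar {s : ℂ} (hs : 1 < s.re) :
    LSeriesSummable (fun n ↦ quadChar K n) s := by
  have : NeZero (absDiscr K) := ⟨absDiscr_pos.ne'⟩
  obtain ⟨M, hM⟩ := Finite.exists_le (fun a : ZMod (absDiscr K) ↦ ‖quadChar K a‖)
  exact LSeriesSummable_of_bounded_of_one_lt_re (fun n _ ↦ hM n) hs

theorem idealCount_eq_convolution (hK : Module.finrank ℚ K = 2) [NumberField.IsTotallyComplex K]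
    {n : ℕ} (hn : n ≠ 0) :
    (idealCount K n : ℂ) = LSeries.convolution 1 (fun n ↦ quadChar K n) n := by
  have h := idealCount_eq_sum_kroneckerSymbol hK hn
  rw [LSeries.convolution_def]
  simp only [Pi.one_apply, one_mul]
  rw [Nat.sum_divisorsAntidiagonal' (f := fun _ y ↦ quadChar K (y : ℕ))]
  have h' := congrArg (Int.cast : ℤ → ℂ) h
  push_cast at h'
  rw [h']
  exact Finset.sum_congr rfl fun d hd ↦
    (quadChar_natCast hK (Nat.pos_of_mem_divisors hd).ne').symm

theorem lseriesSummable_idealCount (hK : Module.finrank ℚ K = 2)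
    [NumberField.IsTotallyComplex K] {s : ℂ} (hs : 1 < s.re) :
    LSeriesSummable (fun n ↦ (idealCount K n : ℂ)) s := by
  have h1 : LSeriesSummable 1 s := LSeriesSummable_one_iff.mpr hs
  have h := h1.convolution (lseriesSummable_quadChar (K := K) hs)
  exact (LSeriesSummable_congr s (fun hn ↦ idealCount_eq_convolution hK hn)).mpr h

theorem quadL_eq_lseries {s : ℂ} (hs : 1 < s.re) :
    quadL K s = LSeries (fun n ↦ quadChar K n) s := by
  have : NeZero (absDiscr K) := ⟨absDiscr_pos.ne'⟩
  exact ZMod.LFunction_eq_LSeries _ hs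

/-- `ζ_K(s) = ζ(s) L(s, χ_D)`. -/
theorem dedekindZeta_eq_mul (hK : Module.finrank ℚ K = 2) [NumberField.IsTotallyComplex K] {s : ℂ}
    (hs : 1 < s.re) :
    NumberField.dedekindZeta K s = riemannZeta s * quadL K s := by
  have h1 : LSeriesSummable 1 s := LSeriesSummable_one_iff.mpr hs
  rw [quadL_eq_lseries hs, ← LSeries_one_eq_riemannZeta hs,
    ← LSeries_convolution' h1 (lseriesSummable_quadChar hs)]
  exact LSeries_congr (fun hn ↦ idealCount_eq_convolution hK hn) s

/-- There is a single infinite place, so the regulator is an empty determinant; no real place and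
one complex place leave the factor 2π. -/
theorem dedekindZeta_residue_eq (hK : Module.finrank ℚ K = 2) [NumberField.IsTotallyComplex K] :
    NumberField.dedekindZeta_residue K = 2 * Real.pi * NumberField.classNumber K /
      (NumberField.Units.torsionOrder K * Real.sqrt (absDiscr K)) := by
  have hreg : NumberField.Units.regulator K = 1 := by
    rw [NumberField.Units.regulator_eq_det']
    have hdet (ι : Type _) (_ : IsEmpty ι) (_ : DecidableEq ι) (_ : Fintype ι)
        (M : Matrix ι ι ℝ) : |M.det| = 1 := by rw [Matrix.det_isEmpty, abs_one]
    refine hdet _ ?_ _ _ _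
    obtain ⟨w₀, hw₀⟩ := Fintype.card_eq_one_iff.mp (card_infinitePlace_eq_one hK)
    exact ⟨fun w ↦ w.2 ((hw₀ _).trans (hw₀ _).symm)⟩
  have hc : NumberField.InfinitePlace.nrComplexPlaces K = 1 := by
    have h := NumberField.InfinitePlace.card_add_two_mul_card_eq_rank K
    rw [NumberField.IsTotallyComplex.nrRealPlaces_eq_zero, hK] at h
    omega
  rw [NumberField.dedekindZeta_residue_def, hreg, hc,
    NumberField.IsTotallyComplex.nrRealPlaces_eq_zero, absDiscr, Nat.cast_natAbs]
  push_cast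
  ring

theorem tendsto_ofReal_nhdsGT_one :
    Tendsto (fun s : ℝ ↦ (s : ℂ)) (𝓝[>] 1) (𝓝[≠] 1) := by
  refine tendsto_nhdsWithin_iff.mpr ⟨?_, ?_⟩
  · exact (Complex.continuous_ofReal.tendsto' 1 1 Complex.ofReal_one).mono_left nhdsWithin_le_nhds
  · filter_upwards [self_mem_nhdsWithin] with s hs
    have : s ≠ 1 := ne_of_gt hs
    simpa using this

theorem sub_one_mul_dedekindZeta_eventuallyEq (hK : Module.finrank ℚ K = 2)
    [NumberField.IsTotallyComplex K] :
    (fun s : ℝ ↦ ((s : ℂ) - 1) * NumberField.dedekindZeta K s) =ᶠ[𝓝[>] 1]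
      fun s : ℝ ↦ (((s : ℂ) - 1) * riemannZeta s) * quadL K s := by
  filter_upwards [self_mem_nhdsWithin] with s hs
  rw [dedekindZeta_eq_mul hK (by simpa using hs), mul_assoc]

/-- A non-zero mean of χ would give L(s, χ) a pole at 1, and ζ · L a double pole there, whereas ζ_K
has a simple one. The additional factor s - 1 in the limits makes this contradiction explicit. The
vanishing is what makes L(s, χ) entire. -/
theorem sum_quadChar_eq_zero (hK : Module.finrank ℚ K = 2) [NumberField.IsTotallyComplex K]
    [NeZero (absDiscr K)] : ∑ a, quadChar K a = 0 := by
  have h1 := (ZMod.LFunction_residue_one (quadChar K)).comp tendsto_ofReal_nhdsGT_one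
  have h2 := riemannZeta_residue_one.comp tendsto_ofReal_nhdsGT_one
  have h3 := NumberField.tendsto_sub_one_mul_dedekindZeta_nhdsGT K
  have h4 : Tendsto (fun s : ℝ ↦ (s : ℂ) - 1) (𝓝[>] 1) (𝓝 0) := by
    have : Continuous fun s : ℝ ↦ (s : ℂ) - 1 := by fun_prop
    exact (this.tendsto' 1 0 (by simp)).mono_left nhdsWithin_le_nhds
  have h5 := h4.mul h3
  have h6 := h2.mul h1
  have h7 : (fun s : ℝ ↦ ((s : ℂ) - 1) * (((s : ℂ) - 1) * NumberField.dedekindZeta K s)) =ᶠ[𝓝[>] 1]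
      fun s : ℝ ↦ (((s : ℂ) - 1) * riemannZeta s) * (((s : ℂ) - 1) * quadL K s) := by
    filter_upwards [sub_one_mul_dedekindZeta_eventuallyEq hK] with s hs
    rw [hs]; ring
  have h8 := tendsto_nhds_unique (h5.congr' h7) h6
  rw [zero_mul, one_mul, ← Finset.sum_div, eq_comm, div_eq_zero_iff] at h8
  exact h8.resolve_right (by exact_mod_cast absDiscr_pos.ne')

theorem differentiable_quadL (hK : Module.finrank ℚ K = 2) [NumberField.IsTotallyComplex K] :
    Differentiable ℂ (quadL K) := by
  have : NeZero (absDiscr K) := ⟨absDiscr_pos.ne'⟩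
  exact ZMod.differentiable_LFunction_of_sum_zero (sum_quadChar_eq_zero hK)

/-- The Dirichlet class number formula. -/
theorem quadL_one (hK : Module.finrank ℚ K = 2) [NumberField.IsTotallyComplex K] :
    quadL K 1 = ((2 * Real.pi * NumberField.classNumber K /
      (NumberField.Units.torsionOrder K * Real.sqrt (absDiscr K)) : ℝ) : ℂ) := by
  have h2 := riemannZeta_residue_one.comp tendsto_ofReal_nhdsGT_one
  have h3 := NumberField.tendsto_sub_one_mul_dedekindZeta_nhdsGT K
  have h1 : Tendsto (fun s : ℝ ↦ quadL K s) (𝓝[>] 1) (𝓝 (quadL K 1)) :=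
    ((differentiable_quadL hK).continuous.tendsto 1).comp
      (tendsto_ofReal_nhdsGT_one.mono_right nhdsWithin_le_nhds)
  have h4 := tendsto_nhds_unique (h3.congr' (sub_one_mul_dedekindZeta_eventuallyEq hK)) (h2.mul h1)
  rw [one_mul, dedekindZeta_residue_eq hK] at h4
  exact h4.symm

/-- The second coefficient of the Laurent expansion of `ζ_K` at `1`. -/
theorem tendsto_dedekindZeta_sub (hK : Module.finrank ℚ K = 2) [NumberField.IsTotallyComplex K] :
    Tendsto (fun s : ℝ ↦ NumberField.dedekindZeta K s - quadL K 1 * riemannZeta s) (𝓝[>] 1)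
      (𝓝 (deriv (quadL K) 1)) := by
  have h2 := riemannZeta_residue_one.comp tendsto_ofReal_nhdsGT_one
  have h1 := (((differentiable_quadL hK) 1).hasDerivAt.tendsto_slope).comp tendsto_ofReal_nhdsGT_one
  have h := h2.mul h1
  rw [one_mul] at h
  refine h.congr' ?_
  filter_upwards [self_mem_nhdsWithin] with s hs
  have hs1 : (s : ℂ) - 1 ≠ 0 := by
    have : s ≠ 1 := ne_of_gt hs
    rw [sub_ne_zero]; simpa using this
  rw [dedekindZeta_eq_mul hK (by simpa using hs)]
  simp only [Function.comp_apply, slope_def_field]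
  field_simp

/-- The values of the Dedekind zeta function as sums over positive integers. -/
theorem hasSum_dedekindZeta (hK : Module.finrank ℚ K = 2) [NumberField.IsTotallyComplex K] {s : ℂ}
    (hs : 1 < s.re) :
    HasSum (fun n : ℕ+ ↦ (idealCount K n : ℂ) / (n : ℂ) ^ s) (NumberField.dedekindZeta K s) :=
  (lseriesSummable_idealCount hK hs).hasSum_pnat

end Zeta

/-! ### The Bessel function `K₀` -/

theorem besselK_zero_eq (z : ℂ) :
    besselK 0 z = ∫ t in Ioi (0 : ℝ), Complex.exp (-z * Real.cosh t) := by
  simp [besselK]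

theorem integrableOn_exp_neg_mul_cosh {x : ℝ} (hx : 0 < x) :
    IntegrableOn (fun t ↦ Real.exp (-x * Real.cosh t)) (Ioi 0) := by
  refine Integrable.mono' (exp_neg_integrableOn_Ioi 0 hx) (by fun_prop) ?_
  filter_upwards [ae_restrict_mem measurableSet_Ioi] with t ht
  rw [Real.norm_eq_abs, abs_of_pos (Real.exp_pos _), Real.exp_le_exp]
  have h1 : t ≤ Real.cosh t :=
    (Real.self_le_sinh_iff.mpr (le_of_lt ht)).trans (Real.sinh_lt_cosh t).le
  nlinarith

theorem norm_exp_neg_mul_cosh (z : ℂ) (t : ℝ) :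
    ‖Complex.exp (-z * Real.cosh t)‖ = Real.exp (-z.re * Real.cosh t) := by
  rw [Complex.norm_exp]
  congr 1
  rw [neg_mul, Complex.neg_re, Complex.re_mul_ofReal, neg_mul]

/-- The bound follows from cosh t ≥ (1 + t)/2 and from the cubic Taylor term (x/2)³/6 of exp(x/2).
Fourth-power decay suffices because the arguments grow like √n: it yields n^(-2), which is summable
against v(n). -/
theorem norm_besselK_zero_le {z : ℂ} (hz : 0 < z.re) : ‖besselK 0 z‖ ≤ 96 / z.re ^ 4 := by
  set x := z.re with hx
  rw [besselK_zero_eq]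
  have h1 : ‖∫ t in Ioi (0 : ℝ), Complex.exp (-z * Real.cosh t)‖ ≤
      ∫ t in Ioi (0 : ℝ), Real.exp (-(x / 2)) * Real.exp (-(x / 2) * t) := by
    refine norm_integral_le_of_norm_le ((exp_neg_integrableOn_Ioi 0 (half_pos hz)).const_mul _) ?_
    filter_upwards [ae_restrict_mem measurableSet_Ioi] with t ht
    rw [norm_exp_neg_mul_cosh, ← Real.exp_add, Real.exp_le_exp, ← hx]
    have h1 : t ≤ Real.cosh t :=
      (Real.self_le_sinh_iff.mpr (le_of_lt ht)).trans (Real.sinh_lt_cosh t).le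
    have h2 := Real.one_le_cosh t
    nlinarith
  refine h1.trans ?_
  rw [integral_const_mul, integral_exp_mul_Ioi (by linarith), mul_zero, Real.exp_zero]
  have h2 : Real.exp (-(x / 2)) ≤ 48 / x ^ 3 := by
    have := Real.pow_div_factorial_le_exp (x / 2) (by positivity) 3
    rw [Real.exp_neg, inv_le_comm₀ (Real.exp_pos _) (by positivity)]
    refine le_trans (le_of_eq ?_) this
    simp [Nat.factorial]
    ring
  have h3 : -1 / -(x / 2) = 2 / x := by field_simp
  rw [h3]
  calc _ ≤ 48 / x ^ 3 * (2 / x) := by gcongr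
    _ = _ := by field_simp; norm_num

theorem differentiableAt_besselK_zero {z : ℂ} (hz : 0 < z.re) :
    DifferentiableAt ℂ (besselK 0) z := by
  have heq : besselK 0 = fun z ↦ ∫ t in Ioi (0 : ℝ), Complex.exp (-z * Real.cosh t) :=
    funext besselK_zero_eq
  rw [heq]
  set ε := z.re / 2 with hε
  have hε0 : 0 < ε := by positivity
  have hre {w : ℂ} (hw : w ∈ Metric.ball z ε) : ε ≤ w.re := by
    have h1 : |(w - z).re| ≤ ‖w - z‖ := Complex.abs_re_le_norm _
    rw [Metric.mem_ball, dist_eq_norm] at hw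
    have h2 := (abs_le.mp (h1.trans hw.le)).1
    rw [Complex.sub_re] at h2
    linarith
  have hcont (w : ℂ) : Continuous fun t : ℝ ↦ Complex.exp (-w * Real.cosh t) := by fun_prop
  refine (hasDerivAt_integral_of_dominated_loc_of_deriv_le
    (F := fun w t ↦ Complex.exp (-w * Real.cosh t))
    (F' := fun w t ↦ Complex.exp (-w * Real.cosh t) * (-Real.cosh t))
    -- Half of the exponential decay absorbs the factor cosh t brought down by differentiation; the
    -- other half keeps the bound integrable.
    (bound := fun t ↦ 2 / ε * Real.exp (-(ε / 2) * Real.cosh t))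
    (Metric.ball_mem_nhds z hε0) ?_ ?_ ?_ ?_ ?_ ?_).2.differentiableAt
  · exact Eventually.of_forall fun w ↦ (hcont w).aestronglyMeasurable
  · refine Integrable.mono' (integrableOn_exp_neg_mul_cosh hz) (hcont z).aestronglyMeasurable ?_
    exact Eventually.of_forall fun t ↦ (norm_exp_neg_mul_cosh z t).le
  · exact (Continuous.aestronglyMeasurable (by fun_prop))
  · refine Eventually.of_forall fun t w hw ↦ ?_
    rw [norm_mul, norm_exp_neg_mul_cosh, norm_neg, Complex.norm_real, Real.norm_eq_abs,
      abs_of_pos (Real.cosh_pos t)]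
    have hc := Real.cosh_pos t
    have h1 : Real.exp (-w.re * Real.cosh t) ≤
        Real.exp (-(ε / 2) * Real.cosh t) * Real.exp (-(ε / 2) * Real.cosh t) := by
      rw [← Real.exp_add, Real.exp_le_exp]
      nlinarith [hre hw]
    have h2 : Real.exp (-(ε / 2) * Real.cosh t) * Real.cosh t ≤ 2 / ε := by
      have h3 := Real.add_one_le_exp (ε / 2 * Real.cosh t)
      rw [neg_mul, Real.exp_neg, inv_mul_le_iff₀ (Real.exp_pos _), mul_div_assoc', le_div_iff₀ hε0]
      linarith
    calc _ ≤ Real.exp (-(ε / 2) * Real.cosh t) * Real.exp (-(ε / 2) * Real.cosh t) *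
          Real.cosh t := by gcongr
      _ = Real.exp (-(ε / 2) * Real.cosh t) * Real.cosh t * Real.exp (-(ε / 2) * Real.cosh t) := by
          ring
      _ ≤ _ := by gcongr
  · exact (integrableOn_exp_neg_mul_cosh (half_pos hε0)).const_mul _
  · refine Eventually.of_forall fun t w _ ↦ ?_
    have := ((hasDerivAt_id w).neg.mul_const (Real.cosh t : ℂ)).cexp
    simpa using this

/-- The value of `K₀` on the positive real axis. -/
noncomputable def realK (x : ℝ) : ℝ := ∫ t in Ioi (0 : ℝ), Real.exp (-x * Real.cosh t)

theorem besselK_zero_ofReal (x : ℝ) : besselK 0 x = realK x := by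
  rw [besselK_zero_eq, realK, ← integral_complex_ofReal]
  simp

theorem realK_nonneg (x : ℝ) : 0 ≤ realK x :=
  setIntegral_nonneg measurableSet_Ioi fun _ _ ↦ (Real.exp_pos _).le

theorem realK_le {x : ℝ} (hx : 0 < x) : realK x ≤ 96 / x ^ 4 := by
  have h := norm_besselK_zero_le (z := x) (by simpa using hx)
  rw [besselK_zero_ofReal, Complex.norm_real, Real.norm_eq_abs, abs_of_nonneg (realK_nonneg x),
    Complex.ofReal_re] at h
  exact h

theorem integrable_exp_neg_mul_cosh {x : ℝ} (hx : 0 < x) :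
    Integrable fun t ↦ Real.exp (-x * Real.cosh t) := by
  have h1 := integrableOn_exp_neg_mul_cosh hx
  have h2 : IntegrableOn (fun t ↦ Real.exp (-x * Real.cosh t)) (Iic 0) := by
    rw [← Measure.map_neg_eq_self (volume : Measure ℝ)]
    have m : MeasurableEmbedding fun x : ℝ ↦ -x := (Homeomorph.neg ℝ).measurableEmbedding
    rw [m.integrableOn_map_iff]
    simp_rw [Function.comp_def, Real.cosh_neg, neg_preimage, neg_Iic, neg_zero]
    exact Iff.mpr integrableOn_Ici_iff_integrableOn_Ioi h1
  rw [← integrableOn_univ, ← Iic_union_Ioi (a := (0 : ℝ))]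
  exact h2.union h1

/-- The Laplace type integral representation of `K₀`. -/
theorem integral_inv_mul_exp_neg_div_add {B a : ℝ} (hB : 0 < B) (ha : 0 < a) :
    IntegrableOn (fun t : ℝ ↦ t⁻¹ * Real.exp (-B / t) * Real.exp (-a * t)) (Ioi 0) ∧
    ∫ t in Ioi (0 : ℝ), t⁻¹ * Real.exp (-B / t) * Real.exp (-a * t) =
      2 * realK (2 * Real.sqrt (B * a)) := by
  -- The scale c balances the two exponents: with t = c e^u they add up to -(2q) cosh u, and dt/t =
  -- du.
  set c := Real.sqrt (B / a) with hc
  have hc0 : 0 < c := Real.sqrt_pos.mpr (by positivity)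
  set q := Real.sqrt (B * a) with hq
  have hq0 : 0 < q := Real.sqrt_pos.mpr (by positivity)
  have hca : a * c = q := by
    rw [hc, hq, ← Real.sqrt_sq ha.le, ← Real.sqrt_mul (by positivity), Real.sqrt_sq ha.le]
    congr 1
    field_simp
  have hBc : B / c = q := by
    rw [div_eq_iff hc0.ne', hc, hq, ← Real.sqrt_mul (by positivity)]
    rw [show B * a * (B / a) = B ^ 2 by field_simp, Real.sqrt_sq hB.le]
  have himg : Set.image (fun u : ℝ ↦ c * Real.exp u) univ = Ioi 0 := by
    ext t
    simp only [image_univ, mem_range, mem_Ioi]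
    constructor
    · rintro ⟨u, rfl⟩; positivity
    · intro ht
      exact ⟨Real.log (t / c), by rw [Real.exp_log (by positivity)]; field_simp⟩
  have hder : ∀ u ∈ (univ : Set ℝ), HasDerivWithinAt (fun u : ℝ ↦ c * Real.exp u)
      (c * Real.exp u) univ u := fun u _ ↦ ((Real.hasDerivAt_exp u).const_mul c).hasDerivWithinAt
  have hinj : InjOn (fun u : ℝ ↦ c * Real.exp u) univ := fun u _ u' _ h ↦
    Real.exp_injective (mul_left_cancel₀ hc0.ne' h)
  have hfun (u : ℝ) : |c * Real.exp u| • ((c * Real.exp u)⁻¹ * Real.exp (-B / (c * Real.exp u)) *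
      Real.exp (-a * (c * Real.exp u))) = Real.exp (-(2 * q) * Real.cosh |u|) := by
    have hpos : 0 < c * Real.exp u := by positivity
    rw [abs_of_pos hpos, smul_eq_mul, ← mul_assoc, mul_inv_cancel_left₀ hpos.ne', ← Real.exp_add,
      Real.cosh_abs, Real.cosh_eq]
    congr 1
    have h1 : -B / (c * Real.exp u) = -q * Real.exp (-u) := by
      rw [← hBc, Real.exp_neg]; field_simp
    have h2 : -a * (c * Real.exp u) = -q * Real.exp u := by rw [← hca]; ring
    rw [h1, h2]
    ring
  rw [← himg]
  constructor
  · rw [integrableOn_image_iff_integrableOn_abs_deriv_smul MeasurableSet.univ hder hinj]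
    simp only [hfun]
    simpa using integrable_exp_neg_mul_cosh (by positivity : 0 < 2 * q)
  · rw [integral_image_eq_integral_abs_deriv_smul MeasurableSet.univ hder hinj]
    simp only [hfun, Measure.restrict_univ]
    rw [integral_comp_abs (f := fun u ↦ Real.exp (-(2 * q) * Real.cosh u)), realK]

/-! ### Modular theta series and the analogue of the digamma function -/

/-- A theta series `c₀ + ∑ v(n) e ^ (-n t)` with non-negative coefficients that satisfies the
functional equation under `t ↦ 4 π² / (D t)`. -/
structure IsModularTheta (v : ℕ+ → ℝ) (D c₀ : ℝ) (S : ℝ → ℝ) : Prop where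
  D_pos : 0 < D
  const_nonneg : 0 ≤ c₀
  nonneg : ∀ n, 0 ≤ v n
  summable : ∀ s : ℝ, 1 < s → Summable fun n : ℕ+ ↦ v n / (n : ℝ) ^ s
  hasSum : ∀ t, 0 < t → HasSum (fun n : ℕ+ ↦ v n * Real.exp (-t * n)) (S t)
  modular : ∀ t, 0 < t → c₀ + S t =
    2 * Real.pi / (Real.sqrt D * t) * (c₀ + S (4 * Real.pi ^ 2 / (D * t)))

namespace IsModularTheta

variable {v : ℕ+ → ℝ} {D c₀ : ℝ} {S : ℝ → ℝ}

/-- The residue of the associated Dirichlet series. -/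
noncomputable def res (D c₀ : ℝ) : ℝ := 2 * Real.pi * c₀ / Real.sqrt D

theorem S_nonneg (h : IsModularTheta v D c₀ S) {t : ℝ} (ht : 0 < t) : 0 ≤ S t :=
  (h.hasSum t ht).nonneg fun n ↦ mul_nonneg (h.nonneg n) (Real.exp_pos _).le

/-- Every index n is at least 1, so each term decays at least as fast as e^(-t). -/
theorem S_le (h : IsModularTheta v D c₀ S) {t t₀ : ℝ} (ht₀ : 0 < t₀) (ht : t₀ ≤ t) :
    S t ≤ Real.exp (t₀ - t) * S t₀ := by
  refine hasSum_le (fun n ↦ ?_) (h.hasSum t (ht₀.trans_le ht))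
    ((h.hasSum t₀ ht₀).mul_left (Real.exp (t₀ - t)))
  have hn : (1 : ℝ) ≤ n := by exact_mod_cast n.pos
  have := h.nonneg n
  calc v n * Real.exp (-t * n) ≤ v n * Real.exp (t₀ - t + -t₀ * n) := by
        gcongr; nlinarith
    _ = _ := by rw [Real.exp_add]; ring

theorem antitoneOn_S (h : IsModularTheta v D c₀ S) : AntitoneOn S (Ioi 0) := by
  intro t₀ ht₀ t _ htt
  refine (h.S_le ht₀ htt).trans ?_
  have h1 : Real.exp (t₀ - t) ≤ 1 := Real.exp_le_one_iff.mpr (by linarith)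
  exact mul_le_of_le_one_left (h.S_nonneg ht₀) h1

/-- Monotonicity gives measurability without looking at the partial sums. -/
theorem aestronglyMeasurable_S (h : IsModularTheta v D c₀ S) :
    AEStronglyMeasurable S (volume.restrict (Ioi 0)) :=
  (aemeasurable_restrict_of_antitoneOn measurableSet_Ioi h.antitoneOn_S).aestronglyMeasurable

/-- The dual series occurring in the functional equation. -/
theorem S_eq (h : IsModularTheta v D c₀ S) {t : ℝ} (ht : 0 < t) : S t = -c₀ + res D c₀ / t +
    2 * Real.pi / (Real.sqrt D * t) * S (4 * Real.pi ^ 2 / D / t) := by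
  have h1 := h.modular t ht
  have hD := Real.sqrt_pos.mpr h.D_pos
  rw [div_div, res]
  have : 2 * Real.pi * c₀ / Real.sqrt D / t = 2 * Real.pi / (Real.sqrt D * t) * c₀ := by
    field_simp
  rw [this]
  linarith

/-- Near 0 the dual argument tends to infinity, so the exponential decay of S beats the factor 1/t.
For t ≥ 1 the functional equation expresses the dual term through S and c₀. -/
theorem exists_dual_bound (h : IsModularTheta v D c₀ S) : ∃ C, 0 ≤ C ∧ ∀ t, 0 < t →
    2 * Real.pi / (Real.sqrt D * t) * S (4 * Real.pi ^ 2 / D / t) ≤ C := by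
  have hD := h.D_pos
  have hsD := Real.sqrt_pos.mpr h.D_pos
  have hpi := Real.pi_pos
  set B := 4 * Real.pi ^ 2 / D with hB
  have hB0 : 0 < B := by positivity
  have hSB := h.S_nonneg hB0
  have hS1 := h.S_nonneg one_pos
  have hc := h.const_nonneg
  refine ⟨2 * Real.pi / Real.sqrt D * (Real.exp B * S B / B) + (S 1 + c₀), by positivity,
    fun t ht ↦ ?_⟩
  rcases le_total t 1 with h1 | h1
  · have hBt : B ≤ B / t := by rw [le_div_iff₀ ht]; nlinarith
    have h2 := h.S_le hB0 hBt
    have h3 : Real.exp (-(B / t)) ≤ t / B := by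
      rw [Real.exp_neg, inv_le_comm₀ (Real.exp_pos _) (by positivity), inv_div]
      linarith [Real.add_one_le_exp (B / t)]
    have h4 : S (B / t) ≤ Real.exp B * (t / B) * S B := by
      refine h2.trans ?_
      rw [sub_eq_add_neg, Real.exp_add]
      gcongr
    have h5 : 2 * Real.pi / (Real.sqrt D * t) * S (B / t) ≤
        2 * Real.pi / Real.sqrt D * (Real.exp B * S B / B) := by
      calc _ ≤ 2 * Real.pi / (Real.sqrt D * t) * (Real.exp B * (t / B) * S B) := by gcongr
        _ = _ := by field_simp
    linarith
  · have h2 := h.S_eq ht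
    rw [← hB] at h2
    have h3 := h.antitoneOn_S (mem_Ioi.mpr one_pos) (mem_Ioi.mpr ht) h1
    have h4 : 0 ≤ res D c₀ / t := by unfold res; positivity
    have h5 : 0 ≤ 2 * Real.pi / Real.sqrt D * (Real.exp B * S B / B) := by positivity
    linarith

theorem integrableOn_dual_mul_exp (h : IsModularTheta v D c₀ S) {a : ℝ} (ha : 0 < a) :
    IntegrableOn (fun t ↦
    2 * Real.pi / (Real.sqrt D * t) * S (4 * Real.pi ^ 2 / D / t) * Real.exp (-a * t)) (Ioi 0) := by
  obtain ⟨C, hC0, hC⟩ := h.exists_dual_bound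
  have hmeas : AEStronglyMeasurable (fun t ↦ (S t + c₀ - res D c₀ * t⁻¹) * Real.exp (-a * t))
      (volume.restrict (Ioi 0)) := by
    refine AEStronglyMeasurable.mul ((h.aestronglyMeasurable_S.add_const _).sub ?_) (by fun_prop)
    exact (measurable_inv.const_mul _).aestronglyMeasurable
  refine Integrable.mono' ((exp_neg_integrableOn_Ioi 0 ha).const_mul C) (hmeas.congr ?_) ?_
  · filter_upwards [ae_restrict_mem measurableSet_Ioi] with t ht
    rw [h.S_eq ht]
    ring
  · filter_upwards [ae_restrict_mem measurableSet_Ioi] with t ht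
    have hD := Real.sqrt_pos.mpr h.D_pos
    have ht' : (0 : ℝ) < t := ht
    have := h.S_nonneg (show 0 < 4 * Real.pi ^ 2 / D / t by
      have := h.D_pos; positivity)
    rw [Real.norm_eq_abs, abs_of_nonneg (by positivity)]
    exact mul_le_mul_of_nonneg_right (hC t ht) (Real.exp_pos _).le

theorem realK_term_le (h : IsModularTheta v D c₀ S) {a : ℝ} (ha : 0 < a) (n : ℕ+) :
    v n * realK (4 * Real.pi / Real.sqrt D * Real.sqrt (n * a)) ≤
      96 / (4 * Real.pi / Real.sqrt D) ^ 4 / a ^ 2 * (v n / (n : ℝ) ^ (2 : ℝ)) := by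
  have hsD := Real.sqrt_pos.mpr h.D_pos
  have hpi := Real.pi_pos
  have hn : (0 : ℝ) < n := by exact_mod_cast n.pos
  have hsq : 0 < Real.sqrt (n * a) := Real.sqrt_pos.mpr (by positivity)
  have h1 := realK_le (x := 4 * Real.pi / Real.sqrt D * Real.sqrt (n * a)) (by positivity)
  have h2 : Real.sqrt (n * a) ^ 4 = ((n : ℝ) * a) ^ 2 := by
    rw [show 4 = 2 * 2 by norm_num, pow_mul, Real.sq_sqrt (by positivity)]
  have := h.nonneg n
  calc _ ≤ v n * (96 / (4 * Real.pi / Real.sqrt D * Real.sqrt (n * a)) ^ 4) := by gcongr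
    _ = _ := by
      rw [mul_pow, h2, Real.rpow_two]
      field_simp

theorem summable_realK (h : IsModularTheta v D c₀ S) {a : ℝ} (ha : 0 < a) :
    Summable fun n : ℕ+ ↦ v n * realK (4 * Real.pi / Real.sqrt D * Real.sqrt (n * a)) :=
  Summable.of_nonneg_of_le (fun n ↦ mul_nonneg (h.nonneg n) (realK_nonneg _))
    (h.realK_term_le ha) ((h.summable 2 one_lt_two).mul_left _)

/-- Term by term this is the Laplace integral of K₀ with B replaced by Bn. Non-negativity reduces
the exchange of sum and integral to the convergence of the K-series. -/
theorem integral_dual_mul_exp (h : IsModularTheta v D c₀ S) {a : ℝ} (ha : 0 < a) :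
    ∫ t in Ioi (0 : ℝ), 2 * Real.pi / (Real.sqrt D * t) * S (4 * Real.pi ^ 2 / D / t) *
      Real.exp (-a * t) =
    4 * Real.pi / Real.sqrt D *
      ∑' n : ℕ+, v n * realK (4 * Real.pi / Real.sqrt D * Real.sqrt (n * a)) := by
  have hD := h.D_pos
  have hsD := Real.sqrt_pos.mpr h.D_pos
  have hpi := Real.pi_pos
  set B := 4 * Real.pi ^ 2 / D with hB
  have hB0 : 0 < B := by positivity
  have hn (n : ℕ+) : (0 : ℝ) < n := by exact_mod_cast n.pos
  have hroot (n : ℕ+) : 2 * Real.sqrt (B * n * a) =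
      4 * Real.pi / Real.sqrt D * Real.sqrt (n * a) := by
    rw [mul_assoc, Real.sqrt_mul hB0.le, hB, Real.sqrt_div (by positivity),
      show 4 * Real.pi ^ 2 = (2 * Real.pi) ^ 2 by ring, Real.sqrt_sq (by positivity)]
    ring
  have key (n : ℕ+) := integral_inv_mul_exp_neg_div_add (mul_pos hB0 (hn n)) ha
  let F : ℕ+ → ℝ → ℝ := fun n t ↦ 2 * Real.pi / Real.sqrt D * v n *
    (t⁻¹ * Real.exp (-(B * n) / t) * Real.exp (-a * t))
  have hF (n : ℕ+) : Integrable (F n) (volume.restrict (Ioi 0)) := (key n).1.const_mul _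
  have hFint (n : ℕ+) : ∫ t in Ioi (0 : ℝ), F n t = 4 * Real.pi / Real.sqrt D *
      (v n * realK (4 * Real.pi / Real.sqrt D * Real.sqrt (n * a))) := by
    rw [integral_const_mul, (key n).2, hroot]
    ring
  have hFnorm (n : ℕ+) : ∫ t in Ioi (0 : ℝ), ‖F n t‖ = ∫ t in Ioi (0 : ℝ), F n t := by
    refine setIntegral_congr_fun measurableSet_Ioi fun t ht ↦ ?_
    have := h.nonneg n
    have ht' : (0 : ℝ) < t := ht
    exact Real.norm_of_nonneg (by positivity)
  have hsum := hasSum_integral_of_summable_integral_norm hF (by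
    simp_rw [hFnorm, hFint]
    exact (h.summable_realK ha).mul_left _)
  simp_rw [hFint] at hsum
  rw [← tsum_mul_left, hsum.tsum_eq]
  refine setIntegral_congr_fun measurableSet_Ioi fun t ht ↦ ?_
  have ht' : (0 : ℝ) < t := ht
  have hS := (h.hasSum (B / t) (by positivity)).mul_left
    (2 * Real.pi / (Real.sqrt D * t) * Real.exp (-a * t))
  have : (fun n : ℕ+ ↦ 2 * Real.pi / (Real.sqrt D * t) * Real.exp (-a * t) *
      (v n * Real.exp (-(B / t) * n))) = fun n ↦ F n t := by
    funext n
    simp only [F]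
    rw [show -(B * n) / t = -(B / t) * n by ring]
    field_simp
  rw [this] at hS
  rw [hS.tsum_eq]
  ring

end IsModularTheta

/-! ### Increments of the digamma analogue on the positive axis -/

theorem integral_exp_neg_mul_Ioi {a : ℝ} (ha : 0 < a) :
    ∫ t in Ioi (0 : ℝ), Real.exp (-a * t) = 1 / a := by
  rw [integral_exp_mul_Ioi (by linarith), mul_zero, Real.exp_zero]
  field_simp

theorem frullani_exp {a b : ℝ} (ha : 0 < a) (hab : a ≤ b) :
    IntegrableOn (fun t ↦ (Real.exp (-a * t) - Real.exp (-b * t)) / t) (Ioi 0) ∧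
    ∫ t in Ioi (0 : ℝ), (Real.exp (-a * t) - Real.exp (-b * t)) / t = Real.log (b / a) := by
  have h_integral : IntegrableOn (fun t ↦ (Real.exp (-a * t) - Real.exp (-b * t)) / t) (Ioi 0) := by
    refine Integrable.mono' ((exp_neg_integrableOn_Ioi 0 ha).const_mul (b - a)) ?_ ?_
    · exact Measurable.aestronglyMeasurable (by fun_prop)
    · filter_upwards [ae_restrict_mem measurableSet_Ioi] with t ht
      have ht' : (0 : ℝ) < t := ht
      have h1 : Real.exp (-b * t) ≤ Real.exp (-a * t) := by
        rw [Real.exp_le_exp]; nlinarith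
      rw [Real.norm_eq_abs, abs_of_nonneg (div_nonneg (by linarith) ht'.le), div_le_iff₀ ht']
      have h2 := Real.add_one_le_exp (-(b - a) * t)
      have h3 : Real.exp (-b * t) = Real.exp (-a * t) * Real.exp (-(b - a) * t) := by
        rw [← Real.exp_add]; ring_nf
      rw [h3]
      nlinarith [Real.exp_pos (-a * t)]
  refine ⟨h_integral, ?_⟩
  have hb := ha.trans_le hab
  have h1 := Frullani.integral_Ioi_eq (f := fun x : ℝ ↦ Real.exp (-x)) (a := a) (b := b)
    (L := 1) (R := 0)
    (Continuous.locallyIntegrable (by fun_prop) |>.locallyIntegrableOn _) ha hb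
    ((Continuous.tendsto' (by fun_prop) 0 1 (by simp)).mono_left nhdsWithin_le_nhds)
    (Real.tendsto_exp_neg_atTop_nhds_zero) (by
      refine h_integral.congr_fun (fun t _ ↦ ?_) measurableSet_Ioi
      simp [div_eq_inv_mul])
  rw [sub_zero, smul_eq_mul, mul_one] at h1
  rw [← h1]
  refine setIntegral_congr_fun measurableSet_Ioi fun t _ ↦ ?_
  simp [div_eq_inv_mul]

namespace IsModularTheta

variable {v : ℕ+ → ℝ} {D c₀ : ℝ} {S : ℝ → ℝ}

theorem summable_div_sq (h : IsModularTheta v D c₀ S) :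
    Summable fun n : ℕ+ ↦ v n / (n : ℝ) ^ 2 := by
  simpa using h.summable 2 one_lt_two

theorem summable_inv_sub_inv (h : IsModularTheta v D c₀ S) {a : ℝ} (ha : 0 ≤ a) :
    Summable fun n : ℕ+ ↦ v n * (1 / (n : ℝ) - 1 / (n + a)) := by
  have hn (n : ℕ+) : (0 : ℝ) < n := by exact_mod_cast n.pos
  have heq (n : ℕ+) : (1 / (n : ℝ) - 1 / (n + a)) = a / (n * (n + a)) := by
    have := hn n
    have : (n : ℝ) + a ≠ 0 := by positivity
    field_simp
    ring
  refine Summable.of_nonneg_of_le (fun n ↦ ?_) (fun n ↦ ?_) (h.summable_div_sq.mul_left a)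
  · have := hn n
    have := h.nonneg n
    rw [heq]
    positivity
  · have hn0 := hn n
    have := h.nonneg n
    rw [heq]
    calc v n * (a / (n * (n + a))) ≤ v n * (a / (n * n)) := by gcongr; linarith
      _ = _ := by ring

theorem summable_inv_add_sub_inv_add (h : IsModularTheta v D c₀ S) {a b : ℝ} (ha : 0 < a)
    (hb : 0 < b) :
    Summable fun n : ℕ+ ↦ v n * (1 / ((n : ℝ) + a) - 1 / (n + b)) := by
  refine ((h.summable_inv_sub_inv hb.le).sub (h.summable_inv_sub_inv ha.le)).congr fun n ↦ ?_
  ring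

/-- Each 1/(n + a) is the Laplace transform of e^(-nt) at a. All terms have a constant sign since a
≤ b, so sum and integral may be exchanged. -/
theorem tsum_inv_sub_eq_integral (h : IsModularTheta v D c₀ S) {a b : ℝ} (ha : 0 < a)
    (hab : a ≤ b) :
    ∑' n : ℕ+, v n * (1 / ((n : ℝ) + a) - 1 / (n + b)) =
      ∫ t in Ioi (0 : ℝ), S t * (Real.exp (-a * t) - Real.exp (-b * t)) := by
  have hb := ha.trans_le hab
  have hn (n : ℕ+) : (0 : ℝ) < n := by exact_mod_cast n.pos
  let F : ℕ+ → ℝ → ℝ := fun n t ↦ v n * (Real.exp (-(n + a) * t) - Real.exp (-(n + b) * t))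
  have hi (n : ℕ+) {c : ℝ} (hc : 0 < c) :
      IntegrableOn (fun t ↦ Real.exp (-(n + c) * t)) (Ioi 0) :=
    exp_neg_integrableOn_Ioi 0 (by have := hn n; positivity)
  have hF (n : ℕ+) : Integrable (F n) (volume.restrict (Ioi 0)) :=
    ((hi n ha).sub (hi n hb)).const_mul _
  have hFint (n : ℕ+) : ∫ t in Ioi (0 : ℝ), F n t = v n * (1 / ((n : ℝ) + a) - 1 / (n + b)) := by
    have := hn n
    rw [integral_const_mul, integral_sub (hi n ha) (hi n hb),
      integral_exp_neg_mul_Ioi (by positivity), integral_exp_neg_mul_Ioi (by positivity)]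
  have hFnorm (n : ℕ+) : ∫ t in Ioi (0 : ℝ), ‖F n t‖ = ∫ t in Ioi (0 : ℝ), F n t := by
    refine setIntegral_congr_fun measurableSet_Ioi fun t ht ↦ ?_
    have ht' : (0 : ℝ) < t := ht
    refine Real.norm_of_nonneg (mul_nonneg (h.nonneg n) (sub_nonneg.mpr ?_))
    rw [Real.exp_le_exp]
    nlinarith
  have hsum := hasSum_integral_of_summable_integral_norm hF (by
    simp_rw [hFnorm, hFint]
    exact h.summable_inv_add_sub_inv_add ha hb)
  simp_rw [hFint] at hsum
  rw [hsum.tsum_eq]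
  refine setIntegral_congr_fun measurableSet_Ioi fun t ht ↦ ?_
  have hS := (h.hasSum t ht).mul_right (Real.exp (-a * t) - Real.exp (-b * t))
  have : (fun n : ℕ+ ↦ v n * Real.exp (-t * n) * (Real.exp (-a * t) - Real.exp (-b * t))) =
      fun n ↦ F n t := by
    funext n
    simp only [F]
    rw [show -((n : ℝ) + a) * t = -t * n + -a * t by ring,
      show -((n : ℝ) + b) * t = -t * n + -b * t by ring, Real.exp_add, Real.exp_add]
    ring
  rw [this] at hS
  exact hS.tsum_eq

/-- The analogue of the digamma function (shifted so as to vanish at `0`), on the positive real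
axis. -/
noncomputable def realPsi (v : ℕ+ → ℝ) (a : ℝ) : ℝ := ∑' n : ℕ+, v n * (1 / (n : ℝ) - 1 / (n + a))

/-- The series of `K`-Bessel functions dual to `realPsi`. -/
noncomputable def realKSum (v : ℕ+ → ℝ) (D a : ℝ) : ℝ :=
  ∑' n : ℕ+, v n * realK (4 * Real.pi / Real.sqrt D * Real.sqrt (n * a))

/-- The functional equation splits S into -c₀, res/t and the dual series. They give respectively the
terms in c₀, a Frullani logarithm and the K-series. The difference of exponentials is needed because
res/t alone is not integrable at 0. -/
theorem realPsi_sub_realPsi (h : IsModularTheta v D c₀ S) {a b : ℝ} (ha : 0 < a) (hab : a ≤ b) :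
    realPsi v b - realPsi v a = c₀ / b - c₀ / a + res D c₀ * Real.log (b / a) +
      4 * Real.pi / Real.sqrt D * (realKSum v D a - realKSum v D b) := by
  have hb := ha.trans_le hab
  have h1 : realPsi v b - realPsi v a =
      ∑' n : ℕ+, v n * (1 / ((n : ℝ) + a) - 1 / (n + b)) := by
    rw [realPsi, realPsi,
      ← (h.summable_inv_sub_inv hb.le).tsum_sub (h.summable_inv_sub_inv ha.le)]
    exact tsum_congr fun n ↦ by ring
  rw [h1, h.tsum_inv_sub_eq_integral ha hab]
  have hfr := frullani_exp ha hab
  have hea : IntegrableOn (fun t ↦ Real.exp (-a * t)) (Ioi 0) := exp_neg_integrableOn_Ioi 0 ha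
  have heb : IntegrableOn (fun t ↦ Real.exp (-b * t)) (Ioi 0) := exp_neg_integrableOn_Ioi 0 hb
  have hda := h.integrableOn_dual_mul_exp ha
  have hdb := h.integrableOn_dual_mul_exp hb
  have heq : ∫ t in Ioi (0 : ℝ), S t * (Real.exp (-a * t) - Real.exp (-b * t)) =
      ∫ t in Ioi (0 : ℝ), ((-c₀ * (Real.exp (-a * t) - Real.exp (-b * t)) +
        res D c₀ * ((Real.exp (-a * t) - Real.exp (-b * t)) / t)) +
        (2 * Real.pi / (Real.sqrt D * t) * S (4 * Real.pi ^ 2 / D / t) * Real.exp (-a * t) -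
        2 * Real.pi / (Real.sqrt D * t) * S (4 * Real.pi ^ 2 / D / t) * Real.exp (-b * t))) := by
    refine setIntegral_congr_fun measurableSet_Ioi fun t ht ↦ ?_
    rw [h.S_eq ht]
    ring
  have hi1 : IntegrableOn (fun t ↦ -c₀ * (Real.exp (-a * t) - Real.exp (-b * t))) (Ioi 0) :=
    (hea.sub heb).const_mul _
  have hi2 : IntegrableOn (fun t ↦ res D c₀ * ((Real.exp (-a * t) - Real.exp (-b * t)) / t))
    (Ioi 0) := hfr.1.const_mul _
  have hi3 : IntegrableOn (fun t ↦ -c₀ * (Real.exp (-a * t) - Real.exp (-b * t)) +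
    res D c₀ * ((Real.exp (-a * t) - Real.exp (-b * t)) / t)) (Ioi 0) := hi1.add hi2
  have hi4 : IntegrableOn (fun t ↦
    2 * Real.pi / (Real.sqrt D * t) * S (4 * Real.pi ^ 2 / D / t) * Real.exp (-a * t) -
    2 * Real.pi / (Real.sqrt D * t) * S (4 * Real.pi ^ 2 / D / t) * Real.exp (-b * t)) (Ioi 0) :=
    hda.sub hdb
  rw [heq, integral_add hi3 hi4, integral_add hi1 hi2, integral_const_mul,
    integral_const_mul, integral_sub hea heb, integral_sub hda hdb, hfr.2,
    integral_exp_neg_mul_Ioi ha, integral_exp_neg_mul_Ioi hb, h.integral_dual_mul_exp ha,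
    h.integral_dual_mul_exp hb, realKSum, realKSum]
  ring

/-- The Lambert series of the constant sequence `1`. -/
theorem _root_.hasSum_exp_neg_mul_pnat {t : ℝ} (ht : 0 < t) :
    HasSum (fun n : ℕ+ ↦ Real.exp (-t * n)) (1 / (Real.exp t - 1)) := by
  have h1 : Real.exp (-t) < 1 := Real.exp_lt_one_iff.mpr (by linarith)
  have hg := (hasSum_geometric_of_lt_one (Real.exp_pos (-t)).le h1).mul_left (Real.exp (-t))
  rw [← Equiv.pnatEquivNat.hasSum_iff] at hg
  have hfun : (fun n : ℕ+ ↦ Real.exp (-t * n)) =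
      (fun i ↦ Real.exp (-t) * Real.exp (-t) ^ i) ∘ Equiv.pnatEquivNat := by
    funext n
    simp only [Function.comp_apply, Equiv.pnatEquivNat_apply]
    rw [← pow_succ', PNat.natPred, Nat.sub_add_cancel n.pos, ← Real.exp_nat_mul]
    ring_nf
  have hval : 1 / (Real.exp t - 1) = Real.exp (-t) * (1 - Real.exp (-t))⁻¹ := by
    have : Real.exp t - 1 ≠ 0 := by
      have := Real.one_lt_exp_iff.mpr ht
      linarith
    rw [Real.exp_neg]
    have he := (Real.exp_pos t).ne'
    have : 1 - (Real.exp t)⁻¹ ≠ 0 := by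
      rw [← Real.exp_neg]; linarith
    field_simp
  rw [hfun, hval]
  exact hg

/-! ### The constant term at s = 1 and the value of `realPsi` -/

theorem hasSum_sub_res (h : IsModularTheta v D c₀ S) {t : ℝ} (ht : 0 < t) :
    HasSum (fun n : ℕ+ ↦ (v n - res D c₀) * Real.exp (-t * n))
      (S t - res D c₀ / (Real.exp t - 1)) := by
  have h1 := (h.hasSum t ht).sub ((hasSum_exp_neg_mul_pnat ht).mul_left (res D c₀))
  simp only [← sub_mul, mul_one_div] at h1
  exact h1

theorem res_nonneg (h : IsModularTheta v D c₀ S) : 0 ≤ res D c₀ := by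
  have := h.const_nonneg
  have := Real.pi_pos
  unfold res
  positivity

/-- The function res/(e^t - 1) is the series of the constant coefficient res. Subtracting it removes
the singularity of S at 0, while both parts decay like e^(-t) at infinity. This is the majorant for
both limits defining the constant term. -/
theorem exists_bound_sub_res (h : IsModularTheta v D c₀ S) : ∃ C, 0 ≤ C ∧ ∀ t, 0 < t →
    |S t - res D c₀ / (Real.exp t - 1)| ≤ C * Real.exp (-t) := by
  obtain ⟨C, hC0, hC⟩ := h.exists_dual_bound
  have hρ := h.res_nonneg
  have hc := h.const_nonneg
  have hS1 := h.S_nonneg one_pos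
  set ρ := res D c₀
  refine ⟨(C + c₀ + ρ) * Real.exp 1 + (Real.exp 1 * S 1 + 2 * ρ), by positivity, fun t ht ↦ ?_⟩
  have het := Real.exp_pos (-t)
  have hsD := Real.sqrt_nonneg D
  have hexp : t ≤ Real.exp t - 1 := by linarith [Real.add_one_le_exp t]
  rcases le_total t 1 with h1 | h1
  · have h2 : |S t - ρ / (Real.exp t - 1)| ≤ C + c₀ + ρ := by
      rw [h.S_eq ht]
      have hdual0 : 0 ≤ 2 * Real.pi / (Real.sqrt D * t) * S (4 * Real.pi ^ 2 / D / t) := by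
        have := h.S_nonneg (show 0 < 4 * Real.pi ^ 2 / D / t by
          have := h.D_pos; have := Real.pi_pos; positivity)
        have := Real.pi_pos
        positivity
      have hdual := hC t ht
      have e1 : ρ / (Real.exp t - 1) ≤ ρ / t := by gcongr
      -- After clearing denominators this is (1 - t) e^t ≤ 1, that is 1 - t ≤ e^(-t).
      have e2 : ρ / t - ρ / (Real.exp t - 1) ≤ ρ := by
        have h3 : (1 - t) * Real.exp t ≤ 1 := by
          have := Real.add_one_le_exp (-t)
          calc (1 - t) * Real.exp t ≤ Real.exp (-t) * Real.exp t := by gcongr; linarith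
            _ = 1 := by rw [← Real.exp_add]; simp
        have h4 : 1 / t - 1 / (Real.exp t - 1) ≤ 1 := by
          have h5 : 0 < Real.exp t - 1 := by linarith
          rw [div_sub_div _ _ ht.ne' h5.ne', div_le_one (by positivity)]
          nlinarith
        calc ρ / t - ρ / (Real.exp t - 1) = ρ * (1 / t - 1 / (Real.exp t - 1)) := by ring
          _ ≤ ρ * 1 := by gcongr
          _ = ρ := mul_one _
      rw [abs_le]
      constructor <;> linarith
    have h3 : 1 ≤ Real.exp 1 * Real.exp (-t) := by
      rw [← Real.exp_add]; exact Real.one_le_exp (by linarith)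
    calc _ ≤ (C + c₀ + ρ) * 1 := by linarith
      _ ≤ (C + c₀ + ρ) * (Real.exp 1 * Real.exp (-t)) := by gcongr
      _ ≤ _ := by
        have : 0 ≤ (Real.exp 1 * S 1 + 2 * ρ) * Real.exp (-t) := by positivity
        linarith
  · have h2 := h.S_le one_pos h1
    have h3 := h.S_nonneg ht
    have h4 : ρ / (Real.exp t - 1) ≤ 2 * ρ * Real.exp (-t) := by
      have h5 : 2 ≤ Real.exp t := by linarith [Real.add_one_le_exp t]
      rw [Real.exp_neg, div_le_iff₀ (by linarith), mul_assoc, ← div_eq_inv_mul]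
      have : 1 / 2 ≤ (Real.exp t - 1) / Real.exp t := by
        rw [div_le_div_iff₀ two_pos (Real.exp_pos t)]; linarith
      nlinarith
    have h6 : 0 ≤ ρ / (Real.exp t - 1) := div_nonneg hρ (by linarith)
    have h7 : Real.exp (1 - t) * S 1 = Real.exp 1 * S 1 * Real.exp (-t) := by
      rw [sub_eq_add_neg, Real.exp_add]; ring
    have h8 : 0 ≤ (C + c₀ + ρ) * Real.exp 1 * Real.exp (-t) := by positivity
    have h9 : 0 ≤ Real.exp 1 * S 1 * Real.exp (-t) := by positivity
    rw [abs_le]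
    constructor <;> nlinarith

theorem aestronglyMeasurable_sub_res (h : IsModularTheta v D c₀ S) :
    AEStronglyMeasurable (fun t ↦ S t - res D c₀ / (Real.exp t - 1)) (volume.restrict (Ioi 0)) :=
  h.aestronglyMeasurable_S.sub (Measurable.aestronglyMeasurable (by fun_prop))

/-- The constant term of the Dirichlet series at `1`, after subtracting the pole. -/
noncomputable def constTerm (D c₀ : ℝ) (S : ℝ → ℝ) : ℝ :=
  ∫ t in Ioi (0 : ℝ), (S t - res D c₀ / (Real.exp t - 1))

/-- The constant term is reached by two limits: s → 1+ here, which ties it to Dirichlet series, and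
N → ∞ in `tendsto_integral_sub_res_exp`, which ties it to `realPsi`. Dominating t^(s-1) by 1 + t is
enough for s < 2. -/
theorem tendsto_integral_sub_res_rpow (h : IsModularTheta v D c₀ S) :
    Tendsto (fun s : ℝ ↦ ∫ t in Ioi (0 : ℝ), (S t - res D c₀ / (Real.exp t - 1)) * t ^ (s - 1))
      (𝓝[>] 1) (𝓝 (constTerm D c₀ S)) := by
  obtain ⟨C, hC0, hC⟩ := h.exists_bound_sub_res
  have hI : IntegrableOn (fun t : ℝ ↦ C * (Real.exp (-t) + t * Real.exp (-t))) (Ioi 0) := by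
    have h1 : IntegrableOn (fun t : ℝ ↦ Real.exp (-t)) (Ioi 0) := by
      simpa using exp_neg_integrableOn_Ioi 0 one_pos
    have h2 : IntegrableOn (fun t : ℝ ↦ t * Real.exp (-t)) (Ioi 0) := by
      have := Real.GammaIntegral_convergent two_pos
      refine this.congr_fun (fun t _ ↦ ?_) measurableSet_Ioi
      norm_num [mul_comm]
    exact (h1.add h2).const_mul C
  refine tendsto_integral_filter_of_dominated_convergence _ ?_ ?_ hI ?_
  · exact Eventually.of_forall fun s ↦ h.aestronglyMeasurable_sub_res.mul
      (Measurable.aestronglyMeasurable (by fun_prop))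
  · have hs2 : ∀ᶠ s : ℝ in 𝓝[>] 1, s < 2 := nhdsWithin_le_nhds (Iio_mem_nhds one_lt_two)
    filter_upwards [self_mem_nhdsWithin, hs2] with s hs hs2
    filter_upwards [ae_restrict_mem measurableSet_Ioi] with t ht
    have ht' : (0 : ℝ) < t := ht
    have hs' : (1 : ℝ) < s := hs
    have hpow : t ^ (s - 1) ≤ 1 + t := by
      rcases le_total t 1 with h1 | h1
      · have := Real.rpow_le_one ht'.le h1 (by linarith : 0 ≤ s - 1)
        linarith
      · have := Real.rpow_le_rpow_of_exponent_le h1 (by linarith : s - 1 ≤ 1)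
        rw [Real.rpow_one] at this
        linarith
    rw [norm_mul, Real.norm_eq_abs, Real.norm_of_nonneg (Real.rpow_nonneg ht'.le _)]
    calc _ ≤ C * Real.exp (-t) * (1 + t) :=
          mul_le_mul (hC t ht) hpow (Real.rpow_nonneg ht'.le _) (by positivity)
      _ = _ := by ring
  · filter_upwards [ae_restrict_mem measurableSet_Ioi] with t ht
    have ht' : (0 : ℝ) < t := ht
    have hcont : Continuous fun s : ℝ ↦ (S t - res D c₀ / (Real.exp t - 1)) * t ^ (s - 1) :=
      continuous_const.mul (Real.continuous_const_rpow ht'.ne' |>.comp (by fun_prop))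
    exact (hcont.tendsto' 1 _ (by simp)).mono_left nhdsWithin_le_nhds

theorem tendsto_integral_sub_res_exp (h : IsModularTheta v D c₀ S) :
    Tendsto (fun N : ℕ ↦ ∫ t in Ioi (0 : ℝ),
      (S t - res D c₀ / (Real.exp t - 1)) * (1 - Real.exp (-N * t)))
      atTop (𝓝 (constTerm D c₀ S)) := by
  obtain ⟨C, hC0, hC⟩ := h.exists_bound_sub_res
  have hI : IntegrableOn (fun t : ℝ ↦ C * Real.exp (-t)) (Ioi 0) := by
    have h1 : IntegrableOn (fun t : ℝ ↦ Real.exp (-t)) (Ioi 0) := by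
      simpa using exp_neg_integrableOn_Ioi 0 one_pos
    exact h1.const_mul C
  refine tendsto_integral_of_dominated_convergence _ ?_ hI ?_ ?_
  · exact fun N ↦ h.aestronglyMeasurable_sub_res.mul
      (Measurable.aestronglyMeasurable (by fun_prop))
  · intro N
    filter_upwards [ae_restrict_mem measurableSet_Ioi] with t ht
    have ht' : (0 : ℝ) < t := ht
    have h1 : Real.exp (-N * t) ≤ 1 := Real.exp_le_one_iff.mpr (by
      have : 0 ≤ (N : ℝ) * t := by positivity
      linarith)
    have h2 := Real.exp_pos (-N * t)
    rw [norm_mul, Real.norm_eq_abs, Real.norm_of_nonneg (by linarith)]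
    calc _ ≤ C * Real.exp (-t) * 1 :=
          mul_le_mul (hC t ht) (by linarith) (by linarith) (by positivity)
      _ = _ := by ring
  · filter_upwards [ae_restrict_mem measurableSet_Ioi] with t ht
    have ht' : (0 : ℝ) < t := ht
    have h1 : Tendsto (fun N : ℕ ↦ Real.exp (-N * t)) atTop (𝓝 0) := by
      refine Real.tendsto_exp_atBot.comp ?_
      simp_rw [neg_mul]
      exact tendsto_neg_atTop_atBot.comp (tendsto_natCast_atTop_atTop.atTop_mul_const ht')
    simpa using (h1.const_sub 1).const_mul (S t - res D c₀ / (Real.exp t - 1))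

end IsModularTheta

/-- This telescoping series is the counterpart of `realPsi` for coefficients equal to 1. It brings
in harmonic numbers, from which Euler's constant arises. -/
theorem hasSum_pnat_inv_sub_inv (N : ℕ) :
    HasSum (fun n : ℕ+ ↦ 1 / (n : ℝ) - 1 / (n + N)) (harmonic N : ℝ) := by
  induction N with
  | zero => simp
  | succ N ih =>
    have htel : HasSum (fun n : ℕ+ ↦ 1 / ((n : ℝ) + N) - 1 / (n + (N + 1)))
        (1 / ((N : ℝ) + 1)) := by
      have hnn : ∀ i : ℕ, 0 ≤ 1 / ((i : ℝ) + 1 + N) - 1 / ((i : ℝ) + 1 + (N + 1)) := fun i ↦ by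
        rw [sub_nonneg]
        exact one_div_le_one_div_of_le (by positivity) (by linarith)
      have hnat : HasSum (fun i : ℕ ↦ 1 / ((i : ℝ) + 1 + N) - 1 / ((i : ℝ) + 1 + (N + 1)))
          (1 / ((N : ℝ) + 1)) := by
        rw [hasSum_iff_tendsto_nat_of_nonneg hnn]
        have hsum (k : ℕ) : ∑ i ∈ Finset.range k,
            (1 / ((i : ℝ) + 1 + N) - 1 / ((i : ℝ) + 1 + (N + 1))) =
            1 / ((N : ℝ) + 1) - 1 / ((k : ℝ) + (N + 1)) := by
          have := Finset.sum_range_sub' (fun i : ℕ ↦ 1 / ((i : ℝ) + (N + 1))) k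
          simp only [Nat.cast_zero, zero_add] at this
          rw [← this]
          refine Finset.sum_congr rfl fun i _ ↦ ?_
          push_cast
          ring_nf
        simp_rw [hsum]
        have h0 : Tendsto (fun k : ℕ ↦ 1 / ((k : ℝ) + (N + 1))) atTop (𝓝 0) := by
          simp_rw [one_div]
          exact tendsto_inv_atTop_zero.comp
            (tendsto_atTop_add_const_right _ _ tendsto_natCast_atTop_atTop)
        simpa using h0.const_sub (1 / ((N : ℝ) + 1))
      rw [← Equiv.pnatEquivNat.symm.hasSum_iff]
      have hfun : ((fun n : ℕ+ ↦ 1 / ((n : ℝ) + N) - 1 / (n + (N + 1))) ∘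
          Equiv.pnatEquivNat.symm) =
          fun i : ℕ ↦ 1 / ((i : ℝ) + 1 + N) - 1 / ((i : ℝ) + 1 + (N + 1)) := by
        funext i
        simp
      rw [hfun]
      exact hnat
    have h := ih.add htel
    have hfun : (fun n : ℕ+ ↦ 1 / (n : ℝ) - 1 / (n + (N + 1 : ℕ))) =
        fun n : ℕ+ ↦ 1 / (n : ℝ) - 1 / (n + N) + (1 / ((n : ℝ) + N) - 1 / (n + (N + 1))) := by
      funext n
      push_cast
      ring
    rw [hfun, harmonic_succ]
    push_cast
    rw [← one_div]
    exact h

namespace IsModularTheta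

variable {v : ℕ+ → ℝ} {D c₀ : ℝ} {S : ℝ → ℝ}

theorem realKSum_nonneg (h : IsModularTheta v D c₀ S) (a : ℝ) : 0 ≤ realKSum v D a :=
  tsum_nonneg fun n ↦ mul_nonneg (h.nonneg n) (realK_nonneg _)

theorem tendsto_realKSum (h : IsModularTheta v D c₀ S) :
    Tendsto (fun N : ℕ ↦ realKSum v D N) atTop (𝓝 0) := by
  set M := ∑' n : ℕ+, v n / (n : ℝ) ^ (2 : ℝ)
  have hup : Tendsto (fun N : ℕ ↦ 96 / (4 * Real.pi / Real.sqrt D) ^ 4 / (N : ℝ) ^ 2 * M) atTop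
      (𝓝 0) := by
    have h1 : Tendsto (fun N : ℕ ↦ ((N : ℝ) ^ 2)⁻¹) atTop (𝓝 0) :=
      tendsto_inv_atTop_zero.comp ((tendsto_pow_atTop two_ne_zero).comp tendsto_natCast_atTop_atTop)
    have h2 := (h1.const_mul (96 / (4 * Real.pi / Real.sqrt D) ^ 4)).mul_const M
    simpa [div_eq_mul_inv] using h2
  refine tendsto_of_tendsto_of_tendsto_of_le_of_le' tendsto_const_nhds hup
    (Eventually.of_forall fun N ↦ h.realKSum_nonneg N) ?_
  filter_upwards [eventually_gt_atTop 0] with N hN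
  have hN' : (0 : ℝ) < N := by exact_mod_cast hN
  rw [← tsum_mul_left]
  exact (h.summable_realK hN').tsum_le_tsum (h.realK_term_le hN')
    ((h.summable 2 one_lt_two).mul_left _)

theorem tsum_sub_res_inv (h : IsModularTheta v D c₀ S) {N : ℕ} (hN : 0 < N) :
    realPsi v N - res D c₀ * harmonic N = ∫ t in Ioi (0 : ℝ),
      (S t - res D c₀ / (Real.exp t - 1)) * (1 - Real.exp (-N * t)) := by
  have hN' : (0 : ℝ) < N := by exact_mod_cast hN
  have hn (n : ℕ+) : (0 : ℝ) < n := by exact_mod_cast n.pos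
  have hρ := h.res_nonneg
  have hs1 := h.summable_inv_sub_inv hN'.le
  have hs2 := (hasSum_pnat_inv_sub_inv N).mul_left (res D c₀)
  have hnn (n : ℕ+) : 0 ≤ 1 / (n : ℝ) - 1 / (n + N) := by
    rw [sub_nonneg]
    exact one_div_le_one_div_of_le (hn n) (by linarith)
  let F : ℕ+ → ℝ → ℝ := fun n t ↦ (v n - res D c₀) *
    (Real.exp (-(n : ℝ) * t) - Real.exp (-(n + N) * t))
  have hi (n : ℕ+) : IntegrableOn (fun t ↦ Real.exp (-(n : ℝ) * t)) (Ioi 0) :=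
    exp_neg_integrableOn_Ioi 0 (hn n)
  have hi' (n : ℕ+) : IntegrableOn (fun t ↦ Real.exp (-((n : ℝ) + N) * t)) (Ioi 0) :=
    exp_neg_integrableOn_Ioi 0 (by have := hn n; positivity)
  have h_integral (n : ℕ+) : ∫ t in Ioi (0 : ℝ), (Real.exp (-(n : ℝ) * t) - Real.exp (-(n + N) * t)) =
      1 / (n : ℝ) - 1 / (n + N) := by
    have := hn n
    rw [integral_sub (hi n) (hi' n), integral_exp_neg_mul_Ioi (hn n),
      integral_exp_neg_mul_Ioi (by positivity)]
  have hF (n : ℕ+) : Integrable (F n) (volume.restrict (Ioi 0)) :=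
    ((hi n).sub (hi' n)).const_mul _
  have hFint (n : ℕ+) : ∫ t in Ioi (0 : ℝ), F n t =
      (v n - res D c₀) * (1 / (n : ℝ) - 1 / (n + N)) := by
    rw [integral_const_mul, h_integral]
  have hFnorm (n : ℕ+) : ∫ t in Ioi (0 : ℝ), ‖F n t‖ =
      |v n - res D c₀| * (1 / (n : ℝ) - 1 / (n + N)) := by
    rw [← h_integral, ← integral_const_mul]
    refine setIntegral_congr_fun measurableSet_Ioi fun t ht ↦ ?_
    have ht' : (0 : ℝ) < t := ht
    have : Real.exp (-((n : ℝ) + N) * t) ≤ Real.exp (-(n : ℝ) * t) := by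
      rw [Real.exp_le_exp]
      nlinarith
    change ‖(v n - res D c₀) * _‖ = _
    rw [norm_mul, Real.norm_of_nonneg (sub_nonneg.mpr this), Real.norm_eq_abs]
  have hsum := hasSum_integral_of_summable_integral_norm hF (by
    simp_rw [hFnorm]
    refine Summable.of_nonneg_of_le (fun n ↦ mul_nonneg (abs_nonneg _) (hnn n)) (fun n ↦ ?_)
      (hs1.add hs2.summable)
    rw [← add_mul]
    refine mul_le_mul_of_nonneg_right ?_ (hnn n)
    have := h.nonneg n
    rw [abs_le]
    constructor <;> linarith)
  simp_rw [hFint] at hsum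
  have hsum' := hs1.hasSum.sub hs2
  have hfun : (fun n : ℕ+ ↦ v n * (1 / (n : ℝ) - 1 / (n + N)) -
      res D c₀ * (1 / (n : ℝ) - 1 / (n + N))) =
      fun n : ℕ+ ↦ (v n - res D c₀) * (1 / (n : ℝ) - 1 / (n + N)) := by
    funext n; ring
  rw [hfun] at hsum'
  rw [realPsi, hsum'.unique hsum]
  refine setIntegral_congr_fun measurableSet_Ioi fun t ht ↦ ?_
  have hS := (h.hasSum_sub_res ht).mul_right (1 - Real.exp (-N * t))
  have : (fun n : ℕ+ ↦ (v n - res D c₀) * Real.exp (-t * n) * (1 - Real.exp (-N * t))) =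
      fun n ↦ F n t := by
    funext n
    simp only [F]
    rw [show -((n : ℝ) + N) * t = -t * n + -N * t by ring, Real.exp_add,
      show -(n : ℝ) * t = -t * n by ring]
    ring
  rw [this] at hS
  exact hS.tsum_eq

/-- The increment formula is used between a and an integer N → ∞. There `realPsi v N - res *
harmonic N` tends to the constant term, the harmonic numbers minus log N tend to γ, and c₀/N and the
K-series at N vanish. -/
theorem realPsi_eq (h : IsModularTheta v D c₀ S) {a : ℝ} (ha : 0 < a) :
    realPsi v a = c₀ / a + res D c₀ * Real.log a +
      (constTerm D c₀ S + res D c₀ * Real.eulerMascheroniConstant) -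
      4 * Real.pi / Real.sqrt D * realKSum v D a := by
  have h1 : Tendsto (fun N : ℕ ↦ realPsi v N - res D c₀ * harmonic N) atTop
      (𝓝 (constTerm D c₀ S)) := by
    refine h.tendsto_integral_sub_res_exp.congr' ?_
    filter_upwards [eventually_gt_atTop 0] with N hN
    exact (h.tsum_sub_res_inv hN).symm
  have h2 := Real.tendsto_eulerMascheroniSeq'
  have h3 : Tendsto (fun N : ℕ ↦ c₀ / (N : ℝ)) atTop (𝓝 0) :=
    tendsto_const_div_atTop_nhds_zero_nat c₀
  have h4 := h.tendsto_realKSum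
  have h5 := ((h1.add (h2.const_mul (res D c₀))).sub h3).add
    (h4.const_mul (4 * Real.pi / Real.sqrt D))
  have h6 : Tendsto (fun _ : ℕ ↦ realPsi v a - c₀ / a - res D c₀ * Real.log a +
      4 * Real.pi / Real.sqrt D * realKSum v D a) atTop
      (𝓝 (constTerm D c₀ S + res D c₀ * Real.eulerMascheroniConstant - 0 +
        4 * Real.pi / Real.sqrt D * 0)) := by
    refine h5.congr' ?_
    filter_upwards [eventually_gt_atTop 0, eventually_ge_atTop ⌈a⌉₊] with N hN hNa
    have hN' : (0 : ℝ) < N := by exact_mod_cast hN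
    have hd := h.realPsi_sub_realPsi ha (Nat.ceil_le.mp hNa)
    rw [Real.log_div hN'.ne' ha.ne'] at hd
    rw [Real.eulerMascheroniSeq', if_neg hN.ne']
    linarith
  have h7 := tendsto_nhds_unique h6 tendsto_const_nhds
  rw [sub_zero, mul_zero, add_zero] at h7
  linarith

theorem Gamma_mul_tsum_sub_res (h : IsModularTheta v D c₀ S) {s : ℝ} (hs : 1 < s) :
    Real.Gamma s * ∑' n : ℕ+, (v n - res D c₀) / (n : ℝ) ^ s =
      ∫ t in Ioi (0 : ℝ), (S t - res D c₀ / (Real.exp t - 1)) * t ^ (s - 1) := by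
  have hn (n : ℕ+) : (0 : ℝ) < n := by exact_mod_cast n.pos
  have hρ := h.res_nonneg
  have hs0 : 0 < s := by linarith
  let F : ℕ+ → ℝ → ℝ := fun n t ↦ (v n - res D c₀) * (t ^ (s - 1) * Real.exp (-((n : ℝ) * t)))
  have h_integral (n : ℕ+) : ∫ t in Ioi (0 : ℝ), t ^ (s - 1) * Real.exp (-((n : ℝ) * t)) =
      Real.Gamma s * (1 / (n : ℝ) ^ s) := by
    rw [Real.integral_rpow_mul_exp_neg_mul_Ioi hs0 (hn n), Real.div_rpow zero_le_one (hn n).le,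
      Real.one_rpow, mul_comm]
  have hi (n : ℕ+) : IntegrableOn (fun t ↦ t ^ (s - 1) * Real.exp (-((n : ℝ) * t))) (Ioi 0) := by
    -- A non-integrable function has integral 0 by convention, so the positive value of the integral
    -- proves integrability.
    refine Integrable.of_integral_ne_zero ?_
    rw [h_integral]
    have := hn n
    have := Real.Gamma_pos_of_pos hs0
    positivity
  have hF (n : ℕ+) : Integrable (F n) (volume.restrict (Ioi 0)) := (hi n).const_mul _
  have hFint (n : ℕ+) : ∫ t in Ioi (0 : ℝ), F n t =
      Real.Gamma s * ((v n - res D c₀) / (n : ℝ) ^ s) := by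
    rw [integral_const_mul, h_integral]
    ring
  have hFnorm (n : ℕ+) : ∫ t in Ioi (0 : ℝ), ‖F n t‖ =
      Real.Gamma s * (|v n - res D c₀| / (n : ℝ) ^ s) := by
    have : Real.Gamma s * (|v n - res D c₀| / (n : ℝ) ^ s) =
      |v n - res D c₀| * (Real.Gamma s * (1 / (n : ℝ) ^ s)) := by ring
    rw [this, ← h_integral, ← integral_const_mul]
    refine setIntegral_congr_fun measurableSet_Ioi fun t ht ↦ ?_
    have ht' : (0 : ℝ) < t := ht
    change ‖(v n - res D c₀) * _‖ = _
    rw [norm_mul, Real.norm_eq_abs, Real.norm_of_nonneg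
      (show 0 ≤ t ^ (s - 1) * Real.exp (-((n : ℝ) * t)) by positivity)]
  have hone : Summable fun n : ℕ+ ↦ 1 / (n : ℝ) ^ s :=
    (Real.summable_one_div_nat_rpow.mpr hs).comp_injective PNat.coe_injective
  have hsum := hasSum_integral_of_summable_integral_norm hF (by
    simp_rw [hFnorm]
    refine Summable.mul_left _ (Summable.of_nonneg_of_le (fun n ↦ ?_) (fun n ↦ ?_)
      ((h.summable s hs).add (hone.mul_left (res D c₀))))
    · have := hn n
      positivity
    · have := hn n
      rw [mul_one_div, ← add_div]
      gcongr
      have := h.nonneg n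
      rw [abs_le]
      constructor <;> linarith)
  simp_rw [hFint] at hsum
  rw [← tsum_mul_left, hsum.tsum_eq]
  refine setIntegral_congr_fun measurableSet_Ioi fun t ht ↦ ?_
  have hS := (h.hasSum_sub_res ht).mul_right (t ^ (s - 1))
  have : (fun n : ℕ+ ↦ (v n - res D c₀) * Real.exp (-t * n) * t ^ (s - 1)) = fun n ↦ F n t := by
    funext n
    simp only [F]
    rw [show -((n : ℝ) * t) = -t * n by ring]
    ring
  rw [this] at hS
  exact hS.tsum_eq

/-- Dividing the Mellin transform by Γ(s), which tends to 1, identifies the constant term with the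
limit of the Dirichlet series after removal of its pole. -/
theorem tendsto_tsum_sub_res (h : IsModularTheta v D c₀ S) :
    Tendsto (fun s : ℝ ↦ ∑' n : ℕ+, (v n - res D c₀) / (n : ℝ) ^ s) (𝓝[>] 1)
      (𝓝 (constTerm D c₀ S)) := by
  have hΓ : Tendsto Real.Gamma (𝓝[>] 1) (𝓝 1) := by
    have : ContinuousAt Real.Gamma 1 := (Real.differentiableAt_Gamma fun m ↦ by
      have : (0 : ℝ) ≤ m := by positivity
      linarith).continuousAt
    have h1 := this.tendsto
    rw [Real.Gamma_one] at h1
    exact h1.mono_left nhdsWithin_le_nhds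
  have h1 := h.tendsto_integral_sub_res_rpow.div hΓ one_ne_zero
  rw [div_one] at h1
  refine h1.congr' ?_
  filter_upwards [self_mem_nhdsWithin] with s hs
  have hs' : (1 : ℝ) < s := hs
  have := (Real.Gamma_pos_of_pos (by linarith : 0 < s)).ne'
  rw [Pi.div_apply, ← h.Gamma_mul_tsum_sub_res hs, mul_div_cancel_left₀ _ this]

end IsModularTheta

/-! ### Analytic continuation to the slit plane -/

theorem ofReal_mul_cpow_half {r : ℝ} (hr : 0 ≤ r) {z : ℂ} (hz : z ≠ 0) :
    ((r : ℂ) * z) ^ (1 / 2 : ℂ) = (Real.sqrt r : ℂ) * z ^ (1 / 2 : ℂ) := by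
  rcases hr.eq_or_lt with rfl | hr
  · simp
  have hr' : (r : ℂ) ≠ 0 := by exact_mod_cast hr.ne'
  rw [Complex.cpow_def_of_ne_zero (mul_ne_zero hr' hz), Complex.log_ofReal_mul hr hz, add_mul,
    Complex.exp_add, ← Complex.cpow_def_of_ne_zero hz, Complex.ofReal_log hr.le,
    ← Complex.cpow_def_of_ne_zero hr', Real.sqrt_eq_rpow, Complex.ofReal_cpow hr.le]
  norm_num

/-- Halving the argument maps the slit plane into the right half-plane, where the integral for K₀
converges. -/
theorem re_cpow_half_pos {z : ℂ} (hz : z ∈ Complex.slitPlane) : 0 < (z ^ (1 / 2 : ℂ)).re := by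
  have h0 := Complex.slitPlane_ne_zero hz
  rw [Complex.cpow_def_of_ne_zero h0, Complex.exp_re]
  refine mul_pos (Real.exp_pos _) (Real.cos_pos_of_mem_Ioo ?_)
  have him : (Complex.log z * (1 / 2)).im = z.arg / 2 := by
    have : Complex.log z * (1 / 2) = ((1 / 2 : ℝ) : ℂ) * Complex.log z := by push_cast; ring
    rw [this, Complex.im_ofReal_mul, Complex.log_im]
    ring
  rw [him]
  have h1 := Complex.neg_pi_lt_arg z
  have h2 := lt_of_le_of_ne (Complex.arg_le_pi z) (Complex.mem_slitPlane_iff_arg.mp hz).1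
  constructor <;> linarith

/-- A lower bound for the distance of `z` from the negative integers. -/
theorem le_norm_natCast_add {δ : ℝ} (hδ1 : δ ≤ 1) {z : ℂ} (hz0 : z ≠ 0)
    (hz : 0 < z.re ∨ δ * ‖z‖ ≤ |z.im|) (n : ℕ) : δ * n ≤ ‖(n : ℂ) + z‖ := by
  have hn : (0 : ℝ) ≤ n := by positivity
  rcases hz with hz | hz
  · have h1 : (n : ℝ) + z.re ≤ ‖(n : ℂ) + z‖ := by
      have := Complex.re_le_norm ((n : ℂ) + z)
      simpa using this
    nlinarith
  · have hzpos : 0 < ‖z‖ := norm_pos_iff.mpr hz0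
    -- Multiplying by the conjugate of z makes z² into ‖z‖², so only n Im z survives in the
    -- imaginary part.
    have h1 : |((starRingEnd ℂ) z * ((n : ℂ) + z)).im| ≤ ‖z‖ * ‖(n : ℂ) + z‖ := by
      refine (Complex.abs_im_le_norm _).trans ?_
      rw [norm_mul, Complex.norm_conj]
    have h2 : ((starRingEnd ℂ) z * ((n : ℂ) + z)).im = -(n * z.im) := by
      simp
      ring
    rw [h2, abs_neg, abs_mul, abs_of_nonneg hn] at h1
    have h3 : n * (δ * ‖z‖) ≤ n * |z.im| := by gcongr
    have h4 : ‖z‖ * (δ * n) ≤ ‖z‖ * ‖(n : ℂ) + z‖ := by nlinarith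
    exact le_of_mul_le_mul_left h4 hzpos

namespace IsModularTheta

variable {v : ℕ+ → ℝ} {D c₀ : ℝ} {S : ℝ → ℝ}

/-- The analogue of the digamma function (shifted so as to vanish at `0`). -/
noncomputable def psi (v : ℕ+ → ℝ) (z : ℂ) : ℂ :=
  ∑' n : ℕ+, (v n : ℂ) * (1 / (n : ℂ) - 1 / (n + z))

/-- The series of `K`-Bessel functions dual to `psi`. -/
noncomputable def kSum (v : ℕ+ → ℝ) (D : ℝ) (z : ℂ) : ℂ :=
  ∑' n : ℕ+, (v n : ℂ) *
    besselK 0 (((4 * Real.pi / Real.sqrt D * Real.sqrt n : ℝ) : ℂ) * z ^ (1 / 2 : ℂ))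

theorem norm_psi_term_le (h : IsModularTheta v D c₀ S) {δ R : ℝ} (hδ : 0 < δ) (hδ1 : δ ≤ 1)
    {z : ℂ} (hz0 : z ≠ 0)
    (hz : 0 < z.re ∨ δ * ‖z‖ ≤ |z.im|) (hR : ‖z‖ ≤ R) (n : ℕ+) :
    ‖(v n : ℂ) * (1 / (n : ℂ) - 1 / (n + z))‖ ≤ R / δ * (v n / (n : ℝ) ^ 2) := by
  have hn : (0 : ℝ) < n := by exact_mod_cast n.pos
  have hlow := le_norm_natCast_add hδ1 hz0 hz n
  have hpos : 0 < ‖((n : ℕ) : ℂ) + z‖ := lt_of_lt_of_le (by positivity) hlow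
  have hne : ((n : ℕ) : ℂ) + z ≠ 0 := norm_pos_iff.mp hpos
  have hnC : ((n : ℕ) : ℂ) ≠ 0 := by exact_mod_cast n.ne_zero
  have heq : (1 / ((n : ℕ) : ℂ) - 1 / (n + z)) = z / (n * (n + z)) := by
    field_simp
    ring
  have hv := h.nonneg n
  have hR0 : 0 ≤ R := (norm_nonneg z).trans hR
  rw [norm_mul, Complex.norm_real, Real.norm_of_nonneg hv, heq, norm_div, norm_mul,
    Complex.norm_natCast]
  calc v n * (‖z‖ / (n * ‖((n : ℕ) : ℂ) + z‖)) ≤ v n * (R / (n * (δ * n))) := by gcongr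
    _ = _ := by field_simp

/-- The strict cone condition is open, so the same δ serves in a neighbourhood and makes the bound
on the terms of `psi` locally uniform. -/
theorem exists_cone {z : ℂ} (hz : z ∈ Complex.slitPlane) : ∃ δ : ℝ, 0 < δ ∧ δ ≤ 1 ∧
    (0 < z.re ∨ δ * ‖z‖ < |z.im|) := by
  rcases hz with hz | hz
  · exact ⟨1, one_pos, le_rfl, Or.inl hz⟩
  · have him : 0 < |z.im| := abs_pos.mpr hz
    have hle := Complex.abs_im_le_norm z
    have hpos : 0 < ‖z‖ := him.trans_le hle
    refine ⟨|z.im| / ‖z‖ / 2, by positivity, ?_, Or.inr ?_⟩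
    · have := (div_le_one hpos).mpr hle
      linarith
    · have : |z.im| / ‖z‖ / 2 * ‖z‖ = |z.im| / 2 := by field_simp
      rw [this]
      linarith

theorem summable_psi (h : IsModularTheta v D c₀ S) {z : ℂ} (hz : z ∈ Complex.slitPlane) :
    Summable fun n : ℕ+ ↦ (v n : ℂ) * (1 / (n : ℂ) - 1 / (n + z)) := by
  obtain ⟨δ, hδ, hδ1, hzδ⟩ := exists_cone hz
  exact Summable.of_norm_bounded (h.summable_div_sq.mul_left (‖z‖ / δ))
    (h.norm_psi_term_le hδ hδ1 (Complex.slitPlane_ne_zero hz) (hzδ.imp_right le_of_lt) le_rfl)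

theorem differentiableOn_psi (h : IsModularTheta v D c₀ S) :
    DifferentiableOn ℂ (psi v) Complex.slitPlane := by
  intro z hz
  obtain ⟨δ, hδ, hδ1, hzδ⟩ := exists_cone hz
  let U : Set ℂ := {w | w ∈ Complex.slitPlane ∧ ‖w‖ < ‖z‖ + 1 ∧
    (0 < w.re ∨ δ * ‖w‖ < |w.im|)}
  have hU : IsOpen U := by
    have h1 : IsOpen {w : ℂ | δ * ‖w‖ < |w.im|} :=
      isOpen_lt (continuous_const.mul continuous_norm) Complex.continuous_im.abs
    have h2 : IsOpen {w : ℂ | 0 < w.re} := isOpen_lt continuous_const Complex.continuous_re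
    have h3 : IsOpen {w : ℂ | ‖w‖ < ‖z‖ + 1} := isOpen_lt continuous_norm continuous_const
    exact Complex.isOpen_slitPlane.inter (h3.inter (h2.union h1))
  have hzU : z ∈ U := ⟨hz, by linarith, hzδ⟩
  have hd : DifferentiableOn ℂ (psi v) U := by
    refine Complex.differentiableOn_tsum_of_summable_norm
      (h.summable_div_sq.mul_left ((‖z‖ + 1) / δ)) (fun n ↦ ?_) hU (fun n w hw ↦ ?_)
    · intro w hw
      have hn : (0 : ℝ) < n := by exact_mod_cast n.pos
      have hlow := le_norm_natCast_add hδ1 (Complex.slitPlane_ne_zero hw.1)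
        (hw.2.2.imp_right le_of_lt) n
      have hne : ((n : ℕ) : ℂ) + w ≠ 0 := norm_pos_iff.mp (lt_of_lt_of_le (by positivity) hlow)
      refine DifferentiableAt.differentiableWithinAt ?_
      exact ((differentiableAt_const _).sub ((differentiableAt_const _).div
        ((differentiableAt_const _).add differentiableAt_id) hne)).const_mul _
    · exact h.norm_psi_term_le hδ hδ1 (Complex.slitPlane_ne_zero hw.1)
        (hw.2.2.imp_right le_of_lt) hw.2.1.le n
  exact ((hd z hzU).differentiableAt (hU.mem_nhds hzU)).differentiableWithinAt

theorem norm_kSum_term_le (h : IsModularTheta v D c₀ S) {ε : ℝ} (hε : 0 < ε) {w : ℂ} (hw : ε ≤ w.re)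
    (n : ℕ+) :
    ‖(v n : ℂ) * besselK 0 (((4 * Real.pi / Real.sqrt D * Real.sqrt n : ℝ) : ℂ) * w)‖ ≤
      96 / (4 * Real.pi / Real.sqrt D * ε) ^ 4 * (v n / (n : ℝ) ^ 2) := by
  have hsD := Real.sqrt_pos.mpr h.D_pos
  have hpi := Real.pi_pos
  have hn : (0 : ℝ) < n := by exact_mod_cast n.pos
  have hsn : 0 < Real.sqrt n := Real.sqrt_pos.mpr hn
  have hv := h.nonneg n
  have hre : (((4 * Real.pi / Real.sqrt D * Real.sqrt n : ℝ) : ℂ) * w).re =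
      4 * Real.pi / Real.sqrt D * Real.sqrt n * w.re := Complex.re_ofReal_mul _ _
  have hwpos : 0 < w.re := hε.trans_le hw
  have hb := norm_besselK_zero_le
    (z := ((4 * Real.pi / Real.sqrt D * Real.sqrt n : ℝ) : ℂ) * w) (by rw [hre]; positivity)
  rw [hre] at hb
  have h4 : Real.sqrt n ^ 4 = (n : ℝ) ^ 2 := by
    rw [show 4 = 2 * 2 by norm_num, pow_mul, Real.sq_sqrt hn.le]
  rw [norm_mul, Complex.norm_real, Real.norm_of_nonneg hv]
  calc _ ≤ v n * (96 / (4 * Real.pi / Real.sqrt D * Real.sqrt n * w.re) ^ 4) := by gcongr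
    _ ≤ v n * (96 / (4 * Real.pi / Real.sqrt D * Real.sqrt n * ε) ^ 4) := by gcongr
    _ = _ := by
      rw [mul_pow, mul_pow _ (Real.sqrt n), h4, mul_pow _ ε]
      field_simp

theorem summable_kSum (h : IsModularTheta v D c₀ S) {z : ℂ} (hz : z ∈ Complex.slitPlane) :
    Summable fun n : ℕ+ ↦ (v n : ℂ) *
      besselK 0 (((4 * Real.pi / Real.sqrt D * Real.sqrt n : ℝ) : ℂ) * z ^ (1 / 2 : ℂ)) :=
  Summable.of_norm_bounded (h.summable_div_sq.mul_left _)
    (h.norm_kSum_term_le (re_cpow_half_pos hz) le_rfl)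

theorem differentiableOn_kSum (h : IsModularTheta v D c₀ S) :
    DifferentiableOn ℂ (kSum v D) Complex.slitPlane := by
  intro z hz
  have hsD := Real.sqrt_pos.mpr h.D_pos
  have hpi := Real.pi_pos
  have hre := re_cpow_half_pos hz
  set ε := (z ^ (1 / 2 : ℂ)).re / 2 with hε
  have hε0 : 0 < ε := by positivity
  have hdp : DifferentiableOn ℂ (fun w : ℂ ↦ w ^ (1 / 2 : ℂ)) Complex.slitPlane := fun w hw ↦
    (differentiableAt_id.cpow_const hw).differentiableWithinAt
  let U : Set ℂ := Complex.slitPlane ∩ (fun w : ℂ ↦ w ^ (1 / 2 : ℂ)) ⁻¹' {w | ε < w.re}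
  have hU : IsOpen U := hdp.continuousOn.isOpen_inter_preimage Complex.isOpen_slitPlane
    (isOpen_lt continuous_const Complex.continuous_re)
  have hzU : z ∈ U := ⟨hz, by change ε < (z ^ (1 / 2 : ℂ)).re; linarith⟩
  have hd : DifferentiableOn ℂ (kSum v D) U := by
    refine Complex.differentiableOn_tsum_of_summable_norm
      (h.summable_div_sq.mul_left (96 / (4 * Real.pi / Real.sqrt D * ε) ^ 4)) (fun n ↦ ?_) hU
      (fun n w hw ↦ h.norm_kSum_term_le hε0 (le_of_lt hw.2) n)
    intro w hw
    have hn : (0 : ℝ) < n := by exact_mod_cast n.pos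
    have hsn : 0 < Real.sqrt n := Real.sqrt_pos.mpr hn
    have hwre : ε < (w ^ (1 / 2 : ℂ)).re := hw.2
    have hpos : 0 < (((4 * Real.pi / Real.sqrt D * Real.sqrt n : ℝ) : ℂ) * w ^ (1 / 2 : ℂ)).re := by
      rw [Complex.re_ofReal_mul]
      have : 0 < (w ^ (1 / 2 : ℂ)).re := hε0.trans hwre
      positivity
    refine DifferentiableAt.differentiableWithinAt (DifferentiableAt.const_mul ?_ _)
    exact DifferentiableAt.comp (g := besselK 0)
      (f := fun w ↦ ((4 * Real.pi / Real.sqrt D * Real.sqrt n : ℝ) : ℂ) * w ^ (1 / 2 : ℂ)) w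
      (differentiableAt_besselK_zero hpos) ((differentiableAt_id.cpow_const hw.1).const_mul _)
  exact ((hd z hzU).differentiableAt (hU.mem_nhds hzU)).differentiableWithinAt

theorem psi_ofReal (a : ℝ) : psi v a = realPsi v a := by
  rw [psi, realPsi, Complex.ofReal_tsum]
  refine tsum_congr fun n ↦ ?_
  push_cast
  rfl

theorem kSum_ofReal {a : ℝ} (ha : 0 < a) : kSum v D a = realKSum v D a := by
  rw [kSum, realKSum, Complex.ofReal_tsum]
  refine tsum_congr fun n ↦ ?_
  have hn : (0 : ℝ) < n := by exact_mod_cast n.pos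
  have : (a : ℂ) ^ (1 / 2 : ℂ) = (Real.sqrt a : ℂ) := by
    rw [Real.sqrt_eq_rpow, Complex.ofReal_cpow ha.le]
    norm_num
  rw [this, ← Complex.ofReal_mul, besselK_zero_ofReal, Real.sqrt_mul hn.le]
  push_cast
  ring_nf

/-- The expansion of the analogue of the digamma function in `K`-Bessel functions. -/
theorem psi_eq (h : IsModularTheta v D c₀ S) {z : ℂ} (hz : z ∈ Complex.slitPlane) :
    psi v z = c₀ / z + res D c₀ * Complex.log z +
      (constTerm D c₀ S + res D c₀ * Real.eulerMascheroniConstant) -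
      4 * Real.pi / Real.sqrt D * kSum v D z := by
  set f : ℂ → ℂ := fun z ↦ c₀ / z + res D c₀ * Complex.log z +
      (constTerm D c₀ S + res D c₀ * Real.eulerMascheroniConstant) -
      4 * Real.pi / Real.sqrt D * kSum v D z with hf
  have hfd : DifferentiableOn ℂ f Complex.slitPlane := by
    refine DifferentiableOn.sub (DifferentiableOn.add (DifferentiableOn.add ?_ ?_) ?_) ?_
    · exact (differentiableOn_const _).div differentiableOn_id fun w hw ↦
        Complex.slitPlane_ne_zero hw
    · exact (fun w hw ↦ ((Complex.differentiableAt_log hw).const_mul _).differentiableWithinAt)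
    · exact differentiableOn_const _
    · exact h.differentiableOn_kSum.const_mul _
  have ha1 := hfd.analyticOnNhd Complex.isOpen_slitPlane
  have ha2 := h.differentiableOn_psi.analyticOnNhd Complex.isOpen_slitPlane
  have hone : (1 : ℂ) ∈ Complex.slitPlane := Complex.one_mem_slitPlane
  -- Agreement at real points accumulating at 1 from the right is enough for the identity theorem on
  -- the connected slit plane.
  have hfreq : ∃ᶠ w in 𝓝[≠] (1 : ℂ), psi v w = f w := by
    refine tendsto_ofReal_nhdsGT_one.frequently (Eventually.frequently ?_)
    filter_upwards [self_mem_nhdsWithin] with a ha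
    have ha0 : (0 : ℝ) < a := one_pos.trans ha
    rw [psi_ofReal, h.realPsi_eq ha0, hf]
    simp only [kSum_ofReal ha0, ← Complex.ofReal_log ha0.le]
    push_cast
    ring
  have hconn : IsPreconnected Complex.slitPlane :=
    (Complex.starConvex_one_slitPlane.isPathConnected hone).isConnected.isPreconnected
  exact ha2.eqOn_of_preconnected_of_frequently_eq ha1 hconn hone hfreq hz

end IsModularTheta

/-! ### Lambert series and their transformation formula -/

/-- The partial fraction expansion of the Bose-Einstein kernel. -/
theorem hasSum_partialFraction_exp {x : ℂ} (hx : 0 < x.re) :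
    HasSum (fun k : ℕ+ ↦ 2 * x / (x ^ 2 + (2 * Real.pi * k) ^ 2))
      (1 / (Complex.exp x - 1) + 1 / 2 - 1 / x) := by
  have hpi : (Real.pi : ℂ) ≠ 0 := by exact_mod_cast Real.pi_ne_zero
  have hx0 : x ≠ 0 := by rintro rfl; simp at hx
  -- With this z one has e^(2πiz) = e^(-x), so the cotangent series at z becomes the required
  -- expansion.
  set z : ℂ := Complex.I * x / (2 * Real.pi) with hz
  have him : z.im = x.re / (2 * Real.pi) := by
    have : z = ((1 / (2 * Real.pi) : ℝ) : ℂ) * (Complex.I * x) := by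
      rw [hz]; push_cast; ring
    rw [this, Complex.im_ofReal_mul]
    simp
    ring
  have himpos : 0 < z.im := by rw [him]; positivity
  have hzi : z ∈ Complex.integerComplement := by
    rintro ⟨n, hn⟩
    rw [← hn] at himpos
    simp at himpos
  have hne : ∀ r : ℝ, z + r ≠ 0 := fun r h0 ↦ by
    have := congrArg Complex.im h0
    simp at this
    linarith
  have hs : HasSum (fun k : ℕ+ ↦ 1 / (z - k) + 1 / (z + k))
      (Real.pi * Complex.cot (Real.pi * z) - 1 / z) := by
    rw [cot_series_rep hzi, add_sub_cancel_left]
    refine Summable.hasSum ?_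
    have h1 := summable_cotTerm hzi
    have h2 := Equiv.pnatEquivNat.summable_iff.mpr h1
    refine h2.congr fun k ↦ ?_
    have : ((Equiv.pnatEquivNat k : ℕ) : ℂ) + 1 = (k : ℂ) := by
      have : k.natPred + 1 = (k : ℕ) := k.natPred_add_one
      rw [← this]; push_cast; rfl
    simp only [Function.comp, cotTerm, this]
  have h2 := hs.mul_left (Complex.I / (2 * Real.pi))
  have hfun : (fun k : ℕ+ ↦ 2 * x / (x ^ 2 + (2 * Real.pi * k) ^ 2)) =
      fun k : ℕ+ ↦ Complex.I / (2 * Real.pi) * (1 / (z - k) + 1 / (z + k)) := by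
    funext k
    have ha : z + k ≠ 0 := by simpa using hne k
    have hb : z - k ≠ 0 := by simpa [sub_eq_add_neg] using hne (-k)
    have hab : x ^ 2 + (2 * Real.pi * k) ^ 2 = -(2 * Real.pi) ^ 2 * ((z - k) * (z + k)) := by
      rw [hz]
      field_simp
      linear_combination x ^ 2 * Complex.I_sq
    have hx' : x = -(Complex.I * (2 * Real.pi) * z) := by
      rw [hz]
      field_simp
      linear_combination Complex.I_sq
    rw [hab, hx']
    field_simp
    ring
  have hval : 1 / (Complex.exp x - 1) + 1 / 2 - 1 / x =
      Complex.I / (2 * Real.pi) * (Real.pi * Complex.cot (Real.pi * z) - 1 / z) := by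
    have he : 2 * Complex.I * (Real.pi * z) = -x := by
      rw [hz]
      field_simp
      linear_combination Complex.I_sq
    have hex : Complex.exp x - 1 ≠ 0 := by
      intro h0
      have h1 : ‖Complex.exp x‖ = 1 := by rw [sub_eq_zero.mp h0]; simp
      rw [Complex.norm_exp, Real.exp_eq_one_iff] at h1
      linarith
    have hzinv : 1 / z = 2 * Real.pi / (Complex.I * x) := by rw [hz, one_div_div]
    rw [Complex.cot_eq_exp_ratio, he, hzinv, Complex.exp_neg]
    have h3 : (1 : ℂ) - (Complex.exp x)⁻¹ ≠ 0 := by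
      have := Complex.exp_ne_zero x
      have h6 : (1 : ℂ) - (Complex.exp x)⁻¹ = (Complex.exp x - 1) / Complex.exp x := by
        field_simp
      rw [h6]
      exact div_ne_zero hex this
    have h4 := Complex.exp_ne_zero x
    have h5 : ((Complex.exp x)⁻¹ + 1) / (Complex.I * (1 - (Complex.exp x)⁻¹)) =
        (1 + Complex.exp x) / (Complex.I * (Complex.exp x - 1)) := by
      field_simp
    rw [h5]
    have hI := Complex.I_ne_zero
    field_simp
    ring
  rw [hfun, hval]
  exact h2

/-- A double series grouped by the product of the two indices. -/
theorem hasSum_sum_divisors {g : ℕ → ℕ → ℂ} (hg : Summable fun p : ℕ+ × ℕ+ ↦ g p.1 p.2) :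
    HasSum (fun N : ℕ+ ↦ ∑ d ∈ (N : ℕ).divisors, g d (N / d))
      (∑' p : ℕ+ × ℕ+, g p.1 p.2) := by
  have h1 := hg.hasSum
  rw [← sigmaAntidiagonalEquivProd.hasSum_iff] at h1
  have h2 := h1.sigma fun N ↦ hasSum_fintype _
  have hfun : (fun N : ℕ+ ↦ ∑ d ∈ (N : ℕ).divisors, g d (N / d)) = fun N : ℕ+ ↦
      ∑ i : (N : ℕ).divisorsAntidiagonal,
        ((fun p : ℕ+ × ℕ+ ↦ g p.1 p.2) ∘ sigmaAntidiagonalEquivProd) ⟨N, i⟩ := by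
    funext N
    rw [← Nat.sum_divisorsAntidiagonal g, ← Finset.sum_coe_sort]
    rfl
  rw [hfun]
  exact h2

theorem Complex.log_I_mul {c : ℂ} (hc : 0 < c.re) :
    Complex.log (Complex.I * c) = Complex.log c + Real.pi / 2 * Complex.I := by
  have hc0 : c ≠ 0 := by rintro rfl; simp at hc
  have ha := abs_lt.mp (Complex.abs_arg_lt_pi_div_two_iff.mpr (Or.inl hc))
  rw [Complex.log_mul Complex.I_ne_zero hc0, Complex.log_I]
  · ring
  · rw [Complex.arg_I]
    constructor <;> linarith [Real.pi_pos]

theorem Complex.log_neg_I_mul {c : ℂ} (hc : 0 < c.re) :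
    Complex.log (-Complex.I * c) = Complex.log c - Real.pi / 2 * Complex.I := by
  have hc0 : c ≠ 0 := by rintro rfl; simp at hc
  have ha := abs_lt.mp (Complex.abs_arg_lt_pi_div_two_iff.mpr (Or.inl hc))
  rw [Complex.log_mul (neg_ne_zero.mpr Complex.I_ne_zero) hc0, Complex.log_neg_I]
  · ring
  · rw [Complex.arg_neg_I]
    constructor <;> linarith [Real.pi_pos]

theorem I_mul_mem_slitPlane {c : ℂ} (hc : 0 < c.re) : Complex.I * c ∈ Complex.slitPlane := by
  refine Or.inr ?_
  simp [hc.ne']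

theorem neg_I_mul_mem_slitPlane {c : ℂ} (hc : 0 < c.re) : -Complex.I * c ∈ Complex.slitPlane := by
  refine Or.inr ?_
  simp [hc.ne']

/-- A rotation by π/2 becomes one by π/4 under the square root; this is where the arguments of the
Kelvin functions come from. The condition Re c > 0 keeps the logarithm on its principal branch. -/
theorem I_mul_cpow_half {c : ℂ} (hc : 0 < c.re) :
    (Complex.I * c) ^ (1 / 2 : ℂ) =
      c ^ (1 / 2 : ℂ) * Complex.exp (Real.pi * Complex.I / 4) := by
  have hc0 : c ≠ 0 := by rintro rfl; simp at hc
  rw [Complex.cpow_def_of_ne_zero (mul_ne_zero Complex.I_ne_zero hc0),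
    Complex.cpow_def_of_ne_zero hc0, Complex.log_I_mul hc, ← Complex.exp_add]
  ring_nf

theorem neg_I_mul_cpow_half {c : ℂ} (hc : 0 < c.re) :
    (-Complex.I * c) ^ (1 / 2 : ℂ) =
      c ^ (1 / 2 : ℂ) * Complex.exp (-(Real.pi * Complex.I / 4)) := by
  have hc0 : c ≠ 0 := by rintro rfl; simp at hc
  rw [Complex.cpow_def_of_ne_zero (mul_ne_zero (neg_ne_zero.mpr Complex.I_ne_zero) hc0),
    Complex.cpow_def_of_ne_zero hc0, Complex.log_neg_I_mul hc, ← Complex.exp_add]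
  ring_nf

theorem natCast_add_ne_zero_of_slitPlane {z : ℂ} (hz : z ∈ Complex.slitPlane) (n : ℕ) :
    (n : ℂ) + z ≠ 0 := by
  intro h0
  have hzn : z = ((-n : ℝ) : ℂ) := by push_cast; linear_combination h0
  rw [hzn] at hz
  have h := Complex.ofReal_mem_slitPlane.mp hz
  have : (0 : ℝ) ≤ n := by positivity
  linarith

namespace IsModularTheta

variable {v : ℕ+ → ℝ} {D c₀ : ℝ} {S : ℝ → ℝ}

theorem summable_besselK_I_mul (h : IsModularTheta v D c₀ S) {c : ℂ} (hc : 0 < c.re) :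
    (Summable fun n : ℕ+ ↦ (v n : ℂ) * besselK 0
      (((4 * Real.pi / Real.sqrt D * Real.sqrt n : ℝ) : ℂ) * c ^ (1 / 2 : ℂ) *
        Complex.exp (Real.pi * Complex.I / 4))) ∧
    (Summable fun n : ℕ+ ↦ (v n : ℂ) * besselK 0
      (((4 * Real.pi / Real.sqrt D * Real.sqrt n : ℝ) : ℂ) * c ^ (1 / 2 : ℂ) *
        Complex.exp (-(Real.pi * Complex.I / 4)))) := by
  have h1 := h.summable_kSum (I_mul_mem_slitPlane hc)
  have h2 := h.summable_kSum (neg_I_mul_mem_slitPlane hc)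
  rw [I_mul_cpow_half hc] at h1
  rw [neg_I_mul_cpow_half hc] at h2
  simp only [← mul_assoc] at h1 h2
  exact ⟨h1, h2⟩

theorem kSum_sub_kSum (h : IsModularTheta v D c₀ S) {c : ℂ} (hc : 0 < c.re) :
    kSum v D (Complex.I * c) - kSum v D (-Complex.I * c) =
      2 * Complex.I * ∑' n : ℕ+, (v n : ℂ) *
        kelvinKei (((4 * Real.pi / Real.sqrt D * Real.sqrt n : ℝ) : ℂ) * c ^ (1 / 2 : ℂ)) := by
  obtain ⟨h1, h2⟩ := h.summable_besselK_I_mul hc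
  rw [kSum, kSum, I_mul_cpow_half hc, neg_I_mul_cpow_half hc]
  simp only [← mul_assoc (Complex.ofReal _)]
  rw [← h1.tsum_sub h2, ← tsum_mul_left]
  refine tsum_congr fun n ↦ ?_
  rw [kelvinKei]
  have hI := Complex.I_ne_zero
  field_simp

theorem kSum_add_kSum (h : IsModularTheta v D c₀ S) {c : ℂ} (hc : 0 < c.re) :
    kSum v D (Complex.I * c) + kSum v D (-Complex.I * c) =
      2 * ∑' n : ℕ+, (v n : ℂ) *
        kelvinKer (((4 * Real.pi / Real.sqrt D * Real.sqrt n : ℝ) : ℂ) * c ^ (1 / 2 : ℂ)) := by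
  obtain ⟨h1, h2⟩ := h.summable_besselK_I_mul hc
  rw [kSum, kSum, I_mul_cpow_half hc, neg_I_mul_cpow_half hc]
  simp only [← mul_assoc (Complex.ofReal _)]
  rw [← h1.tsum_add h2, ← tsum_mul_left]
  refine tsum_congr fun n ↦ ?_
  rw [kelvinKer]
  ring

/-- By partial fractions the sum is (ψ(ic) - ψ(-ic))/(2ic). In the difference log c and the additive
constant cancel, while the two logarithms leave πi times the residue. -/
theorem hasSum_div_sq_add_sq (h : IsModularTheta v D c₀ S) {c : ℂ} (hc : 0 < c.re) :
    HasSum (fun n : ℕ+ ↦ (v n : ℂ) / ((n : ℂ) ^ 2 + c ^ 2))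
      (1 / c * (-c₀ / c + Real.pi * res D c₀ / 2 - 4 * Real.pi / Real.sqrt D *
        ∑' n : ℕ+, (v n : ℂ) *
          kelvinKei (((4 * Real.pi / Real.sqrt D * Real.sqrt n : ℝ) : ℂ) * c ^ (1 / 2 : ℂ)))) := by
  have hc0 : c ≠ 0 := by rintro rfl; simp at hc
  have hI := Complex.I_ne_zero
  have hp := I_mul_mem_slitPlane hc
  have hq := neg_I_mul_mem_slitPlane hc
  have h1 := ((h.summable_psi hp).hasSum.sub (h.summable_psi hq).hasSum).mul_left
    (1 / (2 * Complex.I * c))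
  have hval : 1 / (2 * Complex.I * c) * (psi v (Complex.I * c) - psi v (-Complex.I * c)) =
      1 / c * (-c₀ / c + Real.pi * res D c₀ / 2 - 4 * Real.pi / Real.sqrt D *
        ∑' n : ℕ+, (v n : ℂ) *
          kelvinKei (((4 * Real.pi / Real.sqrt D * Real.sqrt n : ℝ) : ℂ) * c ^ (1 / 2 : ℂ))) := by
    have hk := h.kSum_sub_kSum hc
    rw [h.psi_eq hp, h.psi_eq hq, Complex.log_I_mul hc, Complex.log_neg_I_mul hc]
    set X := kSum v D (Complex.I * c)
    set Y := kSum v D (-Complex.I * c)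
    set Z := ∑' n : ℕ+, (v n : ℂ) *
          kelvinKei (((4 * Real.pi / Real.sqrt D * Real.sqrt n : ℝ) : ℂ) * c ^ (1 / 2 : ℂ))
    have hX : X = Y + 2 * Complex.I * Z := by linear_combination hk
    have e1 : (c₀ : ℂ) / (Complex.I * c) = -Complex.I * (c₀ / c) := by
      field_simp; simp
    have e2 : (c₀ : ℂ) / (-Complex.I * c) = Complex.I * (c₀ / c) := by
      field_simp; simp
    have e3 : 1 / (2 * Complex.I * c) = -Complex.I / 2 * (1 / c) := by
      field_simp; simp
    rw [hX, e1, e2, e3]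
    generalize (4 * Real.pi / Real.sqrt D : ℂ) = κ
    linear_combination (1 / c * (c₀ / c - Real.pi * res D c₀ / 2 + κ * Z)) * Complex.I_sq
  rw [← hval]
  have hfun : (fun n : ℕ+ ↦ (v n : ℂ) / ((n : ℂ) ^ 2 + c ^ 2)) = fun n : ℕ+ ↦
      1 / (2 * Complex.I * c) * ((v n : ℂ) * (1 / (n : ℂ) - 1 / (n + Complex.I * c)) -
        (v n : ℂ) * (1 / (n : ℂ) - 1 / (n + -Complex.I * c))) := by
    funext n
    have ha := natCast_add_ne_zero_of_slitPlane hp n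
    have hb := natCast_add_ne_zero_of_slitPlane hq n
    rw [neg_mul, ← sub_eq_add_neg] at hb
    have hab : (n : ℂ) ^ 2 + c ^ 2 = (n + Complex.I * c) * (n - Complex.I * c) := by
      linear_combination c ^ 2 * Complex.I_sq
    rw [hab, neg_mul, ← sub_eq_add_neg]
    field_simp
    ring
  rw [hfun]
  exact h1

/-- Here the sum is (ψ(ic) + ψ(-ic))/(2c²). The terms c₀/z cancel and the constant survives, so γ
and L'(1) occur only for even exponents. -/
theorem hasSum_div_mul_sq_add_sq (h : IsModularTheta v D c₀ S) {c : ℂ} (hc : 0 < c.re) :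
    HasSum (fun n : ℕ+ ↦ (v n : ℂ) / (n * ((n : ℂ) ^ 2 + c ^ 2)))
      (1 / c ^ 2 * (res D c₀ * Complex.log c +
        (constTerm D c₀ S + res D c₀ * Real.eulerMascheroniConstant) -
        4 * Real.pi / Real.sqrt D * ∑' n : ℕ+, (v n : ℂ) *
          kelvinKer (((4 * Real.pi / Real.sqrt D * Real.sqrt n : ℝ) : ℂ) * c ^ (1 / 2 : ℂ)))) := by
  have hc0 : c ≠ 0 := by rintro rfl; simp at hc
  have hI := Complex.I_ne_zero
  have hp := I_mul_mem_slitPlane hc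
  have hq := neg_I_mul_mem_slitPlane hc
  have h1 := ((h.summable_psi hp).hasSum.add (h.summable_psi hq).hasSum).mul_left
    (1 / (2 * c ^ 2))
  have hval : 1 / (2 * c ^ 2) * (psi v (Complex.I * c) + psi v (-Complex.I * c)) =
      (1 / c ^ 2 * (res D c₀ * Complex.log c +
        (constTerm D c₀ S + res D c₀ * Real.eulerMascheroniConstant) -
        4 * Real.pi / Real.sqrt D * ∑' n : ℕ+, (v n : ℂ) *
          kelvinKer (((4 * Real.pi / Real.sqrt D * Real.sqrt n : ℝ) : ℂ) * c ^ (1 / 2 : ℂ)))) := by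
    have hk := h.kSum_add_kSum hc
    rw [h.psi_eq hp, h.psi_eq hq, Complex.log_I_mul hc, Complex.log_neg_I_mul hc]
    set X := kSum v D (Complex.I * c)
    set Y := kSum v D (-Complex.I * c)
    set Z := ∑' n : ℕ+, (v n : ℂ) *
          kelvinKer (((4 * Real.pi / Real.sqrt D * Real.sqrt n : ℝ) : ℂ) * c ^ (1 / 2 : ℂ))
    have hX : X = 2 * Z - Y := by linear_combination hk
    have e2 : (c₀ : ℂ) / (-Complex.I * c) = -(c₀ / (Complex.I * c)) := by
      rw [neg_mul, div_neg]
    rw [hX, e2]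
    generalize (4 * Real.pi / Real.sqrt D : ℂ) = κ
    have : 1 / (2 * c ^ 2) = 1 / 2 * (1 / c ^ 2) := by ring
    rw [this]
    ring
  rw [← hval]
  have hfun : (fun n : ℕ+ ↦ (v n : ℂ) / (n * ((n : ℂ) ^ 2 + c ^ 2))) = fun n : ℕ+ ↦
      1 / (2 * c ^ 2) * ((v n : ℂ) * (1 / (n : ℂ) - 1 / (n + Complex.I * c)) +
        (v n : ℂ) * (1 / (n : ℂ) - 1 / (n + -Complex.I * c))) := by
    funext n
    have hn : (n : ℂ) ≠ 0 := by exact_mod_cast n.ne_zero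
    have ha := natCast_add_ne_zero_of_slitPlane hp n
    have hb := natCast_add_ne_zero_of_slitPlane hq n
    rw [neg_mul, ← sub_eq_add_neg] at hb
    have hab : (n : ℂ) ^ 2 + c ^ 2 = (n + Complex.I * c) * (n - Complex.I * c) := by
      linear_combination c ^ 2 * Complex.I_sq
    have hsum : 1 / ((n : ℂ) + Complex.I * c) + 1 / (n + -Complex.I * c) =
        2 * n / ((n : ℂ) ^ 2 + c ^ 2) := by
      rw [hab, neg_mul, ← sub_eq_add_neg]
      field_simp
      ring
    have hne : (n : ℂ) ^ 2 + c ^ 2 ≠ 0 := hab ▸ mul_ne_zero ha hb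
    have h2 : (v n : ℂ) * (1 / (n : ℂ) - 1 / (n + Complex.I * c)) +
        (v n : ℂ) * (1 / (n : ℂ) - 1 / (n + -Complex.I * c)) =
        v n * (2 / n - 2 * n / ((n : ℂ) ^ 2 + c ^ 2)) := by
      linear_combination -(v n : ℂ) * hsum
    rw [h2]
    field_simp
    ring
  rw [hfun]
  exact h1

end IsModularTheta

theorem hasSum_riemannZeta_nat {e : ℕ} (he : 2 ≤ e) :
    HasSum (fun n : ℕ+ ↦ 1 / (n : ℂ) ^ e) (riemannZeta e) := by
  have h : 1 < ((e : ℂ)).re := by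
    rw [Complex.natCast_re]
    exact_mod_cast he
  simpa only [Complex.cpow_natCast] using hasSum_riemannZeta_pnat h

/-- Needed because log(qk) = log q + log k: summing the second part over k produces the term in
ζ'(2m). -/
theorem hasSum_log_div_pow {e : ℕ} (he : 2 ≤ e) :
    HasSum (fun n : ℕ+ ↦ Complex.log n / (n : ℂ) ^ e) (-deriv riemannZeta e) := by
  have h1 : 1 < ((e : ℂ)).re := by
    rw [Complex.natCast_re]
    exact_mod_cast he
  have h2 : LSeries.abscissaOfAbsConv 1 < ((e : ℂ).re : EReal) := by
    rw [LSeries.abscissaOfAbsConv_one]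
    exact_mod_cast h1
  have h3 : deriv riemannZeta e = deriv (LSeries 1) e := by
    refine Filter.EventuallyEq.deriv_eq ?_
    have hopen : IsOpen {s : ℂ | 1 < s.re} := isOpen_lt continuous_const Complex.continuous_re
    filter_upwards [hopen.mem_nhds h1] with s hs
    exact (LSeries_one_eq_riemannZeta hs).symm
  have h4 := (LSeriesSummable_logMul_of_lt_re h2).hasSum_pnat
  rw [h3, LSeries_deriv h2, neg_neg]
  have hfun : (fun n : ℕ+ ↦ Complex.log n / (n : ℂ) ^ e) =
      fun n : ℕ+ ↦ LSeries.logMul 1 n / (n : ℂ) ^ (e : ℂ) := by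
    funext n
    simp [LSeries.logMul]
  rw [hfun]
  exact h4

theorem hasSum_cexp_neg_mul_pnat {x : ℂ} (hx : 0 < x.re) :
    HasSum (fun k : ℕ+ ↦ Complex.exp (-(x * k))) (1 / (Complex.exp x - 1)) := by
  have hr : ‖Complex.exp (-x)‖ < 1 := by
    rw [Complex.norm_exp, Complex.neg_re]
    exact Real.exp_lt_one_iff.mpr (by linarith)
  have h1 := (hasSum_geometric_of_norm_lt_one hr).mul_left (Complex.exp (-x))
  have h2 := Equiv.pnatEquivNat.hasSum_iff.mpr h1
  have hfun : (fun k : ℕ+ ↦ Complex.exp (-(x * k))) =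
      (fun n : ℕ ↦ Complex.exp (-x) * Complex.exp (-x) ^ n) ∘ Equiv.pnatEquivNat := by
    funext k
    have hk : ((Equiv.pnatEquivNat k : ℕ) : ℂ) + 1 = (k : ℂ) := by
      have : k.natPred + 1 = (k : ℕ) := k.natPred_add_one
      rw [← this]; push_cast; rfl
    rw [Function.comp, ← Complex.exp_nat_mul, ← Complex.exp_add, ← hk]
    ring_nf
  have hval : 1 / (Complex.exp x - 1) = Complex.exp (-x) * (1 - Complex.exp (-x))⁻¹ := by
    rw [Complex.exp_neg]
    have h4 := Complex.exp_ne_zero x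
    rw [← div_eq_mul_inv, ← mul_div_mul_left (Complex.exp x)⁻¹ _ h4, mul_sub,
      mul_inv_cancel₀ h4, mul_one]
  rw [hfun, hval]
  exact h2

/-- Truncated geometric expansion of `x ^ (-M) / (x + Q)` around `x = 0`. -/
theorem inv_pow_mul_inv_add {x Q : ℂ} (hx : x ≠ 0) (hQ : Q ≠ 0) (hxQ : x + Q ≠ 0) (M : ℕ) :
    1 / x ^ M * (1 / (x + Q)) = (-1) ^ M / Q ^ M * (1 / (x + Q)) +
      ∑ j ∈ Finset.Icc 1 M, (-1) ^ (M - j) / Q ^ (M - j + 1) * (1 / x ^ j) := by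
  induction M with
  | zero => simp
  | succ M ih =>
    rw [Finset.sum_Icc_succ_top (by omega)]
    have h1 : ∑ j ∈ Finset.Icc 1 M, (-1) ^ (M + 1 - j) / Q ^ (M + 1 - j + 1) * (1 / x ^ j) =
        -1 / Q * ∑ j ∈ Finset.Icc 1 M, (-1) ^ (M - j) / Q ^ (M - j + 1) * (1 / x ^ j) := by
      rw [Finset.mul_sum]
      refine Finset.sum_congr rfl fun j hj ↦ ?_
      have : M + 1 - j = M - j + 1 := by
        have := (Finset.mem_Icc.mp hj).2
        omega
      rw [this, pow_succ (-1 : ℂ), pow_succ Q (M - j + 1)]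
      field_simp
    have h2 : ∑ j ∈ Finset.Icc 1 M, (-1) ^ (M - j) / Q ^ (M - j + 1) * (1 / x ^ j) =
        1 / x ^ M * (1 / (x + Q)) - (-1) ^ M / Q ^ M * (1 / (x + Q)) := by
      linear_combination -ih
    rw [h1, h2, Nat.sub_self, pow_succ, pow_succ, pow_succ]
    field_simp
    ring

/-! ### The double series and its summation by rows -/

namespace IsModularTheta

variable {v : ℕ+ → ℝ} {D c₀ : ℝ} {S : ℝ → ℝ}

theorem summable_div_pow (h : IsModularTheta v D c₀ S) {e : ℕ} (he : 2 ≤ e) :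
    Summable fun n : ℕ+ ↦ (v n : ℂ) / (n : ℂ) ^ e := by
  refine Summable.of_norm_bounded h.summable_div_sq fun n ↦ ?_
  have hn : (1 : ℝ) ≤ n := by exact_mod_cast n.pos
  rw [norm_div, norm_pow, Complex.norm_real, Complex.norm_natCast, Real.norm_of_nonneg (h.nonneg n)]
  have := h.nonneg n
  gcongr

/-- The expression factors as (d + iqk)(d - iqk). Since Re q > 0, the numbers ±iqk stay in a cone
away from the real axis, so each factor is bounded below both in terms of d and in terms of k. -/
theorem norm_sq_add_sq_ge {q : ℂ} (hq : 0 < q.re) (d k : ℕ+) :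
    (q.re / ‖q‖ * d) ^ 2 ≤ ‖(d : ℂ) ^ 2 + (q * k) ^ 2‖ ∧
      (q.re * k) ^ 2 ≤ ‖(d : ℂ) ^ 2 + (q * k) ^ 2‖ := by
  have hq0 : q ≠ 0 := by rintro rfl; simp at hq
  have hqn : 0 < ‖q‖ := norm_pos_iff.mpr hq0
  have hk : (0 : ℝ) < k := by exact_mod_cast k.pos
  have hd : (0 : ℝ) < d := by exact_mod_cast d.pos
  have hk0 : (k : ℂ) ≠ 0 := by exact_mod_cast k.ne_zero
  have hδ1 : q.re / ‖q‖ ≤ 1 := (div_le_one hqn).mpr (Complex.re_le_norm q)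
  have hfac : (d : ℂ) ^ 2 + (q * k) ^ 2 =
      (d + Complex.I * (q * k)) * (d + -Complex.I * (q * k)) := by
    linear_combination (q * k) ^ 2 * Complex.I_sq
  have him1 : (Complex.I * (q * k)).im = q.re * k := by simp
  have him2 : (-Complex.I * (q * k)).im = -(q.re * k) := by simp
  have hn1 : ‖Complex.I * (q * k)‖ = ‖q‖ * k := by simp
  have hn2 : ‖-Complex.I * (q * k)‖ = ‖q‖ * k := by simp
  have habs : q.re / ‖q‖ * (‖q‖ * k) = q.re * k := by field_simp
  have hpos : 0 ≤ q.re * k := by positivity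
  have e1 := le_norm_natCast_add hδ1 (z := Complex.I * (q * k))
    (mul_ne_zero Complex.I_ne_zero (mul_ne_zero hq0 hk0))
    (Or.inr (by rw [hn1, him1, habs, abs_of_nonneg hpos])) d
  have e2 := le_norm_natCast_add hδ1 (z := -Complex.I * (q * k))
    (mul_ne_zero (neg_ne_zero.mpr Complex.I_ne_zero) (mul_ne_zero hq0 hk0))
    (Or.inr (by rw [hn2, him2, habs, abs_neg, abs_of_nonneg hpos])) d
  have f1 : q.re * k ≤ ‖(d : ℂ) + Complex.I * (q * k)‖ := by
    refine le_trans ?_ (Complex.abs_im_le_norm _)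
    rw [Complex.add_im, him1, Complex.natCast_im, zero_add]
    exact le_abs_self _
  have f2 : q.re * k ≤ ‖(d : ℂ) + -Complex.I * (q * k)‖ := by
    refine le_trans ?_ (Complex.abs_im_le_norm _)
    rw [Complex.add_im, him2, Complex.natCast_im, zero_add, abs_neg]
    exact le_abs_self _
  rw [hfac, norm_mul, sq, sq]
  constructor
  · exact mul_le_mul e1 e2 (by positivity) (norm_nonneg _)
  · exact mul_le_mul f1 f2 (by positivity) (norm_nonneg _)

theorem sq_add_sq_ne_zero {q : ℂ} (hq : 0 < q.re) (d k : ℕ+) :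
    (d : ℂ) ^ 2 + (q * k) ^ 2 ≠ 0 := by
  have h1 := (norm_sq_add_sq_ge hq d k).2
  have hk : (0 : ℝ) < k := by exact_mod_cast k.pos
  have : 0 < (q.re * k) ^ 2 := by positivity
  exact norm_pos_iff.mp (this.trans_le h1)

theorem summable_pnat_rpow_three_half : Summable fun k : ℕ+ ↦ 1 / (k : ℝ) ^ (3 / 2 : ℝ) :=
  (Real.summable_one_div_nat_rpow.mpr (by norm_num : (1 : ℝ) < 3 / 2)).comp_injective
    PNat.coe_injective

/-- The double series obtained by expanding both the divisor sum and the exponential. -/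
theorem summable_double (h : IsModularTheta v D c₀ S) {q : ℂ} (hq : 0 < q.re) {e : ℕ} (he : 1 ≤ e) :
    Summable fun p : ℕ+ × ℕ+ ↦
      (v p.1 : ℂ) / (p.1 : ℂ) ^ e * (1 / ((p.1 : ℂ) ^ 2 + (q * p.2) ^ 2)) := by
  have hq0 : q ≠ 0 := by rintro rfl; simp at hq
  have hqn : 0 < ‖q‖ := norm_pos_iff.mpr hq0
  set δ := q.re / ‖q‖ with hδ
  have hδ0 : 0 < δ := by positivity
  have hb := (h.summable (3 / 2) (by norm_num)).mul_of_nonneg summable_pnat_rpow_three_half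
    (fun n ↦ div_nonneg (h.nonneg n) (by positivity)) (fun n ↦ by positivity)
  refine Summable.of_norm_bounded (hb.mul_left (1 / (δ ^ (1 / 2 : ℝ) * q.re ^ (3 / 2 : ℝ)))) ?_
  rintro ⟨d, k⟩
  have hk : (0 : ℝ) < k := by exact_mod_cast k.pos
  have hd : (0 : ℝ) < d := by exact_mod_cast d.pos
  have hd1 : (1 : ℝ) ≤ d := by exact_mod_cast d.pos
  obtain ⟨h1, h2⟩ := norm_sq_add_sq_ge hq d k
  have hv := h.nonneg d
  set P := ‖(d : ℂ) ^ 2 + (q * k) ^ 2‖ with hP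
  have hP0 : 0 < P := lt_of_lt_of_le (by positivity) h2
  -- Interpolating between the two lower bounds with weights 1/4 and 3/4 gives d^(1/2) k^(3/2). With
  -- the factor d^e, e ≥ 1, both exponents reach 3/2, beyond the convergence threshold 1.
  have g1 : (δ * d) ^ (1 / 2 : ℝ) ≤ P ^ (1 / 4 : ℝ) := by
    have := Real.rpow_le_rpow (by positivity) h1 (by norm_num : (0 : ℝ) ≤ 1 / 4)
    rw [← Real.rpow_natCast, ← Real.rpow_mul (by positivity)] at this
    norm_num at this ⊢
    exact this
  have g2 : (q.re * k) ^ (3 / 2 : ℝ) ≤ P ^ (3 / 4 : ℝ) := by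
    have := Real.rpow_le_rpow (by positivity) h2 (by norm_num : (0 : ℝ) ≤ 3 / 4)
    rw [← Real.rpow_natCast, ← Real.rpow_mul (by positivity)] at this
    norm_num at this ⊢
    exact this
  have g3 : (δ * d) ^ (1 / 2 : ℝ) * (q.re * k) ^ (3 / 2 : ℝ) ≤ P := by
    have : P = P ^ (1 / 4 : ℝ) * P ^ (3 / 4 : ℝ) := by
      rw [← Real.rpow_add hP0]; norm_num
    rw [this]
    exact mul_le_mul g1 g2 (by positivity) (by positivity)
  simp only
  rw [norm_mul, norm_div, norm_pow, norm_div, norm_one, Complex.norm_real, Complex.norm_natCast,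
    Real.norm_of_nonneg hv, ← hP]
  have g4 : (d : ℝ) ≤ (d : ℝ) ^ e := by
    simpa using pow_le_pow_right₀ hd1 he
  calc v d / (d : ℝ) ^ e * (1 / P)
      ≤ v d / d * (1 / ((δ * d) ^ (1 / 2 : ℝ) * (q.re * k) ^ (3 / 2 : ℝ))) := by
        gcongr
    _ = _ := by
        have h32 : (d : ℝ) ^ (3 / 2 : ℝ) = d * (d : ℝ) ^ (1 / 2 : ℝ) := by
          rw [show (3 / 2 : ℝ) = 1 + 1 / 2 by norm_num, Real.rpow_add hd, Real.rpow_one]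
        rw [Real.mul_rpow hδ0.le hd.le, Real.mul_rpow hq.le hk.le, h32]
        have := Real.rpow_pos_of_pos hd (1 / 2)
        field_simp

theorem summable_exp_double (h : IsModularTheta v D c₀ S) {y : ℂ} (hy : 0 < y.re) {e : ℕ}
    (he : 2 ≤ e) :
    Summable fun p : ℕ+ × ℕ+ ↦
      (v p.1 : ℂ) / (p.1 : ℂ) ^ e * Complex.exp (-(p.1 * p.2 * y)) := by
  have hr : Real.exp (-y.re) < 1 := Real.exp_lt_one_iff.mpr (by linarith)
  have hg : Summable fun k : ℕ+ ↦ Real.exp (-y.re) ^ (k : ℕ) :=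
    (summable_geometric_of_lt_one (Real.exp_pos _).le hr).comp_injective PNat.coe_injective
  have hb := h.summable_div_sq.mul_of_nonneg hg
    (fun n ↦ div_nonneg (h.nonneg n) (by positivity)) (fun n ↦ by positivity)
  refine Summable.of_norm_bounded hb ?_
  rintro ⟨d, k⟩
  have hk : (0 : ℝ) < k := by exact_mod_cast k.pos
  have hd1 : (1 : ℝ) ≤ d := by exact_mod_cast d.pos
  have hv := h.nonneg d
  simp only
  rw [norm_mul, norm_div, norm_pow, Complex.norm_real, Complex.norm_natCast,
    Real.norm_of_nonneg hv, Complex.norm_exp, ← Real.exp_nat_mul]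
  have hre : (-((d : ℂ) * k * y)).re = -((d * k : ℝ) * y.re) := by
    rw [Complex.neg_re, show ((d : ℂ) * k) = ((d * k : ℝ) : ℂ) by push_cast; rfl,
      Complex.re_ofReal_mul]
  rw [hre]
  have : (k : ℝ) * y.re ≤ d * k * y.re := by
    have : 0 < (k : ℝ) * y.re := by positivity
    nlinarith
  gcongr
  linarith

/-- The partial fraction expansion at x = dy: as yq = 2π, its denominators are y²(d² + (qk)²). -/
theorem hasSum_double_fst (v : ℕ+ → ℝ) {y q : ℂ} (hy : 0 < y.re) (hq : 0 < q.re)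
    (hyq : y * q = 2 * Real.pi) {e : ℕ} (he : 1 ≤ e) (d : ℕ+) : HasSum (fun k : ℕ+ ↦
      (v d : ℂ) / (d : ℂ) ^ (e - 1) * (1 / ((d : ℂ) ^ 2 + (q * k) ^ 2)))
      ((v d : ℂ) / (d : ℂ) ^ e * (y / 2) *
        (1 / (Complex.exp (d * y) - 1) + 1 / 2 - 1 / (d * y))) := by
  have hy0 : y ≠ 0 := by rintro rfl; simp at hy
  have hd : (0 : ℝ) < d := by exact_mod_cast d.pos
  have hd0 : (d : ℂ) ≠ 0 := by exact_mod_cast d.ne_zero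
  have hdy : 0 < ((d : ℂ) * y).re := by
    rw [← Complex.ofReal_natCast, Complex.re_ofReal_mul]; positivity
  have h1 := (hasSum_partialFraction_exp hdy).mul_left ((v d : ℂ) / (d : ℂ) ^ e * (y / 2))
  have hfun : (fun k : ℕ+ ↦
      (v d : ℂ) / (d : ℂ) ^ (e - 1) * (1 / ((d : ℂ) ^ 2 + (q * k) ^ 2))) =
      fun k : ℕ+ ↦ (v d : ℂ) / (d : ℂ) ^ e * (y / 2) *
        (2 * (d * y) / ((d * y) ^ 2 + (2 * Real.pi * k) ^ 2)) := by
    funext k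
    have h2 : ((d : ℂ) * y) ^ 2 + (2 * Real.pi * k) ^ 2 =
        y ^ 2 * ((d : ℂ) ^ 2 + (q * k) ^ 2) := by
      rw [← hyq]; ring
    have h3 := sq_add_sq_ne_zero hq d k
    obtain ⟨f, rfl⟩ : ∃ f, e = f + 1 := ⟨e - 1, by omega⟩
    rw [h2, Nat.add_sub_cancel, pow_succ]
    field_simp
    ring
  rw [hfun]
  exact h1

/-- Lambert series expressed through the partial fraction double series. -/
theorem lambert_eq (h : IsModularTheta v D c₀ S) {y q : ℂ} (hy : 0 < y.re) (hq : 0 < q.re)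
    (hyq : y * q = 2 * Real.pi) {e : ℕ} (he : 2 ≤ e) :
    1 / 2 * ∑' n : ℕ+, (v n : ℂ) / (n : ℂ) ^ e +
      ∑' p : ℕ+ × ℕ+, (v p.1 : ℂ) / (p.1 : ℂ) ^ e * Complex.exp (-(p.1 * p.2 * y)) -
      1 / y * ∑' n : ℕ+, (v n : ℂ) / (n : ℂ) ^ (e + 1) =
    2 / y * ∑' p : ℕ+ × ℕ+,
      (v p.1 : ℂ) / (p.1 : ℂ) ^ (e - 1) * (1 / ((p.1 : ℂ) ^ 2 + (q * p.2) ^ 2)) := by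
  have hy0 : y ≠ 0 := by rintro rfl; simp at hy
  have hT := (h.summable_double hq (show 1 ≤ e - 1 by omega)).hasSum.prod_fiberwise
    fun d ↦ hasSum_double_fst v hy hq hyq (show 1 ≤ e by omega) d
  have hexp := (h.summable_exp_double hy he).hasSum.prod_fiberwise
    (g := fun d : ℕ+ ↦ (v d : ℂ) / (d : ℂ) ^ e * (1 / (Complex.exp (d * y) - 1))) fun d ↦ by
      have hd : (0 : ℝ) < d := by exact_mod_cast d.pos
      have hdy : 0 < ((d : ℂ) * y).re := by
        rw [← Complex.ofReal_natCast, Complex.re_ofReal_mul]; positivity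
      have h1 := (hasSum_cexp_neg_mul_pnat hdy).mul_left ((v d : ℂ) / (d : ℂ) ^ e)
      simp only [mul_right_comm (d : ℂ) y] at h1
      exact h1
  have h1 := ((((h.summable_div_pow he).hasSum.mul_left (1 / 2)).add hexp).sub
    ((h.summable_div_pow (show 2 ≤ e + 1 by omega)).hasSum.mul_left (1 / y)))
  refine h1.unique ?_
  have hfun : (fun d : ℕ+ ↦ 1 / 2 * ((v d : ℂ) / (d : ℂ) ^ e) +
      (v d : ℂ) / (d : ℂ) ^ e * (1 / (Complex.exp (d * y) - 1)) -
      1 / y * ((v d : ℂ) / (d : ℂ) ^ (e + 1))) = fun d : ℕ+ ↦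
      2 / y * ((v d : ℂ) / (d : ℂ) ^ e * (y / 2) *
        (1 / (Complex.exp (d * y) - 1) + 1 / 2 - 1 / (d * y))) := by
    funext d
    have hd0 : (d : ℂ) ≠ 0 := by exact_mod_cast d.ne_zero
    generalize 1 / (Complex.exp (d * y) - 1) = E
    rw [pow_succ]
    field_simp
    ring
  rw [hfun]
  exact hT.mul_left (2 / y)

end IsModularTheta

/-! ### Summation of the double series by columns -/

namespace IsModularTheta

variable {v : ℕ+ → ℝ} {D c₀ : ℝ} {S : ℝ → ℝ}

/-- The argument of K₀ is proportional to √(dk), so the fourth-power bound gives decay d^(-2) k^(-2)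
in both indices at once, whatever e is. -/
theorem summable_besselK_double (h : IsModularTheta v D c₀ S) {w : ℂ} (hw : w ∈ Complex.slitPlane)
    (e : ℕ) :
    Summable fun p : ℕ+ × ℕ+ ↦ (v p.1 : ℂ) / (p.2 : ℂ) ^ e *
      besselK 0 (((4 * Real.pi / Real.sqrt D * Real.sqrt p.1 : ℝ) : ℂ) *
        (w * p.2) ^ (1 / 2 : ℂ)) := by
  set ε := (w ^ (1 / 2 : ℂ)).re with hε
  have hε0 : 0 < ε := re_cpow_half_pos hw
  have hk2 : Summable fun k : ℕ+ ↦ 1 / (k : ℝ) ^ 2 :=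
    (Real.summable_one_div_nat_pow.mpr one_lt_two).comp_injective PNat.coe_injective
  have hb := h.summable_div_sq.mul_of_nonneg hk2
    (fun n ↦ div_nonneg (h.nonneg n) (by positivity)) (fun n ↦ by positivity)
  refine Summable.of_norm_bounded
    (hb.mul_left (96 / (4 * Real.pi / Real.sqrt D * ε) ^ 4)) ?_
  rintro ⟨d, k⟩
  have hk : (0 : ℝ) < k := by exact_mod_cast k.pos
  have hk1 : (1 : ℝ) ≤ k := by exact_mod_cast k.pos
  have hsk : 0 < Real.sqrt k := Real.sqrt_pos.mpr hk
  have hroot : (w * k) ^ (1 / 2 : ℂ) = (Real.sqrt k : ℂ) * w ^ (1 / 2 : ℂ) := by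
    rw [mul_comm w, ← ofReal_mul_cpow_half hk.le (Complex.slitPlane_ne_zero hw)]
    simp
  have h1 := h.norm_kSum_term_le (ε := Real.sqrt k * ε) (w := (w * k) ^ (1 / 2 : ℂ))
    (by positivity) (by rw [hroot, Complex.re_ofReal_mul]) d
  have hsq : Real.sqrt k ^ 4 = (k : ℝ) ^ 2 := by
    rw [show 4 = 2 * 2 by norm_num, pow_mul, Real.sq_sqrt hk.le]
  simp only
  rw [div_mul_eq_mul_div, norm_div, norm_pow, Complex.norm_natCast]
  refine (div_le_self (norm_nonneg _) (one_le_pow₀ hk1)).trans (h1.trans_eq ?_)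
  rw [← mul_assoc, mul_comm _ (Real.sqrt k), mul_assoc, mul_pow, hsq]
  field_simp

theorem summable_rotated_double (h : IsModularTheta v D c₀ S) {q : ℂ} (hq : 0 < q.re) (e : ℕ) :
    (Summable fun p : ℕ+ × ℕ+ ↦ (v p.1 : ℂ) / (p.2 : ℂ) ^ e *
      besselK 0 (((4 * Real.pi / Real.sqrt D * Real.sqrt p.1 : ℝ) : ℂ) *
        (q * p.2) ^ (1 / 2 : ℂ) * Complex.exp (Real.pi * Complex.I / 4))) ∧
    (Summable fun p : ℕ+ × ℕ+ ↦ (v p.1 : ℂ) / (p.2 : ℂ) ^ e *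
      besselK 0 (((4 * Real.pi / Real.sqrt D * Real.sqrt p.1 : ℝ) : ℂ) *
        (q * p.2) ^ (1 / 2 : ℂ) * Complex.exp (-(Real.pi * Complex.I / 4)))) := by
  have hqk : ∀ k : ℕ+, 0 < (q * k).re := fun k ↦ by
    have hk : (0 : ℝ) < k := by exact_mod_cast k.pos
    rw [← Complex.ofReal_natCast, Complex.re_mul_ofReal]; positivity
  have h1 := h.summable_besselK_double (I_mul_mem_slitPlane hq) e
  have h2 := h.summable_besselK_double (neg_I_mul_mem_slitPlane hq) e
  refine ⟨h1.congr fun p ↦ ?_, h2.congr fun p ↦ ?_⟩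
  · rw [mul_assoc Complex.I, I_mul_cpow_half (hqk _), mul_assoc (Complex.ofReal _)]
  · rw [mul_assoc (-Complex.I), neg_I_mul_cpow_half (hqk _), mul_assoc (Complex.ofReal _)]

theorem summable_kelvinKei_double (h : IsModularTheta v D c₀ S) {q : ℂ} (hq : 0 < q.re) (e : ℕ) :
    Summable fun p : ℕ+ × ℕ+ ↦ (v p.1 : ℂ) / (p.2 : ℂ) ^ e *
      kelvinKei (((4 * Real.pi / Real.sqrt D * Real.sqrt p.1 : ℝ) : ℂ) *
        (q * p.2) ^ (1 / 2 : ℂ)) := by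
  obtain ⟨h1, h2⟩ := h.summable_rotated_double hq e
  refine ((h1.sub h2).mul_left (1 / (2 * Complex.I))).congr fun p ↦ ?_
  rw [kelvinKei]
  ring

theorem summable_kelvinKer_double (h : IsModularTheta v D c₀ S) {q : ℂ} (hq : 0 < q.re) (e : ℕ) :
    Summable fun p : ℕ+ × ℕ+ ↦ (v p.1 : ℂ) / (p.2 : ℂ) ^ e *
      kelvinKer (((4 * Real.pi / Real.sqrt D * Real.sqrt p.1 : ℝ) : ℂ) *
        (q * p.2) ^ (1 / 2 : ℂ)) := by
  obtain ⟨h1, h2⟩ := h.summable_rotated_double hq e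
  refine ((h1.add h2).mul_left (1 / 2)).congr fun p ↦ ?_
  rw [kelvinKer]
  ring

theorem _root_.HasSum.prod_fiberwise_swap {f : ℕ+ × ℕ+ → ℂ} {g : ℕ+ → ℂ} {s : ℂ}
    (hf : HasSum f s) (hg : ∀ k, HasSum (fun d ↦ f (d, k)) (g k)) : HasSum g s :=
  ((Equiv.prodComm ℕ+ ℕ+).hasSum_iff.mpr hf).prod_fiberwise hg

/-- Summation by columns of a double series whose terms carry a factor depending on the column. -/
theorem _root_.hasSum_tsum_column {a : ℕ+ → ℂ} {b : ℕ+ → ℕ+ → ℂ} {e : ℕ}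
    (hf : Summable fun p : ℕ+ × ℕ+ ↦ a p.1 / (p.2 : ℂ) ^ e * b p.1 p.2) :
    HasSum (fun k : ℕ+ ↦ 1 / (k : ℂ) ^ e * ∑' d : ℕ+, a d * b d k)
      (∑' p : ℕ+ × ℕ+, a p.1 / (p.2 : ℂ) ^ e * b p.1 p.2) := by
  refine hf.hasSum.prod_fiberwise_swap fun k ↦ ?_
  have h1 := ((Equiv.prodComm ℕ+ ℕ+).summable_iff.mpr hf).prod_factor k
  have h2 : ∑' d : ℕ+, a d / (k : ℂ) ^ e * b d k = 1 / (k : ℂ) ^ e * ∑' d : ℕ+, a d * b d k := by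
    rw [← tsum_mul_left]
    exact tsum_congr fun d ↦ by ring
  rw [← h2]
  exact h1.hasSum

/-- The columns of the double series, with a general coefficient sequence. -/
theorem hasSum_column {a : ℕ+ → ℂ} {q x : ℂ} (hq : 0 < q.re) {k : ℕ+} {M : ℕ}
    (hx : HasSum (fun d : ℕ+ ↦ a d * (1 / ((d : ℂ) ^ 2 + (q * k) ^ 2))) x)
    (ha : ∀ j ∈ Finset.Icc 1 M, Summable fun d : ℕ+ ↦ a d / (d : ℂ) ^ (2 * j)) :
    HasSum (fun d : ℕ+ ↦ a d / (d : ℂ) ^ (2 * M) * (1 / ((d : ℂ) ^ 2 + (q * k) ^ 2)))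
      ((-1) ^ M / q ^ (2 * M) * (1 / (k : ℂ) ^ (2 * M) * x) +
        ∑ j ∈ Finset.Icc 1 M, (-1) ^ (M - j) / q ^ (2 * (M - j + 1)) *
          (∑' d : ℕ+, a d / (d : ℂ) ^ (2 * j)) * (1 / (k : ℂ) ^ (2 * (M - j + 1)))) := by
  have hq0 : q ≠ 0 := by rintro rfl; simp at hq
  have hk0 : (k : ℂ) ≠ 0 := by exact_mod_cast k.ne_zero
  have h1 := (hx.mul_left ((-1) ^ M / q ^ (2 * M) * (1 / (k : ℂ) ^ (2 * M)))).add
    (hasSum_sum fun j (hj : j ∈ Finset.Icc 1 M) ↦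
      ((ha j hj).hasSum.mul_left ((-1) ^ (M - j) / q ^ (2 * (M - j + 1)) *
        (1 / (k : ℂ) ^ (2 * (M - j + 1))))))
  have hfun : (fun d : ℕ+ ↦ a d / (d : ℂ) ^ (2 * M) * (1 / ((d : ℂ) ^ 2 + (q * k) ^ 2))) =
      fun d : ℕ+ ↦ (-1) ^ M / q ^ (2 * M) * (1 / (k : ℂ) ^ (2 * M)) *
        (a d * (1 / ((d : ℂ) ^ 2 + (q * k) ^ 2))) +
        ∑ j ∈ Finset.Icc 1 M, (-1) ^ (M - j) / q ^ (2 * (M - j + 1)) *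
          (1 / (k : ℂ) ^ (2 * (M - j + 1))) * (a d / (d : ℂ) ^ (2 * j)) := by
    funext d
    have hd0 : (d : ℂ) ≠ 0 := by exact_mod_cast d.ne_zero
    -- The geometric expansion is taken at x = d² and Q = (qk)².
    have h2 := inv_pow_mul_inv_add (pow_ne_zero 2 hd0) (pow_ne_zero 2 (mul_ne_zero hq0 hk0))
      (sq_add_sq_ne_zero hq d k) M
    simp only [← pow_mul] at h2
    have h3 : a d / (d : ℂ) ^ (2 * M) * (1 / ((d : ℂ) ^ 2 + (q * k) ^ 2)) =
        a d * (1 / (d : ℂ) ^ (2 * M) * (1 / ((d : ℂ) ^ 2 + (q * k) ^ 2))) := by ring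
    rw [h3, h2, mul_add, Finset.mul_sum]
    congr 1
    · rw [mul_pow]
      field_simp
    · refine Finset.sum_congr rfl fun j _ ↦ ?_
      rw [mul_pow]
      field_simp
  have hval : ((-1) ^ M / q ^ (2 * M) * (1 / (k : ℂ) ^ (2 * M) * x) +
        ∑ j ∈ Finset.Icc 1 M, (-1) ^ (M - j) / q ^ (2 * (M - j + 1)) *
          (∑' d : ℕ+, a d / (d : ℂ) ^ (2 * j)) * (1 / (k : ℂ) ^ (2 * (M - j + 1)))) =
      ((-1) ^ M / q ^ (2 * M) * (1 / (k : ℂ) ^ (2 * M)) * x +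
        ∑ j ∈ Finset.Icc 1 M, (-1) ^ (M - j) / q ^ (2 * (M - j + 1)) *
          (1 / (k : ℂ) ^ (2 * (M - j + 1))) * (∑' d : ℕ+, a d / (d : ℂ) ^ (2 * j))) := by
    congr 1
    · ring
    · exact Finset.sum_congr rfl fun j _ ↦ by ring
  rw [hfun, hval]
  exact h1

/-- Summation of the double series by columns. -/
theorem tsum_double_eq {a : ℕ+ → ℂ} {q X : ℂ} (hq : 0 < q.re) {x : ℕ+ → ℂ} {M : ℕ}
    (hx : ∀ k : ℕ+, HasSum (fun d : ℕ+ ↦ a d * (1 / ((d : ℂ) ^ 2 + (q * k) ^ 2))) (x k))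
    (ha : ∀ j ∈ Finset.Icc 1 M, Summable fun d : ℕ+ ↦ a d / (d : ℂ) ^ (2 * j))
    (hF : Summable fun p : ℕ+ × ℕ+ ↦
      a p.1 / (p.1 : ℂ) ^ (2 * M) * (1 / ((p.1 : ℂ) ^ 2 + (q * p.2) ^ 2)))
    (hX : HasSum (fun k : ℕ+ ↦ 1 / (k : ℂ) ^ (2 * M) * x k) X) :
    ∑' p : ℕ+ × ℕ+, a p.1 / (p.1 : ℂ) ^ (2 * M) * (1 / ((p.1 : ℂ) ^ 2 + (q * p.2) ^ 2)) =
      (-1) ^ M / q ^ (2 * M) * X +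
        ∑ j ∈ Finset.Icc 1 M, (-1) ^ (M - j) / q ^ (2 * (M - j + 1)) *
          (∑' d : ℕ+, a d / (d : ℂ) ^ (2 * j)) * riemannZeta (2 * (M - j + 1) : ℕ) := by
  have h2 := hF.hasSum.prod_fiberwise_swap
    (g := fun k : ℕ+ ↦ (-1) ^ M / q ^ (2 * M) * (1 / (k : ℂ) ^ (2 * M) * x k) +
        ∑ j ∈ Finset.Icc 1 M, (-1) ^ (M - j) / q ^ (2 * (M - j + 1)) *
          (∑' d : ℕ+, a d / (d : ℂ) ^ (2 * j)) * (1 / (k : ℂ) ^ (2 * (M - j + 1))))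
    fun k ↦ hasSum_column hq (hx k) ha
  refine h2.unique ((hX.mul_left _).add (hasSum_sum fun j _ ↦ ?_))
  exact (hasSum_riemannZeta_nat (by omega)).mul_left _

/-- Here a = v and M = m. The column sums carry 1/(qk), and 1/(qk)² in the c₀ term, which raises the
exponent 2m of k to 2m + 1 and 2m + 2. -/
theorem tsum_double_odd (h : IsModularTheta v D c₀ S) {q : ℂ} (hq : 0 < q.re) {m : ℕ}
    (hm : 1 ≤ m) :
    ∑' p : ℕ+ × ℕ+, (v p.1 : ℂ) / (p.1 : ℂ) ^ (2 * m) * (1 / ((p.1 : ℂ) ^ 2 + (q * p.2) ^ 2)) =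
      (-1) ^ m / q ^ (2 * m) * (1 / q * (Real.pi * res D c₀ / 2 * riemannZeta (2 * m + 1 : ℕ) -
        4 * Real.pi / Real.sqrt D * ∑' p : ℕ+ × ℕ+, (v p.1 : ℂ) / (p.2 : ℂ) ^ (2 * m + 1) *
          kelvinKei (((4 * Real.pi / Real.sqrt D * Real.sqrt p.1 : ℝ) : ℂ) *
            (q * p.2) ^ (1 / 2 : ℂ)) - c₀ / q * riemannZeta (2 * m + 2 : ℕ))) +
      ∑ j ∈ Finset.Icc 1 m, (-1) ^ (m - j) / q ^ (2 * (m - j + 1)) *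
        (∑' d : ℕ+, (v d : ℂ) / (d : ℂ) ^ (2 * j)) * riemannZeta (2 * (m - j + 1) : ℕ) := by
  have hq0 : q ≠ 0 := by rintro rfl; simp at hq
  have hqk : ∀ k : ℕ+, 0 < (q * k).re := fun k ↦ by
    have hk : (0 : ℝ) < k := by exact_mod_cast k.pos
    rw [← Complex.ofReal_natCast, Complex.re_mul_ofReal]; positivity
  set κ : ℂ := 4 * Real.pi / Real.sqrt D with hκ
  set b : ℕ+ → ℕ+ → ℂ := fun d k ↦
    kelvinKei (((4 * Real.pi / Real.sqrt D * Real.sqrt d : ℝ) : ℂ) * (q * k) ^ (1 / 2 : ℂ)) with hb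
  have hx : ∀ k : ℕ+, HasSum (fun d : ℕ+ ↦ (v d : ℂ) * (1 / ((d : ℂ) ^ 2 + (q * k) ^ 2)))
      (1 / (q * k) * (-c₀ / (q * k) + Real.pi * res D c₀ / 2 - κ * ∑' d, (v d : ℂ) * b d k)) :=
    fun k ↦ by
      simp only [mul_one_div]
      exact h.hasSum_div_sq_add_sq (hqk k)
  have hsum : Summable fun p : ℕ+ × ℕ+ ↦ (v p.1 : ℂ) / (p.2 : ℂ) ^ (2 * m + 1) * b p.1 p.2 :=
    h.summable_kelvinKei_double hq (2 * m + 1)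
  have hX : HasSum (fun k : ℕ+ ↦ 1 / (k : ℂ) ^ (2 * m) * (1 / (q * k) *
      (-c₀ / (q * k) + Real.pi * res D c₀ / 2 - κ * ∑' d, (v d : ℂ) * b d k)))
      (1 / q * (Real.pi * res D c₀ / 2 * riemannZeta (2 * m + 1 : ℕ) -
        κ * ∑' p : ℕ+ × ℕ+, (v p.1 : ℂ) / (p.2 : ℂ) ^ (2 * m + 1) * b p.1 p.2 -
        c₀ / q * riemannZeta (2 * m + 2 : ℕ))) := by
    have hcol := hasSum_tsum_column (a := fun n ↦ (v n : ℂ)) (b := b) hsum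
    have h1 := ((((hasSum_riemannZeta_nat (show 2 ≤ 2 * m + 1 by omega)).mul_left
      (Real.pi * res D c₀ / 2 : ℂ)).sub (hcol.mul_left κ)).sub
      ((hasSum_riemannZeta_nat (show 2 ≤ 2 * m + 2 by omega)).mul_left
        (c₀ / q : ℂ))).mul_left (1 / q)
    have hfun : (fun k : ℕ+ ↦ 1 / (k : ℂ) ^ (2 * m) * (1 / (q * k) *
        (-c₀ / (q * k) + Real.pi * res D c₀ / 2 - κ * ∑' d, (v d : ℂ) * b d k))) =
        fun k : ℕ+ ↦ 1 / q * (Real.pi * res D c₀ / 2 * (1 / (k : ℂ) ^ (2 * m + 1)) -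
          κ * (1 / (k : ℂ) ^ (2 * m + 1) * ∑' d, (v d : ℂ) * b d k) -
          c₀ / q * (1 / (k : ℂ) ^ (2 * m + 2))) := by
      funext k
      have hk0 : (k : ℂ) ≠ 0 := by exact_mod_cast k.ne_zero
      generalize ∑' d, (v d : ℂ) * b d k = Z
      rw [pow_succ, pow_add]
      field_simp
      ring
    rw [hfun]
    exact h1
  exact tsum_double_eq hq hx
    (fun j hj ↦ h.summable_div_pow (by have := (Finset.mem_Icc.mp hj).1; omega))
    (h.summable_double hq (by omega)) hX

/-- Here a(d) = v(d)/d and M = m - 1: the odd power of d keeps one factor 1/d inside the column sum.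
The factor 1/(qk)² raises the exponent of k from 2m - 2 to 2m. -/
theorem tsum_double_even (h : IsModularTheta v D c₀ S) {q : ℂ} (hq : 0 < q.re) {m : ℕ}
    (hm : 1 ≤ m) :
    ∑' p : ℕ+ × ℕ+,
        (v p.1 : ℂ) / (p.1 : ℂ) ^ (2 * m - 1) * (1 / ((p.1 : ℂ) ^ 2 + (q * p.2) ^ 2)) =
      (-1) ^ (m - 1) / q ^ (2 * (m - 1)) * (1 / q ^ 2 *
        ((res D c₀ * Complex.log q +
          (constTerm D c₀ S + res D c₀ * Real.eulerMascheroniConstant)) *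
          riemannZeta (2 * m : ℕ) - res D c₀ * deriv riemannZeta (2 * m : ℕ) -
        4 * Real.pi / Real.sqrt D * ∑' p : ℕ+ × ℕ+, (v p.1 : ℂ) / (p.2 : ℂ) ^ (2 * m) *
          kelvinKer (((4 * Real.pi / Real.sqrt D * Real.sqrt p.1 : ℝ) : ℂ) *
            (q * p.2) ^ (1 / 2 : ℂ)))) +
      ∑ j ∈ Finset.Icc 1 (m - 1), (-1) ^ (m - 1 - j) / q ^ (2 * (m - 1 - j + 1)) *
        (∑' d : ℕ+, (v d : ℂ) / (d : ℂ) ^ (2 * j + 1)) *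
          riemannZeta (2 * (m - 1 - j + 1) : ℕ) := by
  obtain ⟨M, rfl⟩ : ∃ M, m = M + 1 := ⟨m - 1, by omega⟩
  simp only [Nat.add_sub_cancel]
  have hq0 : q ≠ 0 := by rintro rfl; simp at hq
  have hqk : ∀ k : ℕ+, 0 < (q * k).re := fun k ↦ by
    have hk : (0 : ℝ) < k := by exact_mod_cast k.pos
    rw [← Complex.ofReal_natCast, Complex.re_mul_ofReal]; positivity
  have hpow : ∀ (d : ℕ+) (j : ℕ), (v d : ℂ) / (d : ℂ) ^ (2 * j + 1) =
      (v d : ℂ) / d / (d : ℂ) ^ (2 * j) := fun d j ↦ by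
    rw [pow_succ, div_div, mul_comm]
  have hF := h.summable_double hq (show 1 ≤ 2 * M + 1 by omega)
  rw [show 2 * (M + 1) - 1 = 2 * M + 1 by omega]
  simp only [hpow] at hF ⊢
  set κ : ℂ := 4 * Real.pi / Real.sqrt D with hκ
  set b : ℕ+ → ℕ+ → ℂ := fun d k ↦
    kelvinKer (((4 * Real.pi / Real.sqrt D * Real.sqrt d : ℝ) : ℂ) * (q * k) ^ (1 / 2 : ℂ)) with hb
  set C : ℂ := constTerm D c₀ S + res D c₀ * Real.eulerMascheroniConstant with hC
  have hx : ∀ k : ℕ+, HasSum (fun d : ℕ+ ↦ (v d : ℂ) / d * (1 / ((d : ℂ) ^ 2 + (q * k) ^ 2)))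
      (1 / (q * k) ^ 2 * (res D c₀ * Complex.log (q * k) + C - κ * ∑' d, (v d : ℂ) * b d k)) :=
    fun k ↦ by
      simp only [mul_one_div, div_div]
      exact h.hasSum_div_mul_sq_add_sq (hqk k)
  have hsum : Summable fun p : ℕ+ × ℕ+ ↦ (v p.1 : ℂ) / (p.2 : ℂ) ^ (2 * (M + 1)) * b p.1 p.2 :=
    h.summable_kelvinKer_double hq (2 * (M + 1))
  have hX : HasSum (fun k : ℕ+ ↦ 1 / (k : ℂ) ^ (2 * M) * (1 / (q * k) ^ 2 *
      (res D c₀ * Complex.log (q * k) + C - κ * ∑' d, (v d : ℂ) * b d k)))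
      (1 / q ^ 2 * ((res D c₀ * Complex.log q + C) * riemannZeta (2 * (M + 1) : ℕ) -
        res D c₀ * deriv riemannZeta (2 * (M + 1) : ℕ) -
        κ * ∑' p : ℕ+ × ℕ+, (v p.1 : ℂ) / (p.2 : ℂ) ^ (2 * (M + 1)) * b p.1 p.2)) := by
    have hcol := hasSum_tsum_column (a := fun n ↦ (v n : ℂ)) (b := b) hsum
    have h1 := ((((hasSum_riemannZeta_nat (show 2 ≤ 2 * (M + 1) by omega)).mul_left
      (res D c₀ * Complex.log q + C)).add
      ((hasSum_log_div_pow (show 2 ≤ 2 * (M + 1) by omega)).mul_left (res D c₀ : ℂ))).sub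
      (hcol.mul_left κ)).mul_left (1 / q ^ 2)
    rw [mul_neg, ← sub_eq_add_neg] at h1
    have hfun : (fun k : ℕ+ ↦ 1 / (k : ℂ) ^ (2 * M) * (1 / (q * k) ^ 2 *
        (res D c₀ * Complex.log (q * k) + C - κ * ∑' d, (v d : ℂ) * b d k))) =
        fun k : ℕ+ ↦ 1 / q ^ 2 * ((res D c₀ * Complex.log q + C) * (1 / (k : ℂ) ^ (2 * (M + 1))) +
          res D c₀ * (Complex.log k / (k : ℂ) ^ (2 * (M + 1))) -
          κ * (1 / (k : ℂ) ^ (2 * (M + 1)) * ∑' d, (v d : ℂ) * b d k)) := by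
      funext k
      have hk : (0 : ℝ) < k := by exact_mod_cast k.pos
      have hk0 : (k : ℂ) ≠ 0 := by exact_mod_cast k.ne_zero
      have hlog : Complex.log (q * k) = Complex.log q + Complex.log k := by
        rw [← Complex.ofReal_natCast, Complex.log_mul_ofReal _ hk _ hq0, add_comm,
          Complex.ofReal_log hk.le]
      rw [hlog]
      generalize ∑' d, (v d : ℂ) * b d k = Z
      rw [mul_add 2 M 1, pow_add]
      field_simp
      ring
    rw [hfun]
    exact h1
  exact tsum_double_eq (a := fun d ↦ (v d : ℂ) / d) hq hx
    (fun j hj ↦ by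
      simp only [← hpow]
      exact h.summable_div_pow (by have := (Finset.mem_Icc.mp hj).1; omega))
    hF hX

end IsModularTheta

/-! ### Specialization to the ideal counting function -/

section

variable {K : Type*} [Field K] [NumberField K]

theorem res_eq_quadL_one (hK : Module.finrank ℚ K = 2) [NumberField.IsTotallyComplex K] :
    (IsModularTheta.res (absDiscr K)
      ((NumberField.classNumber K : ℝ) / NumberField.Units.torsionOrder K) : ℂ) = quadL K 1 := by
  rw [quadL_one hK, IsModularTheta.res]
  congr 1
  have hD : (0 : ℝ) < absDiscr K := by exact_mod_cast absDiscr_pos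
  field_simp

theorem hasSum_dedekindZeta_nat (hK : Module.finrank ℚ K = 2) [NumberField.IsTotallyComplex K]
    {e : ℕ} (he : 2 ≤ e) :
    HasSum (fun n : ℕ+ ↦ ((idealCount K n : ℝ) : ℂ) / (n : ℂ) ^ e)
      (NumberField.dedekindZeta K e) := by
  have h : 1 < ((e : ℂ)).re := by
    rw [Complex.natCast_re]
    exact_mod_cast he
  simpa only [Complex.cpow_natCast, Complex.ofReal_natCast] using hasSum_dedekindZeta hK h

/-- The constant term equals L'(1, χ_D) because both are the limit of ζ_K(s) - L(1, χ_D) ζ(s) as s →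
1+: one from the Mellin transform, the other from ζ_K = ζ · L. -/
theorem exists_isModularTheta (hK : Module.finrank ℚ K = 2) [NumberField.IsTotallyComplex K] :
    ∃ S, IsModularTheta (fun n : ℕ+ ↦ (idealCount K n : ℝ)) (absDiscr K)
        ((NumberField.classNumber K : ℝ) / NumberField.Units.torsionOrder K) S ∧
      (IsModularTheta.constTerm (absDiscr K)
        ((NumberField.classNumber K : ℝ) / NumberField.Units.torsionOrder K) S : ℂ) =
          deriv (quadL K) 1 := by
  obtain ⟨S, hS, hmod⟩ := exists_hasSum_idealCount_exp hK
  have hre : ∀ s : ℝ, 1 < s → 1 < ((s : ℂ)).re := fun s hs ↦ by simpa using hs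
  have hterm : ∀ (s : ℝ) (n : ℕ+), (((n : ℝ) ^ s : ℝ) : ℂ) = (n : ℂ) ^ (s : ℂ) := fun s n ↦ by
    rw [Complex.ofReal_cpow (by positivity), Complex.ofReal_natCast]
  have hsum : ∀ s : ℝ, 1 < s → Summable fun n : ℕ+ ↦ (idealCount K n : ℝ) / (n : ℝ) ^ s :=
    fun s hs ↦ by
      rw [← Complex.summable_ofReal]
      refine (hasSum_dedekindZeta hK (hre s hs)).summable.congr fun n ↦ ?_
      rw [Complex.ofReal_div, hterm, Complex.ofReal_natCast]
  have h : IsModularTheta (fun n : ℕ+ ↦ (idealCount K n : ℝ)) (absDiscr K)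
      ((NumberField.classNumber K : ℝ) / NumberField.Units.torsionOrder K) S :=
    { D_pos := by exact_mod_cast absDiscr_pos
      const_nonneg := by positivity
      nonneg := fun n ↦ by positivity
      summable := hsum
      hasSum := hS
      modular := hmod }
  refine ⟨S, h, ?_⟩
  have h1 := (Complex.continuous_ofReal.tendsto _).comp h.tendsto_tsum_sub_res
  -- Both limits are real-variable limits from the right of 1, where the Dirichlet series converge
  -- termwise.
  refine tendsto_nhds_unique (h1.congr' ?_) (tendsto_dedekindZeta_sub hK)
  filter_upwards [self_mem_nhdsWithin] with s hs
  have h2 := (hasSum_dedekindZeta hK (hre s hs)).sub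
    ((hasSum_riemannZeta_pnat (hre s hs)).mul_left (quadL K 1))
  rw [← h2.tsum_eq, Function.comp, Complex.ofReal_tsum]
  refine tsum_congr fun n ↦ ?_
  rw [Complex.ofReal_div, hterm, Complex.ofReal_sub, res_eq_quadL_one hK, Complex.ofReal_natCast]
  ring

theorem sigmaK_neg_mul_exp (e : ℕ) (y : ℂ) (N : ℕ+) :
    sigmaK K (-(e : ℂ)) N * Complex.exp (-(N * y)) = ∑ d ∈ (N : ℕ).divisors,
      ((idealCount K d : ℝ) : ℂ) / (d : ℂ) ^ e * Complex.exp (-(d * (N / d : ℕ) * y)) := by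
  rw [sigmaK, Finset.sum_mul]
  refine Finset.sum_congr rfl fun d hd ↦ ?_
  have h1 : ((d : ℂ) * (N / d : ℕ)) = (N : ℂ) := by
    exact_mod_cast Nat.mul_div_cancel' (Nat.dvd_of_mem_divisors hd)
  rw [h1, Complex.cpow_neg, Complex.cpow_natCast, Complex.ofReal_natCast, ← div_eq_mul_inv]

/-- Dividing by N^e turns d^e into (N/d)^(-e), so the weight falls on the complementary divisor, the
column index k of the double series. -/
theorem sigmaK_div_pow_mul (e : ℕ) (F : ℕ → ℂ) (N : ℕ+) :
    sigmaK K (e : ℂ) N / (N : ℂ) ^ e * F N = ∑ d ∈ (N : ℕ).divisors,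
      ((idealCount K d : ℝ) : ℂ) / ((N / d : ℕ) : ℂ) ^ e * F (d * (N / d)) := by
  rw [sigmaK, Finset.sum_div, Finset.sum_mul]
  refine Finset.sum_congr rfl fun d hd ↦ ?_
  have h0 : d * (N / d) = (N : ℕ) := Nat.mul_div_cancel' (Nat.dvd_of_mem_divisors hd)
  have h1 : (N : ℂ) = (d : ℂ) * (N / d : ℕ) := by exact_mod_cast h0.symm
  have hd0 : (d : ℂ) ≠ 0 := by
    rintro h
    rw [h, zero_mul] at h1
    exact N.ne_zero (by exact_mod_cast h1)
  rw [h0, h1, Complex.cpow_natCast, Complex.ofReal_natCast, mul_pow]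
  congr 1
  rw [mul_comm (idealCount K d : ℂ), mul_div_mul_left _ _ (pow_ne_zero e hd0)]

/-- The arguments of the Kelvin functions in the two forms of the dual series agree. -/
theorem constA_mul_cpow_half {β : ℂ} (hβ : 0 < β.re) (d k : ℕ) :
    (constA K : ℂ) * (Real.pi * (d * k : ℕ) * β : ℂ) ^ (1 / 2 : ℂ) =
      ((4 * Real.pi / Real.sqrt (absDiscr K) * Real.sqrt d : ℝ) : ℂ) *
        (constA K * β / 2 * k) ^ (1 / 2 : ℂ) := by
  have hβ0 : β ≠ 0 := by rintro rfl; simp at hβ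
  have hD : (0 : ℝ) < absDiscr K := by exact_mod_cast absDiscr_pos
  have hpi := Real.pi_pos
  have hA : 0 < constA K := by rw [constA]; positivity
  have h1 : (Real.pi * (d * k : ℕ) * β : ℂ) = ((Real.pi * (d * k) : ℝ) : ℂ) * β := by
    push_cast; ring
  have h2 : (constA K * β / 2 * k : ℂ) = ((constA K / 2 * k : ℝ) : ℂ) * β := by
    push_cast; ring
  rw [h1, h2, ofReal_mul_cpow_half (by positivity) hβ0, ofReal_mul_cpow_half (by positivity) hβ0,
    ← mul_assoc (constA K : ℂ), ← mul_assoc (Complex.ofReal _) (Complex.ofReal _),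
    ← Complex.ofReal_mul, ← Complex.ofReal_mul]
  congr 2
  rw [Real.sqrt_mul hpi.le, Real.sqrt_mul (by positivity), Real.sqrt_mul (by positivity)]
  have h3 : Real.sqrt (constA K / 2) =
      2 * Real.sqrt Real.pi / Real.sqrt (absDiscr K) := by
    rw [constA, show 8 * Real.pi / absDiscr K / 2 = 2 ^ 2 * Real.pi / absDiscr K by ring,
      Real.sqrt_div (by positivity), Real.sqrt_mul (by positivity), Real.sqrt_sq (by norm_num)]
  have h4 := Real.sqrt_pos.mpr hD
  have h5 : constA K = 8 * Real.pi / (Real.sqrt (absDiscr K)) ^ 2 := by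
    rw [constA, Real.sq_sqrt hD.le]
  rw [h3, h5]
  field_simp
  ring

theorem re_constA_mul_div_two_pos {β : ℂ} (hβ : 0 < β.re) : 0 < (constA K * β / 2 : ℂ).re := by
  have hD : (0 : ℝ) < absDiscr K := by exact_mod_cast absDiscr_pos
  have hA : 0 < constA K := by rw [constA]; positivity
  have h1 : (constA K * β / 2 : ℂ) = ((constA K / 2 : ℝ) : ℂ) * β := by push_cast; ring
  rw [h1, Complex.re_ofReal_mul]
  positivity

theorem hasSum_sigmaK_exp (hK : Module.finrank ℚ K = 2) [NumberField.IsTotallyComplex K] {y : ℂ}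
    (hy : 0 < y.re) {e : ℕ} (he : 2 ≤ e) :
    HasSum (fun n : ℕ+ ↦ sigmaK K (-(e : ℂ)) n * Complex.exp (-(n * y)))
      (∑' p : ℕ+ × ℕ+, ((idealCount K p.1 : ℝ) : ℂ) / (p.1 : ℂ) ^ e *
        Complex.exp (-(p.1 * p.2 * y))) := by
  obtain ⟨S, h, -⟩ := exists_isModularTheta hK
  simp only [sigmaK_neg_mul_exp]
  exact hasSum_sum_divisors (g := fun d j ↦ ((idealCount K d : ℝ) : ℂ) / (d : ℂ) ^ e *
    Complex.exp (-(d * j * y))) (h.summable_exp_double hy he)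

theorem hasSum_sigmaK_kelvinKei (hK : Module.finrank ℚ K = 2) [NumberField.IsTotallyComplex K]
    {β : ℂ} (hβ : 0 < β.re) (e : ℕ) :
    HasSum (fun n : ℕ+ ↦ sigmaK K (e : ℂ) n / (n : ℂ) ^ e *
        kelvinKei (constA K * (Real.pi * n * β : ℂ) ^ (1 / 2 : ℂ)))
      (∑' p : ℕ+ × ℕ+, ((idealCount K p.1 : ℝ) : ℂ) / (p.2 : ℂ) ^ e *
        kelvinKei (((4 * Real.pi / Real.sqrt (absDiscr K) * Real.sqrt p.1 : ℝ) : ℂ) *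
          (constA K * β / 2 * p.2) ^ (1 / 2 : ℂ))) := by
  obtain ⟨S, h, -⟩ := exists_isModularTheta hK
  have hq : 0 < (constA K * β / 2 : ℂ).re := re_constA_mul_div_two_pos hβ
  simp only [sigmaK_div_pow_mul e
    (fun n ↦ kelvinKei (constA K * (Real.pi * n * β : ℂ) ^ (1 / 2 : ℂ))), constA_mul_cpow_half hβ]
  exact hasSum_sum_divisors (g := fun d k ↦ ((idealCount K d : ℝ) : ℂ) / (k : ℂ) ^ e *
    kelvinKei (((4 * Real.pi / Real.sqrt (absDiscr K) * Real.sqrt d : ℝ) : ℂ) *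
          (constA K * β / 2 * k) ^ (1 / 2 : ℂ))) (h.summable_kelvinKei_double hq e)

theorem hasSum_sigmaK_kelvinKer (hK : Module.finrank ℚ K = 2) [NumberField.IsTotallyComplex K]
    {β : ℂ} (hβ : 0 < β.re) (e : ℕ) :
    HasSum (fun n : ℕ+ ↦ sigmaK K (e : ℂ) n / (n : ℂ) ^ e *
        kelvinKer (constA K * (Real.pi * n * β : ℂ) ^ (1 / 2 : ℂ)))
      (∑' p : ℕ+ × ℕ+, ((idealCount K p.1 : ℝ) : ℂ) / (p.2 : ℂ) ^ e *
        kelvinKer (((4 * Real.pi / Real.sqrt (absDiscr K) * Real.sqrt p.1 : ℝ) : ℂ) *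
          (constA K * β / 2 * p.2) ^ (1 / 2 : ℂ))) := by
  obtain ⟨S, h, -⟩ := exists_isModularTheta hK
  have hq : 0 < (constA K * β / 2 : ℂ).re := re_constA_mul_div_two_pos hβ
  simp only [sigmaK_div_pow_mul e
    (fun n ↦ kelvinKer (constA K * (Real.pi * n * β : ℂ) ^ (1 / 2 : ℂ))), constA_mul_cpow_half hβ]
  exact hasSum_sum_divisors (g := fun d k ↦ ((idealCount K d : ℝ) : ℂ) / (k : ℂ) ^ e *
    kelvinKer (((4 * Real.pi / Real.sqrt (absDiscr K) * Real.sqrt d : ℝ) : ℂ) *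
          (constA K * β / 2 * k) ^ (1 / 2 : ℂ))) (h.summable_kelvinKer_double hq e)

/-- The Lambert series of odd exponent through the dual series. -/
theorem lambert_odd (hK : Module.finrank ℚ K = 2) [NumberField.IsTotallyComplex K] {m : ℕ}
    (hm : 1 ≤ m) {y β : ℂ} (hy : 0 < y.re) (hβ : 0 < β.re)
    (hyq : y * (constA K * β / 2) = 2 * Real.pi) :
    1 / 2 * NumberField.dedekindZeta K (2 * m + 1 : ℕ) +
      ∑' n : ℕ+, sigmaK K (-((2 * m + 1 : ℕ) : ℂ)) n * Complex.exp (-(n * y)) -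
      1 / y * NumberField.dedekindZeta K (2 * m + 2 : ℕ) =
    2 / y * ((-1) ^ m / (constA K * β / 2) ^ (2 * m) * (1 / (constA K * β / 2) *
      (Real.pi * quadL K 1 / 2 * riemannZeta (2 * m + 1 : ℕ) -
        4 * Real.pi / Real.sqrt (absDiscr K) *
          ∑' n : ℕ+, sigmaK K ((2 * m + 1 : ℕ) : ℂ) n / (n : ℂ) ^ (2 * m + 1) *
            kelvinKei (constA K * (Real.pi * n * β : ℂ) ^ (1 / 2 : ℂ)) -
        ((NumberField.classNumber K : ℝ) / NumberField.Units.torsionOrder K : ℝ) /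
          (constA K * β / 2) * riemannZeta (2 * m + 2 : ℕ))) +
      ∑ j ∈ Finset.Icc 1 m, (-1) ^ (m - j) / (constA K * β / 2) ^ (2 * (m - j + 1)) *
        NumberField.dedekindZeta K (2 * j : ℕ) * riemannZeta (2 * (m - j + 1) : ℕ)) := by
  obtain ⟨S, h, -⟩ := exists_isModularTheta hK
  have hq : 0 < (constA K * β / 2 : ℂ).re := re_constA_mul_div_two_pos hβ
  have h1 := h.lambert_eq hy hq hyq (show 2 ≤ 2 * m + 1 by omega)
  rw [Nat.add_sub_cancel, h.tsum_double_odd hq hm, res_eq_quadL_one hK,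
    (hasSum_dedekindZeta_nat hK (show 2 ≤ 2 * m + 1 by omega)).tsum_eq,
    (hasSum_dedekindZeta_nat hK (show 2 ≤ 2 * m + 1 + 1 by omega)).tsum_eq] at h1
  rw [(hasSum_sigmaK_exp hK hy (show 2 ≤ 2 * m + 1 by omega)).tsum_eq,
    (hasSum_sigmaK_kelvinKei hK hβ (2 * m + 1)).tsum_eq]
  have h2 : ∑ j ∈ Finset.Icc 1 m, (-1) ^ (m - j) / (constA K * β / 2) ^ (2 * (m - j + 1)) *
        NumberField.dedekindZeta K (2 * j : ℕ) * riemannZeta (2 * (m - j + 1) : ℕ) =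
      ∑ j ∈ Finset.Icc 1 m, (-1) ^ (m - j) / (constA K * β / 2) ^ (2 * (m - j + 1)) *
        (∑' d : ℕ+, ((idealCount K d : ℝ) : ℂ) / (d : ℂ) ^ (2 * j)) *
          riemannZeta (2 * (m - j + 1) : ℕ) := by
    refine Finset.sum_congr rfl fun j hj ↦ ?_
    rw [(hasSum_dedekindZeta_nat hK (by have := (Finset.mem_Icc.mp hj).1; omega)).tsum_eq]
  rw [h2]
  exact h1

/-- The Lambert series of even exponent through the dual series. -/
theorem lambert_even (hK : Module.finrank ℚ K = 2) [NumberField.IsTotallyComplex K] {m : ℕ}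
    (hm : 1 ≤ m) {y β : ℂ} (hy : 0 < y.re) (hβ : 0 < β.re)
    (hyq : y * (constA K * β / 2) = 2 * Real.pi) :
    1 / 2 * NumberField.dedekindZeta K (2 * m : ℕ) +
      ∑' n : ℕ+, sigmaK K (-((2 * m : ℕ) : ℂ)) n * Complex.exp (-(n * y)) -
      1 / y * NumberField.dedekindZeta K (2 * m + 1 : ℕ) =
    2 / y * ((-1) ^ (m - 1) / (constA K * β / 2) ^ (2 * (m - 1)) *
      (1 / (constA K * β / 2) ^ 2 *
      ((quadL K 1 * Complex.log (constA K * β / 2) +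
          (deriv (quadL K) 1 + quadL K 1 * Real.eulerMascheroniConstant)) *
          riemannZeta (2 * m : ℕ) - quadL K 1 * deriv riemannZeta (2 * m : ℕ) -
        4 * Real.pi / Real.sqrt (absDiscr K) *
          ∑' n : ℕ+, sigmaK K ((2 * m : ℕ) : ℂ) n / (n : ℂ) ^ (2 * m) *
            kelvinKer (constA K * (Real.pi * n * β : ℂ) ^ (1 / 2 : ℂ)))) +
      ∑ j ∈ Finset.Icc 1 (m - 1),
        (-1) ^ (m - 1 - j) / (constA K * β / 2) ^ (2 * (m - 1 - j + 1)) *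
        NumberField.dedekindZeta K (2 * j + 1 : ℕ) * riemannZeta (2 * (m - 1 - j + 1) : ℕ)) := by
  obtain ⟨S, h, hc⟩ := exists_isModularTheta hK
  have hq : 0 < (constA K * β / 2 : ℂ).re := re_constA_mul_div_two_pos hβ
  have h1 := h.lambert_eq hy hq hyq (show 2 ≤ 2 * m by omega)
  rw [h.tsum_double_even hq hm, res_eq_quadL_one hK, hc,
    (hasSum_dedekindZeta_nat hK (show 2 ≤ 2 * m by omega)).tsum_eq,
    (hasSum_dedekindZeta_nat hK (show 2 ≤ 2 * m + 1 by omega)).tsum_eq] at h1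
  rw [(hasSum_sigmaK_exp hK hy (show 2 ≤ 2 * m by omega)).tsum_eq,
    (hasSum_sigmaK_kelvinKer hK hβ (2 * m)).tsum_eq]
  have h2 : ∑ j ∈ Finset.Icc 1 (m - 1),
        (-1) ^ (m - 1 - j) / (constA K * β / 2) ^ (2 * (m - 1 - j + 1)) *
        NumberField.dedekindZeta K (2 * j + 1 : ℕ) * riemannZeta (2 * (m - 1 - j + 1) : ℕ) =
      ∑ j ∈ Finset.Icc 1 (m - 1),
        (-1) ^ (m - 1 - j) / (constA K * β / 2) ^ (2 * (m - 1 - j + 1)) *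
        (∑' d : ℕ+, ((idealCount K d : ℝ) : ℂ) / (d : ℂ) ^ (2 * j + 1)) *
          riemannZeta (2 * (m - 1 - j + 1) : ℕ) := by
    refine Finset.sum_congr rfl fun j hj ↦ ?_
    rw [(hasSum_dedekindZeta_nat hK (by have := (Finset.mem_Icc.mp hj).1; omega)).tsum_eq]
  rw [h2]
  exact h1

end

/-! ### Rewriting in terms of α and β -/

section

variable {K : Type*} [Field K] [NumberField K]

theorem ne_zero_of_re_pos {z : ℂ} (hz : 0 < z.re) : z ≠ 0 := by
  rintro rfl
  simp at hz

/-- Both arguments lie in (-π/2, π/2), so the logarithms add without crossing the branch cut. The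
even case uses this to trade √α for a constant over √β. -/
theorem cpow_half_mul_cpow_half {α β : ℂ} (hα : 0 < α.re) (hβ : 0 < β.re) {r : ℝ} (hr : 0 < r)
    (h : α * β = (r : ℂ) ^ 2) : α ^ (1 / 2 : ℂ) * β ^ (1 / 2 : ℂ) = r := by
  have hα0 := ne_zero_of_re_pos hα
  have hβ0 := ne_zero_of_re_pos hβ
  have ha := abs_lt.mp (Complex.abs_arg_lt_pi_div_two_iff.mpr (Or.inl hα))
  have hb := abs_lt.mp (Complex.abs_arg_lt_pi_div_two_iff.mpr (Or.inl hβ))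
  have hlog := Complex.log_mul hα0 hβ0 ⟨by linarith, by linarith⟩
  have hr0 : (r : ℂ) ≠ 0 := by exact_mod_cast hr.ne'
  rw [Complex.cpow_def_of_ne_zero hα0, Complex.cpow_def_of_ne_zero hβ0, ← Complex.exp_add,
    ← add_mul, ← hlog, h, ← Complex.ofReal_pow, ← Complex.ofReal_log (by positivity), Real.log_pow]
  rw [show ((((2 : ℕ) : ℝ) * Real.log r : ℝ) : ℂ) * (1 / 2) = (Real.log r : ℂ) by push_cast; ring,
    ← Complex.ofReal_exp, Real.exp_log hr]

/-- Even powers of q become powers of β/α; this is how the symmetric powers of α and β in the final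
formulas appear. -/
theorem sq_constA_mul_div_two {α β : ℂ} (hα : α ≠ 0)
    (hαβ : α * β = (absDiscr K : ℂ) ^ 2 / (16 * (Real.pi : ℂ) ^ 2)) :
    (constA K * β / 2 : ℂ) ^ 2 = β / α := by
  have hD : (absDiscr K : ℂ) ≠ 0 := by exact_mod_cast absDiscr_pos.ne'
  have hpi : (Real.pi : ℂ) ≠ 0 := by exact_mod_cast Real.pi_ne_zero
  have hA : (constA K : ℂ) = 8 * Real.pi / absDiscr K := by rw [constA]; push_cast; rfl
  rw [eq_div_iff hα, hA]
  have : (8 * Real.pi / absDiscr K * β / 2 : ℂ) ^ 2 * α =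
      16 * Real.pi ^ 2 / (absDiscr K) ^ 2 * β * (α * β) := by ring
  rw [this, hαβ]
  field_simp

theorem constA_mul_pi_mul_mul {α β : ℂ}
    (hαβ : α * β = (absDiscr K : ℂ) ^ 2 / (16 * (Real.pi : ℂ) ^ 2)) :
    (constA K * Real.pi * α : ℂ) * (constA K * β / 2) = 2 * Real.pi := by
  have hD : (absDiscr K : ℂ) ≠ 0 := by exact_mod_cast absDiscr_pos.ne'
  have hpi : (Real.pi : ℂ) ≠ 0 := by exact_mod_cast Real.pi_ne_zero
  have hA : (constA K : ℂ) = 8 * Real.pi / absDiscr K := by rw [constA]; push_cast; rfl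
  have : (constA K * Real.pi * α : ℂ) * (constA K * β / 2) =
      constA K ^ 2 * Real.pi / 2 * (α * β) := by ring
  rw [this, hαβ, hA]
  field_simp
  norm_num

theorem re_constA_mul_pi_mul_pos {α : ℂ} (hα : 0 < α.re) :
    0 < (constA K * Real.pi * α : ℂ).re := by
  have hD : (0 : ℝ) < absDiscr K := by exact_mod_cast absDiscr_pos
  have hA : 0 < constA K := by rw [constA]; positivity
  rw [← Complex.ofReal_mul, Complex.re_ofReal_mul]
  have := Real.pi_pos
  positivity

/-- The transformation formula for odd exponent. -/
theorem transformation_odd (hK : Module.finrank ℚ K = 2) [NumberField.IsTotallyComplex K] {m : ℕ}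
    (hm : 1 ≤ m) {α β : ℂ} (hα : 0 < α.re) (hβ : 0 < β.re)
    (hαβ : α * β = (absDiscr K : ℂ) ^ 2 / (16 * (Real.pi : ℂ) ^ 2)) :
    α ^ (-(m : ℤ)) *
        (1 / 2 * NumberField.dedekindZeta K (2 * m + 1)
          + ∑' n : ℕ+, sigmaK K (-2 * m - 1) n * Complex.exp (-(constA K * Real.pi * n * α))
          - 1 / (constA K * Real.pi * α) * NumberField.dedekindZeta K (2 * m + 2))
      = (-β) ^ (-(m : ℤ)) *
          (Real.pi * NumberField.classNumber K
              / (NumberField.Units.torsionOrder K * Real.sqrt (absDiscr K))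
              * riemannZeta (2 * m + 1)
            - 4 / Real.sqrt (absDiscr K) *
              ∑' n : ℕ+, sigmaK K (2 * m + 1) n / (n : ℂ) ^ (2 * m + 1) *
                kelvinKei (constA K * (Real.pi * n * β : ℂ) ^ (1 / 2 : ℂ))
            - 2 * NumberField.classNumber K
              / (NumberField.Units.torsionOrder K * constA K * Real.pi * β)
              * riemannZeta (2 * m + 2))
        + 4 / absDiscr K *
          ∑ k ∈ Finset.Icc 1 m, (-1) ^ (m - k) * riemannZeta (2 * m + 2 - 2 * k)
            * NumberField.dedekindZeta K (2 * k) * α ^ (1 - k : ℤ) * β ^ (k - m : ℤ) := by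
  have hα0 := ne_zero_of_re_pos hα
  have hβ0 := ne_zero_of_re_pos hβ
  have hpi : (Real.pi : ℂ) ≠ 0 := by exact_mod_cast Real.pi_ne_zero
  have hD : (0 : ℝ) < absDiscr K := by exact_mod_cast absDiscr_pos
  have hD0 : (absDiscr K : ℂ) ≠ 0 := by exact_mod_cast absDiscr_pos.ne'
  have hsD : (Real.sqrt (absDiscr K) : ℂ) ≠ 0 := by exact_mod_cast (Real.sqrt_pos.mpr hD).ne'
  have hA : (constA K : ℂ) = 8 * Real.pi / absDiscr K := by rw [constA]; push_cast; rfl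
  have hA0 : (constA K : ℂ) ≠ 0 := by rw [hA]; exact div_ne_zero (mul_ne_zero (by norm_num) hpi) hD0
  have hw : (NumberField.Units.torsionOrder K : ℂ) ≠ 0 := by
    exact_mod_cast NumberField.Units.torsionOrder_ne_zero K
  have hy := re_constA_mul_pi_mul_pos (K := K) hα
  have hyq := constA_mul_pi_mul_mul (K := K) hαβ
  have hq2 := sq_constA_mul_div_two hα0 hαβ
  have hq0 := ne_zero_of_re_pos (re_constA_mul_div_two_pos (K := K) hβ)
  have hy0 := ne_zero_of_re_pos hy
  have h2y : 2 / (constA K * Real.pi * α : ℂ) = (constA K * β / 2) / Real.pi := by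
    rw [div_eq_div_iff hy0 hpi]; linear_combination -hyq
  have h1 := lambert_odd hK hm hy hβ hyq
  have hexp : ∀ n : ℕ+, (constA K * Real.pi * n * α : ℂ) = n * (constA K * Real.pi * α) :=
    fun n ↦ by ring
  have c1 : ((2 * m + 1 : ℕ) : ℂ) = 2 * m + 1 := by push_cast; ring
  have c2 : ((2 * m + 2 : ℕ) : ℂ) = 2 * m + 2 := by push_cast; ring
  have c3 : (-2 * m - 1 : ℂ) = -(2 * m + 1) := by ring
  simp only [hexp, c3]
  rw [c1, c2] at h1
  rw [h1, h2y, mul_add, mul_add]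
  set q : ℂ := constA K * β / 2 with hq
  congr 1
  · rw [quadL_one hK, pow_mul, hq2]
    -- Eliminating A in favour of q lets all remaining odd powers of q cancel against the factor q/π
    -- in front.
    have hq' : (constA K : ℂ) = 2 * q / β := by rw [hq]; field_simp
    generalize ∑' n : ℕ+, sigmaK K (2 * m + 1) n / (n : ℂ) ^ (2 * m + 1) *
                kelvinKei (constA K * (Real.pi * n * β : ℂ) ^ (1 / 2 : ℂ)) = X
    rw [hq', zpow_neg, zpow_neg, zpow_natCast, zpow_natCast, neg_pow β, div_pow]
    -- The sign is its own inverse, so it passes through the negative power of -β.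
    have hsgn2 : ((-1 : ℂ) ^ m) * (-1) ^ m = 1 := by rw [← mul_pow]; norm_num
    have hinv : ((-1) ^ m * β ^ m : ℂ)⁻¹ = (-1) ^ m * (β ^ m)⁻¹ := by
      rw [mul_inv]
      congr 1
      exact inv_eq_of_mul_eq_one_left hsgn2
    rw [hinv]
    push_cast
    generalize ((-1 : ℂ) ^ m) = s
    field_simp
  · rw [← mul_assoc, Finset.mul_sum, Finset.mul_sum]
    refine Finset.sum_congr rfl fun k hk ↦ ?_
    obtain ⟨hk1, hkm⟩ := Finset.mem_Icc.mp hk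
    have c4 : ((2 * (m - k + 1) : ℕ) : ℂ) = 2 * m + 2 - 2 * k := by
      rw [Nat.cast_mul, Nat.cast_add, Nat.cast_sub hkm]; push_cast; ring
    have c5 : ((2 * k : ℕ) : ℂ) = 2 * k := by push_cast; ring
    rw [c4, c5, pow_mul, hq2, div_pow]
    have hqA : q = 4 * Real.pi * β / absDiscr K := by rw [hq, hA]; ring
    have e1 : α ^ (1 - k : ℤ) = α * (α ^ k)⁻¹ := by
      rw [zpow_sub₀ hα0, zpow_one, zpow_natCast, div_eq_mul_inv]
    have e2 : β ^ (k - m : ℤ) = β ^ k * (β ^ m)⁻¹ := by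
      rw [zpow_sub₀ hβ0, zpow_natCast, zpow_natCast, div_eq_mul_inv]
    have e3 : α ^ (m - k + 1) = α ^ m * (α ^ k)⁻¹ * α := by
      rw [pow_succ, pow_sub₀ _ hα0 hkm]
    have e4 : β ^ (m - k + 1) = β ^ m * (β ^ k)⁻¹ * β := by
      rw [pow_succ, pow_sub₀ _ hβ0 hkm]
    rw [e1, e2, e3, e4, hqA, zpow_neg, zpow_natCast]
    field_simp

/-- The transformation formula for even exponent. -/
theorem transformation_even (hK : Module.finrank ℚ K = 2) [NumberField.IsTotallyComplex K] {m : ℕ}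
    (hm : 1 ≤ m) {α β : ℂ} (hα : 0 < α.re) (hβ : 0 < β.re)
    (hαβ : α * β = (absDiscr K : ℂ) ^ 2 / (16 * (Real.pi : ℂ) ^ 2)) :
    α ^ (-((m : ℂ) - 1 / 2)) *
        (1 / 2 * NumberField.dedekindZeta K (2 * m)
          + ∑' n : ℕ+, sigmaK K (-2 * m) n * Complex.exp (-(constA K * Real.pi * n * α))
          - 1 / (constA K * Real.pi * α) * NumberField.dedekindZeta K (2 * m + 1))
      = (-1) ^ (m + 1) * β ^ (-((m : ℂ) - 1 / 2)) *
          (1 / Real.pi * riemannZeta (2 * m)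
              * ((Real.eulerMascheroniConstant + Complex.log (constA K * β / 2)) * quadL K 1
                + deriv (quadL K) 1)
            - 4 / Real.sqrt (absDiscr K) *
              ∑' n : ℕ+, sigmaK K (2 * m) n / (n : ℂ) ^ (2 * m) *
                kelvinKer (constA K * (Real.pi * n * β : ℂ) ^ (1 / 2 : ℂ))
            - 2 * NumberField.classNumber K
              / (NumberField.Units.torsionOrder K * Real.sqrt (absDiscr K))
              * deriv riemannZeta (2 * m))
        + 1 / Real.pi *
          ∑ k ∈ Finset.Icc 1 (m - 1), (-1) ^ (m - 1 - k) * riemannZeta (2 * m - 2 * k)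
            * NumberField.dedekindZeta K (2 * k + 1) * α ^ (-(k : ℤ))
            * β ^ ((k : ℂ) - m + 1 / 2) := by
  have hα0 := ne_zero_of_re_pos hα
  have hβ0 := ne_zero_of_re_pos hβ
  have hpi : (Real.pi : ℂ) ≠ 0 := by exact_mod_cast Real.pi_ne_zero
  have hD : (0 : ℝ) < absDiscr K := by exact_mod_cast absDiscr_pos
  have hD0 : (absDiscr K : ℂ) ≠ 0 := by exact_mod_cast absDiscr_pos.ne'
  have hsD : (Real.sqrt (absDiscr K) : ℂ) ≠ 0 := by exact_mod_cast (Real.sqrt_pos.mpr hD).ne'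
  have hA : (constA K : ℂ) = 8 * Real.pi / absDiscr K := by rw [constA]; push_cast; rfl
  have hw : (NumberField.Units.torsionOrder K : ℂ) ≠ 0 := by
    exact_mod_cast NumberField.Units.torsionOrder_ne_zero K
  have hy := re_constA_mul_pi_mul_pos (K := K) hα
  have hyq := constA_mul_pi_mul_mul (K := K) hαβ
  have hq2 := sq_constA_mul_div_two hα0 hαβ
  have hy0 := ne_zero_of_re_pos hy
  have h2y : 2 / (constA K * Real.pi * α : ℂ) = 4 * β / absDiscr K := by
    have : 2 / (constA K * Real.pi * α : ℂ) = (constA K * β / 2) / Real.pi := by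
      rw [div_eq_div_iff hy0 hpi]; linear_combination -hyq
    rw [this, hA]
    field_simp
    norm_num
  have hhalf : α ^ (1 / 2 : ℂ) * β ^ (1 / 2 : ℂ) = absDiscr K / (4 * Real.pi) := by
    have hpi' := Real.pi_pos
    rw [cpow_half_mul_cpow_half hα hβ (r := absDiscr K / (4 * Real.pi)) (by positivity)
      (by rw [hαβ]; push_cast; ring)]
    push_cast
    rfl
  have hβh0 : β ^ (1 / 2 : ℂ) ≠ 0 := by simp [Complex.cpow_eq_zero_iff, hβ0]
  have hβh : β ^ (1 / 2 : ℂ) * β ^ (1 / 2 : ℂ) = β := by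
    rw [← Complex.cpow_add _ _ hβ0]; norm_num
  -- From here on √β is the only half-integral power left.
  have hαh : α ^ (1 / 2 : ℂ) = absDiscr K / (4 * Real.pi) / β ^ (1 / 2 : ℂ) := by
    rw [eq_div_iff hβh0, hhalf]
  have hαm : α ^ (-((m : ℂ) - 1 / 2)) = (α ^ m)⁻¹ * α ^ (1 / 2 : ℂ) := by
    rw [neg_sub, Complex.cpow_sub _ _ hα0, Complex.cpow_natCast]; ring
  have hβm : β ^ (-((m : ℂ) - 1 / 2)) = (β ^ m)⁻¹ * β ^ (1 / 2 : ℂ) := by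
    rw [neg_sub, Complex.cpow_sub _ _ hβ0, Complex.cpow_natCast]; ring
  have h1 := lambert_even hK hm hy hβ hyq
  have hexp : ∀ n : ℕ+, (constA K * Real.pi * n * α : ℂ) = n * (constA K * Real.pi * α) :=
    fun n ↦ by ring
  have c1 : ((2 * m : ℕ) : ℂ) = 2 * m := by push_cast; ring
  have c2 : ((2 * m + 1 : ℕ) : ℂ) = 2 * m + 1 := by push_cast; ring
  have c3 : (-2 * m : ℂ) = -(2 * m) := by ring
  simp only [hexp, c3]
  rw [c1, c2] at h1
  rw [h1, h2y, mul_add, mul_add, hαm, hβm, hαh]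
  set H : ℂ := β ^ (1 / 2 : ℂ) with hH
  obtain ⟨M, rfl⟩ : ∃ M, m = M + 1 := ⟨m - 1, by omega⟩
  simp only [Nat.add_sub_cancel]
  set q : ℂ := constA K * β / 2 with hq
  congr 1
  · generalize ∑' n : ℕ+, sigmaK K (2 * (M + 1 : ℕ)) n / (n : ℂ) ^ (2 * (M + 1)) *
                kelvinKer (constA K * (Real.pi * n * β : ℂ) ^ (1 / 2 : ℂ)) = X
    generalize riemannZeta (2 * (M + 1 : ℕ)) = Z
    have hL : 2 * NumberField.classNumber K
        / (NumberField.Units.torsionOrder K * Real.sqrt (absDiscr K)) *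
          deriv riemannZeta (2 * (M + 1 : ℕ)) =
        quadL K 1 / Real.pi * deriv riemannZeta (2 * (M + 1 : ℕ)) := by
      rw [quadL_one hK]
      push_cast
      field_simp
    rw [hL]
    generalize deriv riemannZeta (2 * (M + 1 : ℕ)) = Z'
    have hs : (-1 : ℂ) ^ (M + 1 + 1) = (-1) ^ M := by rw [pow_succ, pow_succ]; ring
    rw [hs, pow_mul, hq2, div_pow, pow_succ, pow_succ]
    generalize ((-1 : ℂ) ^ M) = s
    generalize quadL K 1 = L₁
    generalize Complex.log q = lq
    generalize deriv (quadL K) 1 = L'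
    generalize (Real.eulerMascheroniConstant : ℂ) = γ
    -- Once H = √β is a free variable and β is replaced by H², the claim is an identity of rational
    -- functions.
    clear_value H q
    clear hhalf hαh hαm hβm h1 hL
    subst hβh
    have hαm0 := pow_ne_zero M hα0
    have hHm0 := pow_ne_zero M hβ0
    field_simp
    ring
  · rw [← mul_assoc, Finset.mul_sum, Finset.mul_sum]
    refine Finset.sum_congr rfl fun k hk ↦ ?_
    obtain ⟨hk1, hkm⟩ := Finset.mem_Icc.mp hk
    have c4 : ((2 * (M - k + 1) : ℕ) : ℂ) = 2 * (M + 1 : ℕ) - 2 * k := by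
      rw [Nat.cast_mul, Nat.cast_add, Nat.cast_sub hkm]; push_cast; ring
    have c5 : ((2 * k + 1 : ℕ) : ℂ) = 2 * k + 1 := by push_cast; ring
    rw [c4, c5, pow_mul, hq2, div_pow]
    have e2 : β ^ ((k : ℂ) - (M + 1 : ℕ) + 1 / 2) = β ^ k * (β ^ (M + 1))⁻¹ * H := by
      rw [Complex.cpow_add _ _ hβ0, Complex.cpow_sub _ _ hβ0, Complex.cpow_natCast,
        Complex.cpow_natCast, div_eq_mul_inv]
    have e3 : α ^ (M - k + 1) = α ^ (M + 1) * (α ^ k)⁻¹ := by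
      rw [pow_succ, pow_sub₀ _ hα0 hkm]; ring
    have e4 : β ^ (M - k + 1) = β ^ (M + 1) * (β ^ k)⁻¹ := by
      rw [pow_succ, pow_sub₀ _ hβ0 hkm]; ring
    rw [e2, e3, e4, zpow_neg, zpow_natCast]
    have hb : 4 * β / absDiscr K = 4 * (H * H) / absDiscr K := by rw [hβh]
    rw [hb]
    field_simp

end

end

/-! ### Convergence and the two transformation formulas -/

theorem mainTheorem1 (K : Type*) [Field K] [NumberField K]
    (hK : Module.finrank ℚ K = 2) [NumberField.IsTotallyComplex K]
    (m : ℕ) (hm : 1 ≤ m) (α β : ℂ) (hα : 0 < α.re) (hβ : 0 < β.re)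
    (hαβ : α * β = (absDiscr K : ℂ) ^ 2 / (16 * (Real.pi : ℂ) ^ 2)) :
    -- absolute convergence of the four infinite series
    (Summable fun n : ℕ+ =>
      sigmaK K (-2 * m - 1) n * Complex.exp (-(constA K * Real.pi * n * α))) ∧
    (Summable fun n : ℕ+ =>
      sigmaK K (2 * m + 1) n / (n : ℂ) ^ (2 * m + 1) *
        kelvinKei (constA K * (Real.pi * n * β : ℂ) ^ (1 / 2 : ℂ))) ∧
    (Summable fun n : ℕ+ =>
      sigmaK K (-2 * m) n * Complex.exp (-(constA K * Real.pi * n * α))) ∧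
    (Summable fun n : ℕ+ =>
      sigmaK K (2 * m) n / (n : ℂ) ^ (2 * m) *
        kelvinKer (constA K * (Real.pi * n * β : ℂ) ^ (1 / 2 : ℂ))) ∧
    -- the identity for the exponent `-2m-1`
    α ^ (-(m : ℤ)) *
        (1 / 2 * NumberField.dedekindZeta K (2 * m + 1)
          + ∑' n : ℕ+, sigmaK K (-2 * m - 1) n * Complex.exp (-(constA K * Real.pi * n * α))
          - 1 / (constA K * Real.pi * α) * NumberField.dedekindZeta K (2 * m + 2))
      = (-β) ^ (-(m : ℤ)) *
          (Real.pi * NumberField.classNumber K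
              / (NumberField.Units.torsionOrder K * Real.sqrt (absDiscr K))
              * riemannZeta (2 * m + 1)
            - 4 / Real.sqrt (absDiscr K) *
              ∑' n : ℕ+, sigmaK K (2 * m + 1) n / (n : ℂ) ^ (2 * m + 1) *
                kelvinKei (constA K * (Real.pi * n * β : ℂ) ^ (1 / 2 : ℂ))
            - 2 * NumberField.classNumber K
              / (NumberField.Units.torsionOrder K * constA K * Real.pi * β)
              * riemannZeta (2 * m + 2))
        + 4 / absDiscr K *
          ∑ k ∈ Finset.Icc 1 m, (-1) ^ (m - k) * riemannZeta (2 * m + 2 - 2 * k)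
            * NumberField.dedekindZeta K (2 * k) * α ^ (1 - k : ℤ) * β ^ (k - m : ℤ) ∧
    -- the identity for the exponent `-2m`
    α ^ (-((m : ℂ) - 1 / 2)) *
        (1 / 2 * NumberField.dedekindZeta K (2 * m)
          + ∑' n : ℕ+, sigmaK K (-2 * m) n * Complex.exp (-(constA K * Real.pi * n * α))
          - 1 / (constA K * Real.pi * α) * NumberField.dedekindZeta K (2 * m + 1))
      = (-1) ^ (m + 1) * β ^ (-((m : ℂ) - 1 / 2)) *
          (1 / Real.pi * riemannZeta (2 * m)
              * ((Real.eulerMascheroniConstant + Complex.log (constA K * β / 2)) * quadL K 1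
                + deriv (quadL K) 1)
            - 4 / Real.sqrt (absDiscr K) *
              ∑' n : ℕ+, sigmaK K (2 * m) n / (n : ℂ) ^ (2 * m) *
                kelvinKer (constA K * (Real.pi * n * β : ℂ) ^ (1 / 2 : ℂ))
            - 2 * NumberField.classNumber K
              / (NumberField.Units.torsionOrder K * Real.sqrt (absDiscr K))
              * deriv riemannZeta (2 * m))
        + 1 / Real.pi *
          ∑ k ∈ Finset.Icc 1 (m - 1), (-1) ^ (m - 1 - k) * riemannZeta (2 * m - 2 * k)
            * NumberField.dedekindZeta K (2 * k + 1) * α ^ (-(k : ℤ))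
            * β ^ ((k : ℂ) - m + 1 / 2) := by
  have hexp : ∀ n : ℕ+, (constA K * Real.pi * n * α : ℂ) = n * (constA K * Real.pi * α) :=
    fun n ↦ by ring
  have hy := re_constA_mul_pi_mul_pos (K := K) hα
  refine ⟨?_, ?_, ?_, ?_, transformation_odd hK hm hα hβ hαβ, transformation_even hK hm hα hβ hαβ⟩
  · have h := (hasSum_sigmaK_exp hK hy (show 2 ≤ 2 * m + 1 by omega)).summable
    rw [show -((2 * m + 1 : ℕ) : ℂ) = -2 * m - 1 by push_cast; ring] at h
    simpa only [hexp] using h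
  · have h := (hasSum_sigmaK_kelvinKei hK hβ (2 * m + 1)).summable
    rwa [show ((2 * m + 1 : ℕ) : ℂ) = 2 * m + 1 by push_cast; ring] at h
  · have h := (hasSum_sigmaK_exp hK hy (show 2 ≤ 2 * m by omega)).summable
    rw [show -((2 * m : ℕ) : ℂ) = -2 * m by push_cast; ring] at h
    simpa only [hexp] using h
  · have h := (hasSum_sigmaK_kelvinKer hK hβ (2 * m)).summable
    rwa [show ((2 * m : ℕ) : ℂ) = 2 * m by push_cast; ring] at h
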